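/- Let $B$ be a unital $C^*$-algebra, let $I$ be a set with at least two elements, and for every $\iota\in I$ let $A_\iota$ be a unital $C^*$-algebra containing a copy of $B$ as a unital $C^*$-subalgebra and let $\phi_\iota:A_\iota\to B$ be a conditional expectation such that for every $a\in A_\iota\setminus\{0\}$ there is $x\in A_\iota$ with $\phi_\iota(x^*a^*ax)\neq 0$. For a Hilbert $B$-module $X$ let $\mathcal L(X)$ denote the $C^*$-algebra of adjointable operators on $X$. Let $E_\iota=L^2(A_\iota,\phi_\iota)$ be the right Hilbert $B$-module obtained from $A_\iota$ by separation and completion with respect to the $B$-valued inner product $\langle a_1,a_2\rangle=\phi_\iota(a_1^*a_2)$, let $\hat a\in E_\iota$ be the image of $a\in A_\iota$, let $\pi_\iota:A_\iota\to\mathcal L(E_\iota)$, $\pi_\iota(a)\hat b=\widehat{ab}$, let $\xi_\iota=\hat 1$, and let $E_\iota^\circ=\{x\in E_\iota:\langle\xi_\iota,x\rangle=0\}$, with the left action of $B$ given by the restriction of $\pi_\iota$. Let $$E=\xi B\oplus\bigoplus_{\substack{n\ge 1,\ \iota_1,\dots,\iota_n\in I\\ \iota_1\ne\iota_2,\dots,\iota_{n-1}\neq\iota_n}}E_{\iota_1}^\circ\otimes_B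 E_{\iota_2}^\circ\otimes_B\cdots\otimes_B E_{\iota_n}^\circ$$ be the free product of the modules $E_\iota$ (with internal tensor products), where $\xi B$ is $B$ considered as a Hilbert $B$-module with $\xi=1_B$. For $\iota\in I$ let $E(\iota)\subseteq E$ be the submodule consisting of $\xi B$ and of the summands with $\iota_1\ne\iota$, let $V_\iota:E_\iota\otimes_BE(\iota)\to E$ be the unitary with $V_\iota(\xi_\iota\otimes v)=v$ for $v\in E(\iota)$, and, for $\zeta\in E_\iota^\circ$, $V_\iota(\zeta\otimes\xi)=\zeta$ and $V_\iota(\zeta\otimes(\zeta_1\otimes\cdots\otimes\zeta_n))=\zeta\otimes\zeta_1\otimes\cdots\otimes\zeta_n$; let $\lambda_\iota:A_\iota\to\mathcal L(E)$, $\lambda_\iota(a)=V_\iota(\pi_\iota(a)\otimes 1)V_\iota^*$. The reduced amalgamated free product $A$ of the $(A_\iota,\phi_\iota)$ is the $C^*$-subalgebra of $\mathcal L(E)$ generated by $\bigcup_{\iota\in I}\lambda_\iota(A_\iota)$. For an integer $k\ge 0$ let $E_{(\to k)}\subseteq E$ be the submodule consisting of $\xi B$ and of the summands with $n\le k$, let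 $P_k\in\mathcal L(E)$ be the projection onto it, and let $\Phi_k:\mathcal L(E)\to\mathcal L(E_{(\to k)})$, $\Phi_k(x)=P_kx|_{E_{(\to k)}}$, be the compression. Then there are unital completely positive maps $\Psi_k:\mathcal L(E_{(\to k)})\to\mathcal L(E)$, $k\ge 0$, such that $$\lim_{k\to\infty}\|a-\Psi_k(\Phi_k(a))\|=0\qquad\text{for every }a\in A.$$ -/

import Mathlib

set_option linter.unusedSectionVars false

noncomputable section

namespace FreeProd

open UniformSpace MulOpposite

/-! ### Semi-inner-product modules and their Hausdorff completions -/

/-- A module `V` over `C` with a positive semidefinite `C`-valued sesquilinear form, in the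
convention of Mathlib's `CStarModule`: conjugate linear in the first variable, and
`form x (c • y) = c * form x y`. -/
class PreCStarModule (C V : Type*) [CStarAlgebra C] [PartialOrder C]
    [AddCommGroup V] [Module ℂ V] [Module C V] where
  form : V → V → C
  form_add_right (x y z : V) : form x (y + z) = form x y + form x z
  form_smul_right (c : C) (x y : V) : form x (c • y) = c * form x y
  form_complex_smul_right (z : ℂ) (x y : V) : form x (z • y) = z • form x y
  star_form (x y : V) : star (form x y) = form y x
  form_self_nonneg (x : V) : 0 ≤ form x x

open PreCStarModule

/-- `V` regarded as a seminormed space, with `‖x‖ = ‖form x x‖ ^ (1/2)`. -/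
@[nolint unusedArguments]
def WithForm (C V : Type*) [CStarAlgebra C] [PartialOrder C]
    [AddCommGroup V] [Module ℂ V] [Module C V] [PreCStarModule C V] : Type _ := V

section Pre

variable {C : Type*} [CStarAlgebra C] [PartialOrder C]
  {V : Type*} [AddCommGroup V] [Module ℂ V] [Module C V] [PreCStarModule C V]

theorem form_add_left (x y z : V) : form (C := C) (x + y) z = form x z + form y z := by
  rw [← star_form, form_add_right, star_add, star_form, star_form]

theorem form_complex_smul_left (w : ℂ) (x y : V) :
    form (C := C) (w • x) y = star w • form x y := by
  rw [← star_form, form_complex_smul_right, star_smul, star_form]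

theorem form_smul_left (c : C) (x y : V) : form (c • x) y = form x y * star c := by
  rw [← star_form, form_smul_right, star_mul, star_form]

theorem form_zero_right (x : V) : form (C := C) x 0 = 0 := by
  simpa using form_complex_smul_right (C := C) 0 x (0 : V)

theorem form_zero_left (x : V) : form (C := C) 0 x = 0 := by
  simpa using form_complex_smul_left (C := C) 0 (0 : V) x

theorem form_sub_right (x y z : V) : form (C := C) x (y - z) = form x y - form x z := by
  have h : y - z = y + (-1 : ℂ) • z := by rw [neg_one_smul, sub_eq_add_neg]
  rw [h, form_add_right, form_complex_smul_right, neg_one_smul, sub_eq_add_neg]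

theorem form_sub_left (x y z : V) : form (C := C) (x - y) z = form x z - form y z := by
  rw [← star_form, form_sub_right, star_sub, star_form, star_form]

instance : AddCommGroup (WithForm C V) := inferInstanceAs (AddCommGroup V)
instance : Module ℂ (WithForm C V) := inferInstanceAs (Module ℂ V)
instance : Module C (WithForm C V) := inferInstanceAs (Module C V)
instance : PreCStarModule C (WithForm C V) := inferInstanceAs (PreCStarModule C V)
instance : Inner C (WithForm C V) := ⟨form (V := V)⟩
instance : Norm (WithForm C V) := ⟨fun x => √‖form (C := C) x x‖⟩

theorem WithForm.norm_def (x : WithForm C V) : ‖x‖ = √‖form (C := C) x x‖ := rfl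

theorem WithForm.norm_sq (x : WithForm C V) : ‖x‖ ^ 2 = ‖form (C := C) x x‖ :=
  Real.sq_sqrt (norm_nonneg _)

variable [StarOrderedRing C]

theorem form_mul_form_le (x y : V) {t : ℝ} (ht : ‖form (C := C) x x‖ ≤ t) (ht0 : 0 < t) :
    form (C := C) x y * form y x ≤ t • form y y := by
  have key : (0 : C) ≤ form ((t : ℂ) • y - form (C := C) x y • x)
      ((t : ℂ) • y - form (C := C) x y • x) := form_self_nonneg _
  have h2 : form (C := C) x y * form x x * star (form (C := C) x y)
      ≤ t • (form (C := C) x y * star (form (C := C) x y)) := by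
    refine (CStarAlgebra.star_right_conjugate_le_norm_smul
      (hb := IsSelfAdjoint.of_nonneg (form_self_nonneg x))).trans ?_
    exact smul_le_smul_of_nonneg_right ht (mul_star_self_nonneg _)
  have h3 : form (C := C) ((t : ℂ) • y - form (C := C) x y • x)
      ((t : ℂ) • y - form (C := C) x y • x)
      = t • (t • form y y - form (C := C) x y * form y x)
        + (form (C := C) x y * form x x * star (form (C := C) x y)
          - t • (form (C := C) x y * star (form (C := C) x y))) := by
    simp only [form_sub_left, form_sub_right, form_complex_smul_left, form_complex_smul_right,
      form_smul_left, form_smul_right, star_form]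
    simp only [Complex.star_def, Complex.conj_ofReal, Complex.coe_smul, mul_smul_comm, smul_sub,
      mul_assoc, mul_sub]
    abel
  rw [h3] at key
  have h4 : (0 : C) ≤ t • (t • form y y - form (C := C) x y * form y x) := by
    refine key.trans ?_
    rw [add_le_iff_nonpos_right, sub_nonpos]
    exact h2
  have h5 := smul_nonneg (inv_nonneg.mpr ht0.le) h4
  rw [smul_smul, inv_mul_cancel₀ ht0.ne', one_smul, sub_nonneg] at h5
  exact h5

theorem norm_form_sq_le (x y : V) :
    ‖form (C := C) x y‖ ^ 2 ≤ ‖form (C := C) x x‖ * ‖form (C := C) y y‖ := by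
  have key : ∀ t : ℝ, ‖form (C := C) x x‖ < t →
      ‖form (C := C) x y‖ ^ 2 ≤ t * ‖form (C := C) y y‖ := by
    intro t ht
    have ht0 : 0 < t := (norm_nonneg _).trans_lt ht
    have h1 : ‖form (C := C) x y * form y x‖ ≤ ‖t • form (C := C) y y‖ := by
      refine CStarAlgebra.norm_le_norm_of_nonneg_of_le ?_ (form_mul_form_le x y ht.le ht0)
      rw [← star_form x y]
      exact mul_star_self_nonneg _
    rw [← star_form x y, CStarRing.norm_self_mul_star, norm_smul, Real.norm_of_nonneg ht0.le] at h1
    rwa [sq]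
  have hlim : Filter.Tendsto (fun t : ℝ => t * ‖form (C := C) y y‖)
      (nhdsWithin ‖form (C := C) x x‖ (Set.Ioi ‖form (C := C) x x‖))
      (nhds (‖form (C := C) x x‖ * ‖form (C := C) y y‖)) :=
    ((continuous_id.mul continuous_const).tendsto _).mono_left nhdsWithin_le_nhds
  exact ge_of_tendsto hlim (Filter.eventually_of_mem self_mem_nhdsWithin fun t ht => key t ht)

theorem WithForm.norm_form_le (x y : WithForm C V) : ‖form (C := C) x y‖ ≤ ‖x‖ * ‖y‖ := by
  rw [WithForm.norm_def, WithForm.norm_def, ← Real.sqrt_mul (norm_nonneg _)]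
  exact Real.le_sqrt_of_sq_le (norm_form_sq_le x y)

theorem WithForm.core : SeminormedSpace.Core ℂ (WithForm C V) where
  norm_nonneg x := Real.sqrt_nonneg _
  norm_smul z x := by
    rw [WithForm.norm_def, form_complex_smul_left, form_complex_smul_right, norm_smul, norm_smul,
      norm_star, ← mul_assoc, Real.sqrt_mul (by positivity), Real.sqrt_mul_self (norm_nonneg _)]
    rfl
  norm_triangle x y := by
    have h0 (z : WithForm C V) : 0 ≤ ‖z‖ := Real.sqrt_nonneg _
    refine abs_le_of_sq_le_sq' ?_ (add_nonneg (h0 x) (h0 y)) |>.2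
    rw [WithForm.norm_sq, form_add_left, form_add_right, form_add_right]
    have h1 := WithForm.norm_form_le x y
    have h2 := WithForm.norm_form_le y x
    have h3 := (WithForm.norm_sq x).ge
    have h4 := (WithForm.norm_sq y).ge
    calc _ ≤ ‖form (C := C) x x‖ + ‖form (C := C) x y‖
          + (‖form (C := C) y x‖ + ‖form (C := C) y y‖) :=
          (norm_add_le _ _).trans (add_le_add (norm_add_le _ _) (norm_add_le _ _))
      _ ≤ (‖x‖ + ‖y‖) ^ 2 := by linarith

instance : SeminormedAddCommGroup (WithForm C V) := SeminormedAddCommGroup.ofCore WithForm.core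
instance : NormedSpace ℂ (WithForm C V) where
  norm_smul_le z x := (WithForm.core.norm_smul z x).le

instance : UniformContinuousConstSMul C (WithForm C V) where
  uniformContinuous_const_smul c := by
    have h : ∀ x : WithForm C V, ‖c • x‖ ≤ ‖c‖ * ‖x‖ := by
      intro x
      refine abs_le_of_sq_le_sq' ?_ (by positivity) |>.2
      rw [mul_pow, WithForm.norm_sq, WithForm.norm_sq, form_smul_left, form_smul_right]
      calc _ ≤ ‖c‖ * ‖form (C := C) x x‖ * ‖star c‖ :=
            (norm_mul_le _ _).trans (mul_le_mul_of_nonneg_right (norm_mul_le _ _) (norm_nonneg _))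
        _ = _ := by rw [norm_star]; ring
    exact (AddMonoidHomClass.lipschitz_of_bound
      (DistribSMul.toAddMonoidHom (WithForm C V) c) ‖c‖ h).uniformContinuous

end Pre

/-- The Hausdorff completion of a semi-inner-product module ("separation and completion"). -/
abbrev HilbertCompletion (C V : Type*) [CStarAlgebra C] [PartialOrder C] [StarOrderedRing C]
    [AddCommGroup V] [Module ℂ V] [Module C V] [PreCStarModule C V] : Type _ :=
  Completion (WithForm C V)

section Completion

variable {C : Type*} [CStarAlgebra C] [PartialOrder C] [StarOrderedRing C]
  {V : Type*} [AddCommGroup V] [Module ℂ V] [Module C V] [PreCStarModule C V]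
  {W : Type*} [AddCommGroup W] [Module ℂ W] [Module C W] [PreCStarModule C W]

/-- The canonical map from a semi-inner-product module to its Hausdorff completion. -/
def toHilbert (x : V) : HilbertCompletion C V :=
  let y : WithForm C V := x
  (y : Completion (WithForm C V))

theorem continuous_form :
    Continuous fun p : WithForm C V × WithForm C V => form (C := C) p.1 p.2 := by
  let L : WithForm C V →ₗ⋆[ℂ] WithForm C V →ₗ[ℂ] C :=
    { toFun := fun x =>
        { toFun := fun y => form x y
          map_add' := fun y z => form_add_right x y z
          map_smul' := fun z y => form_complex_smul_right z x y }
      map_add' := fun x y => by ext z; exact form_add_left x y z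
      map_smul' := fun w x => by ext z; exact form_complex_smul_left w x z }
  let L' := LinearMap.mkContinuous₂ L 1 fun x y => by
    rw [one_mul]; exact WithForm.norm_form_le x y
  have : Continuous fun p : WithForm C V × WithForm C V => L' p.1 p.2 := by fun_prop
  exact this

theorem inner_toHilbert (x y : V) :
    inner C (toHilbert (C := C) x) (toHilbert (C := C) y) = form x y :=
  ((Completion.isDenseInducing_coe (α := WithForm C V)).prodMap
    (Completion.isDenseInducing_coe (α := WithForm C V))).extend_eq
    (continuous_form (C := C) (V := V)) (x, y)

theorem continuous_inner_completion :
    Continuous fun p : HilbertCompletion C V × HilbertCompletion C V => inner C p.1 p.2 := by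
  let L : WithForm C V →+ WithForm C V →+ C :=
    { toFun := fun x =>
        { toFun := fun y => form x y
          map_zero' := form_zero_right x
          map_add' := fun y z => form_add_right x y z }
      map_zero' := by ext z; exact form_zero_left z
      map_add' := fun x y => by ext z; exact form_add_left x y z }
  have hL : Continuous fun p : WithForm C V × WithForm C V => L p.1 p.2 := continuous_form
  exact (Completion.isDenseInducing_toCompl (WithForm C V)).extend_Z_bilin
    (Completion.isDenseInducing_toCompl (WithForm C V)) hL

theorem cont_inner {α : Type*} [TopologicalSpace α] {f g : α → HilbertCompletion C V}
    (hf : Continuous f) (hg : Continuous g) : Continuous fun a => inner C (f a) (g a) :=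
  continuous_inner_completion.comp (hf.prodMk hg)

theorem hilbert_induction {p : HilbertCompletion C V → Prop} (x : HilbertCompletion C V)
    (hp : IsClosed {x | p x}) (h : ∀ x : V, p (toHilbert x)) : p x :=
  Completion.induction_on x hp h

theorem inner_self_nonneg_completion (x : HilbertCompletion C V) : 0 ≤ inner C x x := by
  refine hilbert_induction x (isClosed_Ici.preimage (cont_inner continuous_id continuous_id))
    fun x => ?_
  change 0 ≤ inner C (toHilbert x) (toHilbert x)
  rw [inner_toHilbert]
  exact form_self_nonneg x

theorem norm_completion (x : HilbertCompletion C V) : ‖x‖ = √‖inner C x x‖ := by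
  refine hilbert_induction (p := fun x => ‖x‖ = √‖inner C x x‖) x (isClosed_eq continuous_norm
    (Real.continuous_sqrt.comp (cont_inner continuous_id continuous_id).norm)) fun x => ?_
  rw [inner_toHilbert]
  exact Completion.norm_coe (E := WithForm C V) x

/-- The Hausdorff completion of a semi-inner-product module is a Hilbert C⋆-module. -/
instance : CStarModule C (HilbertCompletion C V) where
  inner_add_right {x y z} := by
    refine Completion.induction_on₃ x y z (isClosed_eq ?_ ?_) fun x y z => ?_
    · exact cont_inner continuous_fst (by fun_prop)
    · exact (cont_inner continuous_fst (by fun_prop)).add (cont_inner continuous_fst (by fun_prop))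
    · rw [← Completion.coe_add]
      exact ((inner_toHilbert (C := C) (V := V) x (y + z)).trans (form_add_right _ _ _)).trans
        (congrArg₂ _ (inner_toHilbert _ _).symm (inner_toHilbert _ _).symm)
  inner_self_nonneg {x} := inner_self_nonneg_completion x
  inner_self {x} := by
    rw [← norm_eq_zero (a := x), norm_completion, Real.sqrt_eq_zero (norm_nonneg _), norm_eq_zero]
  inner_op_smul_right {c x y} := by
    refine Completion.induction_on₂ x y (isClosed_eq ?_ ?_) fun x y => ?_
    · exact cont_inner continuous_fst (continuous_snd.const_smul c)
    · exact continuous_const.mul (cont_inner continuous_fst continuous_snd)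
    · rw [← Completion.coe_smul]
      exact ((inner_toHilbert (C := C) (V := V) x (c • y)).trans (form_smul_right _ _ _)).trans
        (congrArg _ (inner_toHilbert _ _).symm)
  inner_smul_right_complex {z x y} := by
    refine Completion.induction_on₂ x y (isClosed_eq ?_ ?_) fun x y => ?_
    · exact cont_inner continuous_fst (continuous_snd.const_smul z)
    · exact (cont_inner continuous_fst continuous_snd).const_smul z
    · rw [← Completion.coe_smul]
      exact ((inner_toHilbert (C := C) (V := V) x (z • y)).trans
        (form_complex_smul_right _ _ _)).trans (congrArg _ (inner_toHilbert _ _).symm)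
  star_inner x y := by
    refine Completion.induction_on₂ x y (isClosed_eq ?_ ?_) fun x y => ?_
    · exact continuous_star.comp (cont_inner continuous_fst continuous_snd)
    · exact cont_inner continuous_snd continuous_fst
    · exact ((congrArg star (inner_toHilbert (C := C) (V := V) x y)).trans (star_form _ _)).trans
        (inner_toHilbert _ _).symm
  norm_eq_sqrt_norm_inner_self x := norm_completion x

/-- The continuous extension of a bounded linear map between semi-inner-product modules. -/
def extend (T : V →ₗ[ℂ] W) (c : ℝ)
    (hT : ∀ x, ‖form (C := C) (T x) (T x)‖ ≤ c ^ 2 * ‖form (C := C) x x‖) :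
    HilbertCompletion C V →L[ℂ] HilbertCompletion C W :=
  ContinuousLinearMap.completion
    (LinearMap.mkContinuous (E := WithForm C V) (F := WithForm C W) T |c| fun x => by
      refine abs_le_of_sq_le_sq' ?_ (by positivity) |>.2
      rw [mul_pow, sq_abs, WithForm.norm_sq, WithForm.norm_sq]
      exact hT x)

theorem extend_toHilbert (T : V →ₗ[ℂ] W) (c : ℝ)
    (hT : ∀ x, ‖form (C := C) (T x) (T x)‖ ≤ c ^ 2 * ‖form (C := C) x x‖) (x : V) :
    extend T c hT (toHilbert x) = toHilbert (T x) :=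
  ContinuousLinearMap.completion_apply_coe (α := WithForm C V) (β := WithForm C W) _ x

theorem inner_extend {T : V →ₗ[ℂ] W} {c : ℝ}
    {hT : ∀ x, ‖form (C := C) (T x) (T x)‖ ≤ c ^ 2 * ‖form (C := C) x x‖}
    {S : W →ₗ[ℂ] V} {d : ℝ}
    {hS : ∀ x, ‖form (C := C) (S x) (S x)‖ ≤ d ^ 2 * ‖form (C := C) x x‖}
    (h : ∀ x y, form (C := C) (T x) y = form x (S y)) (x : HilbertCompletion C V)
    (y : HilbertCompletion C W) :
    inner C (extend T c hT x) y = inner C x (extend S d hS y) := by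
  refine Completion.induction_on₂ x y (isClosed_eq ?_ ?_) fun x y => ?_
  · exact cont_inner ((extend T c hT).continuous.comp continuous_fst) continuous_snd
  · exact cont_inner continuous_fst ((extend S d hS).continuous.comp continuous_snd)
  · have h1 := extend_toHilbert T c hT x
    have h2 := extend_toHilbert S d hS y
    refine (congrArg (fun z => inner C z (toHilbert (V := W) y)) h1).trans ?_
    refine Eq.trans ?_ (congrArg (fun z => inner C (toHilbert (V := V) x) z) h2).symm
    exact (inner_toHilbert (V := W) (T x) y).trans
      ((h x y).trans (inner_toHilbert (V := V) x (S y)).symm)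

/-- If `T` has a formal adjoint `S` and is bounded, then `S` is bounded. -/
theorem bound_adjoint {T : V →ₗ[ℂ] W} {S : W →ₗ[ℂ] V} {c : ℝ}
    (hT : ∀ x, ‖form (C := C) (T x) (T x)‖ ≤ c ^ 2 * ‖form (C := C) x x‖)
    (h : ∀ x y, form (C := C) (T x) y = form x (S y)) (y : W) :
    ‖form (C := C) (S y) (S y)‖ ≤ c ^ 2 * ‖form (C := C) y y‖ := by
  have h1 : ‖form (C := C) (S y) (S y)‖ ^ 2
      ≤ ‖form (C := C) (S y) (S y)‖ * (c ^ 2 * ‖form (C := C) y y‖) := by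
    calc _ = ‖form (C := C) (T (S y)) y‖ ^ 2 := by rw [h]
      _ ≤ _ := norm_form_sq_le _ _
      _ ≤ (c ^ 2 * ‖form (C := C) (S y) (S y)‖) * ‖form (C := C) y y‖ :=
        mul_le_mul_of_nonneg_right (hT _) (norm_nonneg _)
      _ = _ := by ring
  rcases (norm_nonneg (form (C := C) (S y) (S y))).eq_or_lt with h0 | h0
  · rw [← h0]; positivity
  · rw [sq] at h1
    exact le_of_mul_le_mul_left h1 h0

/-- Boundedness of a family of maps that behaves like a `*`-representation. -/
theorem bound_of_rep {A : Type*} [CStarAlgebra A] (T : A → V →ₗ[ℂ] V)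
    (h1 : ∀ a x y, form (C := C) (T a x) (T a y) = form x (T (star a * a) y))
    (h2 : ∀ x y, form (C := C) x (T 1 y) = form x y)
    (h3 : ∀ x y, ∃ L : A →ₗ[ℂ] C, ∀ a, form x (T a y) = L a) (a : A) (x : V) :
    ‖form (C := C) (T a x) (T a x)‖ ≤ ‖a‖ ^ 2 * ‖form (C := C) x x‖ := by
  let _ : PartialOrder A := CStarAlgebra.spectralOrder A
  let _ : StarOrderedRing A := CStarAlgebra.spectralOrderedRing A
  have h4 : (0 : A) ≤ algebraMap ℝ A (‖a‖ ^ 2) - star a * a :=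
    sub_nonneg.mpr (CStarAlgebra.star_mul_le_algebraMap_norm_sq)
  obtain ⟨c, hc⟩ := CStarAlgebra.nonneg_iff_eq_star_mul_self.mp h4
  obtain ⟨L, hL⟩ := h3 x x
  have h5 : form (C := C) (T c x) (T c x) = (‖a‖ ^ 2) • form x x - form (T a x) (T a x) := by
    rw [h1, h1, hL, hL, ← hc, map_sub, ← h2 x x, hL, Algebra.algebraMap_eq_smul_one,
      ← Complex.coe_smul, map_smul, Complex.coe_smul]
  have h6 : form (C := C) (T a x) (T a x) ≤ (‖a‖ ^ 2) • form x x := by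
    rw [← sub_nonneg, ← h5]; exact form_self_nonneg _
  refine (CStarAlgebra.norm_le_norm_of_nonneg_of_le (form_self_nonneg _) h6).trans ?_
  rw [norm_smul, Real.norm_of_nonneg (by positivity)]

end Completion

/-! ### The C⋆-algebra of adjointable operators -/

section Adjointable

variable (C X : Type*) [CStarAlgebra C] [PartialOrder C] [StarOrderedRing C]
  [NormedAddCommGroup X] [NormedSpace ℂ X] [CompleteSpace X] [SMul C X] [CStarModule C X]

/-- The bounded operators on the Hilbert C⋆-module `X` that have an adjoint. -/
def adjointableSubalgebra : Subalgebra ℂ (X →L[ℂ] X) where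
  carrier := {S | ∃ T : X →L[ℂ] X, ∀ x y, inner C (S x) y = inner C x (T y)}
  mul_mem' := by
    rintro S₁ S₂ ⟨T₁, h₁⟩ ⟨T₂, h₂⟩
    exact ⟨T₂ * T₁, fun x y => by simp [h₁, h₂]⟩
  add_mem' := by
    rintro S₁ S₂ ⟨T₁, h₁⟩ ⟨T₂, h₂⟩
    exact ⟨T₁ + T₂, fun x y => by simp [h₁, h₂]⟩
  algebraMap_mem' z := ⟨star z • 1, fun x y => by
    simp [Algebra.algebraMap_eq_smul_one]⟩

/-- `𝓛(X)`: the C⋆-algebra of all adjointable operators on the Hilbert C⋆-module `X`. -/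
def Adjointable : Type _ := adjointableSubalgebra C X

namespace Adjointable

variable {C X}

instance : NormedRing (Adjointable C X) := inferInstanceAs (NormedRing (adjointableSubalgebra C X))
instance : NormedAlgebra ℂ (Adjointable C X) :=
  inferInstanceAs (NormedAlgebra ℂ (adjointableSubalgebra C X))

/-- The underlying bounded operator. -/
def toCLM (S : Adjointable C X) : X →L[ℂ] X := S.1

/-- An adjointable operator, from an operator and an adjoint for it. -/
def mk' (S T : X →L[ℂ] X) (h : ∀ x y, inner C (S x) y = inner C x (T y)) : Adjointable C X :=
  ⟨S, T, h⟩

theorem toCLM_injective : Function.Injective (toCLM : Adjointable C X → X →L[ℂ] X) :=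
  Subtype.val_injective

@[simp] theorem toCLM_mk' (S T : X →L[ℂ] X) (h : ∀ x y, inner C (S x) y = inner C x (T y)) :
    (mk' S T h).toCLM = S := rfl
@[simp] theorem toCLM_mul (S T : Adjointable C X) : (S * T).toCLM = S.toCLM * T.toCLM := rfl
@[simp] theorem toCLM_add (S T : Adjointable C X) : (S + T).toCLM = S.toCLM + T.toCLM := rfl
@[simp] theorem toCLM_sub (S T : Adjointable C X) : (S - T).toCLM = S.toCLM - T.toCLM := rfl
@[simp] theorem toCLM_one : (1 : Adjointable C X).toCLM = 1 := rfl
@[simp] theorem toCLM_smul (z : ℂ) (S : Adjointable C X) : (z • S).toCLM = z • S.toCLM := rfl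
theorem norm_toCLM (S : Adjointable C X) : ‖S.toCLM‖ = ‖S‖ := rfl

/-- The adjoint operator. -/
def adj (S : Adjointable C X) : X →L[ℂ] X := S.2.choose

theorem inner_adj (S : Adjointable C X) (x y : X) :
    inner C (S.toCLM x) y = inner C x (S.adj y) := S.2.choose_spec x y

theorem inner_adj_left (S : Adjointable C X) (x y : X) :
    inner C (S.adj x) y = inner C x (S.toCLM y) := by
  rw [← CStarModule.star_inner (A := C), ← inner_adj, CStarModule.star_inner]

theorem ext_inner {x y : X} (h : ∀ z, inner C z x = inner C z y) : x = y := by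
  rw [← sub_eq_zero, ← CStarModule.inner_self (A := C), CStarModule.inner_sub_right, h, sub_self]

theorem adj_unique (S : Adjointable C X) (T : X →L[ℂ] X)
    (h : ∀ x y, inner C (S.toCLM x) y = inner C x (T y)) : S.adj = T := by
  ext y
  exact ext_inner (C := C) fun z => by rw [← inner_adj, h]

instance : Star (Adjointable C X) := ⟨fun S => mk' S.adj S.toCLM S.inner_adj_left⟩

theorem toCLM_star (S : Adjointable C X) : (star S).toCLM = S.adj := rfl

theorem inner_star (S : Adjointable C X) (x y : X) :
    inner C (S.toCLM x) y = inner C x ((star S).toCLM y) := S.inner_adj x y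

theorem star_eq_of (S T : Adjointable C X)
    (h : ∀ x y, inner C (S.toCLM x) y = inner C x (T.toCLM y)) : star S = T :=
  toCLM_injective (S.adj_unique _ h)

instance : StarRing (Adjointable C X) where
  star_involutive S := star_eq_of _ _ S.inner_adj_left
  star_mul S T := star_eq_of _ _ fun x y => by simp [inner_star]
  star_add S T := star_eq_of _ _ fun x y => by simp [inner_star]

instance : StarModule ℂ (Adjointable C X) where
  star_smul z S := star_eq_of _ _ fun x y => by simp [inner_star]

instance : CStarRing (Adjointable C X) where
  norm_mul_self_le S := by
    have key : ‖S‖ ≤ √‖star S * S‖ := by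
      rw [← norm_toCLM, ← norm_toCLM]
      refine ContinuousLinearMap.opNorm_le_bound _ (Real.sqrt_nonneg _) fun x => ?_
      refine abs_le_of_sq_le_sq' ?_ (by positivity) |>.2
      rw [mul_pow, Real.sq_sqrt (norm_nonneg _), CStarModule.norm_sq_eq (A := C), inner_star]
      calc _ ≤ ‖x‖ * ‖(star S * S).toCLM x‖ := CStarModule.norm_inner_le X
        _ ≤ ‖x‖ * (‖(star S * S).toCLM‖ * ‖x‖) := by
          gcongr; exact ContinuousLinearMap.le_opNorm _ _
        _ = _ := by ring
    calc ‖S‖ * ‖S‖ ≤ √‖star S * S‖ * √‖star S * S‖ := by gcongr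
      _ = _ := Real.mul_self_sqrt (norm_nonneg _)

theorem isClosed_adjointable :
    IsClosed (adjointableSubalgebra C X : Set (X →L[ℂ] X)) := by
  refine IsSeqClosed.isClosed fun S S₀ hS hlim => ?_
  let S' : ℕ → Adjointable C X := fun n => ⟨S n, hS n⟩
  have hc : CauchySeq S' := by
    have h := hlim.cauchySeq
    rw [Metric.cauchySeq_iff] at h ⊢
    exact h
  have hc' : CauchySeq fun n => (star (S' n)).toCLM := by
    rw [Metric.cauchySeq_iff] at hc ⊢
    intro ε hε
    obtain ⟨N, hN⟩ := hc ε hε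
    refine ⟨N, fun m hm n hn => ?_⟩
    rw [dist_eq_norm, ← toCLM_sub, ← star_sub, norm_toCLM, norm_star, ← dist_eq_norm]
    exact hN m hm n hn
  obtain ⟨T₀, hT⟩ := cauchySeq_tendsto_of_complete hc'
  refine ⟨T₀, fun x y => ?_⟩
  have h1 : Filter.Tendsto (fun n => inner C (S n x) y) Filter.atTop
      (nhds (inner C (S₀ x) y)) :=
    ((CStarModule.continuous_inner (A := C) (E := X)).tendsto (S₀ x, y)).comp
      (((ContinuousLinearMap.apply ℂ X x).continuous.tendsto S₀ |>.comp hlim).prodMk_nhds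
        tendsto_const_nhds)
  have h2 : Filter.Tendsto (fun n => inner C x ((star (S' n)).toCLM y)) Filter.atTop
      (nhds (inner C x (T₀ y))) :=
    ((CStarModule.continuous_inner (A := C) (E := X)).tendsto (x, T₀ y)).comp
      (tendsto_const_nhds.prodMk_nhds
        ((ContinuousLinearMap.apply ℂ X y).continuous.tendsto T₀ |>.comp hT))
  refine tendsto_nhds_unique h1 (h2.congr fun n => ?_)
  exact ((S' n).inner_star x y).symm

instance : CompleteSpace (Adjointable C X) :=
  isClosed_adjointable.completeSpace_coe

instance : CStarAlgebra (Adjointable C X) where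

/-- The usual order of a C⋆-algebra: `0 ≤ S` iff `S` is self-adjoint with spectrum in `[0, ∞)`. -/
instance : PartialOrder (Adjointable C X) := CStarAlgebra.spectralOrder _
instance : StarOrderedRing (Adjointable C X) := CStarAlgebra.spectralOrderedRing _

end Adjointable

end Adjointable

/-! ### Positive kernels on finite sets -/

section PSD

variable {B : Type*} [CStarAlgebra B] [PartialOrder B] [StarOrderedRing B]
  {n : Type*} [Fintype n]

/-- Positive semidefiniteness of a finite matrix over `B`. -/
def IsPSD (c : n → n → B) : Prop :=
  (∀ i k, star (c i k) = c k i) ∧ ∀ b : n → B, 0 ≤ ∑ i, ∑ k, star (b i) * c i k * b k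

theorem diag_star_mul (K : CStarMatrix n n B) (i : n) :
    (star K * K) i i = ∑ k, star (K k i) * K k i := by
  rw [CStarMatrix.mul_apply]
  rfl

theorem eq_zero_of_diag_nonpos (K : CStarMatrix n n B) (h : ∀ i, (star K * K) i i ≤ 0) : K = 0 := by
  ext k i
  have h1 : ∑ k, star (K k i) * K k i = 0 := by
    refine le_antisymm ?_ (Finset.sum_nonneg fun k _ => star_mul_self_nonneg _)
    rw [← diag_star_mul]
    exact h i
  rw [Finset.sum_eq_zero_iff_of_nonneg fun k _ => star_mul_self_nonneg _] at h1
  exact CStarRing.star_mul_self_eq_zero_iff _ |>.mp (h1 k (Finset.mem_univ k))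

theorem exists_star_mul_self {R : Type*} [CStarAlgebra R] [PartialOrder R] [StarOrderedRing R]
    {M : R} (hM : 0 ≤ M) : ∃ d : R, M = star d * d :=
  CStarAlgebra.nonneg_iff_eq_star_mul_self.mp hM

theorem exists_negPart {R : Type*} [CStarAlgebra R] [PartialOrder R] [StarOrderedRing R] {M : R}
    (hM : IsSelfAdjoint M) :
    ∃ N : R, star N = N ∧ 0 ≤ N * N * N ∧ N * M * N = -(N * N * N) ∧ (N = 0 → 0 ≤ M) := by
  have hsub : M⁺ - M⁻ = M := CFC.posPart_sub_negPart M hM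
  have hneg : 0 ≤ M⁻ := CFC.negPart_nonneg M
  have hneg' : star M⁻ = M⁻ := (IsSelfAdjoint.of_nonneg hneg)
  have hmul : M⁺ * M⁻ = 0 := CFC.posPart_mul_negPart M
  refine ⟨M⁻, hneg', ?_, ?_, fun h => ?_⟩
  · have := star_left_conjugate_nonneg hneg M⁻
    rwa [hneg'] at this
  · calc M⁻ * M * M⁻ = M⁻ * (M⁺ - M⁻) * M⁻ := by rw [hsub]
      _ = M⁻ * (M⁺ * M⁻) - M⁻ * M⁻ * M⁻ := by noncomm_ring
      _ = _ := by rw [hmul]; simp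
  · rw [← hsub, h, sub_zero]
    exact CFC.posPart_nonneg M

theorem IsPSD.exists_factor {c : n → n → B} (hc : IsPSD c) :
    ∃ d : n → n → B, ∀ i k, c i k = ∑ m, star (d m i) * d m k := by
  classical
  let M : CStarMatrix n n B := CStarMatrix.ofMatrix c
  have hM : IsSelfAdjoint M := by
    ext i k
    exact hc.1 k i
  obtain ⟨N, hneg', h4, h3, hN⟩ := exists_negPart hM
  obtain ⟨K, hK⟩ := exists_star_mul_self h4
  have hK0 : K = 0 := by
    refine eq_zero_of_diag_nonpos K fun i => ?_
    rw [← hK, ← neg_nonneg]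
    have h5 : -((N * N * N) i i) = (N * M * N) i i := by rw [h3]; rfl
    rw [h5]
    have h6 := hc.2 fun k => N k i
    have h7 : (N * M * N) i i = ∑ a, ∑ b, star (N a i) * c a b * N b i := by
      rw [CStarMatrix.mul_apply, Finset.sum_comm]
      refine Finset.sum_congr rfl fun b _ => ?_
      rw [CStarMatrix.mul_apply, Finset.sum_mul]
      refine Finset.sum_congr rfl fun a _ => ?_
      have h8 : N i a = star (N a i) := by
        conv_lhs => rw [← hneg']
        rfl
      rw [h8]
      rfl
    rw [h7]
    exact h6
  have hM3 : N * N * N = 0 := by rw [hK, hK0, mul_zero]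
  have hM2 : N * N = 0 := by
    refine (CStarRing.star_mul_self_eq_zero_iff _).mp ?_
    rw [star_mul, hneg', ← mul_assoc, hM3, zero_mul]
  have hM1 : N = 0 := by
    refine (CStarRing.star_mul_self_eq_zero_iff _).mp ?_
    rw [hneg', hM2]
  have hMpos : 0 ≤ M := hN hM1
  obtain ⟨d, hd⟩ := exists_star_mul_self hMpos
  refine ⟨fun m i => d m i, fun i k => ?_⟩
  have h9 : c i k = (star d * d) i k := by rw [← hd]; rfl
  rw [h9, CStarMatrix.mul_apply]
  rfl

theorem IsPSD.one : IsPSD fun _ _ : n => (1 : B) := by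
  refine ⟨fun _ _ => star_one _, fun b => ?_⟩
  have h : ∑ i, ∑ k, star (b i) * 1 * b k = star (∑ i, b i) * ∑ k, b k := by
    simp only [mul_one, star_sum, Finset.sum_mul_sum]
  rw [h]
  exact star_mul_self_nonneg _

end PSD

/-! ### Conditional expectations and their `L²`-modules -/

/-- A conditional expectation from the unital C⋆-algebra `A` onto its unital C⋆-subalgebra `B`,
where `j : B → A` is the inclusion: a positive `B`-bimodule map that restricts to the identity
on `B`. (The inclusion `j` is then injective.) -/
structure CondExp {B A : Type*} [CStarAlgebra B] [PartialOrder B] [CStarAlgebra A]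
    (j : B →⋆ₐ[ℂ] A) extends A →ₗ[ℂ] B where
  map_incl' (b : B) : toFun (j b) = b
  map_incl_mul' (b : B) (a : A) : toFun (j b * a) = b * toFun a
  map_mul_incl' (a : A) (b : B) : toFun (a * j b) = toFun a * b
  nonneg' (a : A) : 0 ≤ toFun (star a * a)

section L2

variable {B A : Type*} [CStarAlgebra B] [PartialOrder B] [StarOrderedRing B] [CStarAlgebra A]
  {j : B →⋆ₐ[ℂ] A}

namespace CondExp

instance : CoeFun (CondExp j) fun _ => A → B := ⟨fun φ => φ.toFun⟩

variable (φ : CondExp j)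

theorem map_add (a b : A) : φ (a + b) = φ a + φ b := φ.map_add' a b
theorem map_smul (z : ℂ) (a : A) : φ (z • a) = z • φ a := φ.map_smul' z a
theorem map_incl (b : B) : φ (j b) = b := φ.map_incl' b
theorem map_incl_mul (b : B) (a : A) : φ (j b * a) = b * φ a := φ.map_incl_mul' b a
theorem map_mul_incl (a : A) (b : B) : φ (a * j b) = φ a * b := φ.map_mul_incl' a b
theorem nonneg (a : A) : 0 ≤ φ (star a * a) := φ.nonneg' a

theorem map_star (a : A) : φ (star a) = star (φ a) := by
  have h (x : A) : star (φ (star x * x)) = φ (star x * x) := IsSelfAdjoint.of_nonneg (φ.nonneg x)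
  have h0 := h a
  have h1 := h 1
  have h2 := h (1 + a)
  have h3 := h (1 + Complex.I • a)
  have e2 : star (φ a) + star (φ (star a)) = φ a + φ (star a) := by
    have e : star (1 + a) * (1 + a) = star 1 * 1 + (a + star a) + star a * a := by
      rw [star_add, star_one]; noncomm_ring
    rw [e, map_add, map_add, map_add, star_add, star_add, h0, h1, star_add] at h2
    exact add_left_cancel (add_right_cancel h2)
  have e3 : star (φ (star a)) - star (φ a) = φ a - φ (star a) := by
    have e : star (1 + Complex.I • a) * (1 + Complex.I • a)
        = star 1 * 1 + (Complex.I • a + (-Complex.I) • star a) + star a * a := by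
      rw [star_add, star_one, star_smul, add_mul, mul_add, mul_add, smul_mul_smul_comm]
      simp only [Complex.star_def, Complex.conj_I, neg_mul, Complex.I_mul_I, neg_neg, one_smul,
        one_mul, mul_one]
      abel
    rw [e, map_add, map_add, map_add, star_add, star_add, h0, h1, star_add, map_smul,
      map_smul] at h3
    have h4 := add_left_cancel (add_right_cancel h3)
    simp only [star_smul, Complex.star_def, Complex.conj_I, star_neg] at h4
    have h5 := congrArg (fun z => (-Complex.I) • z) h4
    simp only [smul_add, smul_smul, neg_mul, Complex.I_mul_I, smul_neg,
      neg_neg, one_smul, neg_smul] at h5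
    rw [sub_eq_add_neg, sub_eq_add_neg, add_comm, h5]
  have e4 : (2 : ℂ) • star (φ (star a)) = (2 : ℂ) • φ a := by
    rw [two_smul, two_smul]
    calc star (φ (star a)) + star (φ (star a))
        = (star (φ a) + star (φ (star a))) + (star (φ (star a)) - star (φ a)) := by abel
      _ = φ a + φ a := by rw [e2, e3]; abel
  have e5 : star (φ (star a)) = φ a := smul_right_injective B two_ne_zero e4
  rw [← e5, star_star]

end CondExp

/-- The algebra `A`, with the semi-inner product `⟨a, b⟩ = φ (a* b)`. -/
@[nolint unusedArguments]
def PreL2 (_φ : CondExp j) : Type _ := A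

variable (φ : CondExp j)

instance : AddCommGroup (PreL2 φ) := inferInstanceAs (AddCommGroup A)
instance : Module ℂ (PreL2 φ) := inferInstanceAs (Module ℂ A)

/-- The identification of `A` with `PreL2 φ`. -/
def toPre : A ≃ₗ[ℂ] PreL2 φ := LinearEquiv.refl ℂ A
/-- The identification of `PreL2 φ` with `A`. -/
def ofPre : PreL2 φ ≃ₗ[ℂ] A := LinearEquiv.refl ℂ A

@[simp] theorem ofPre_toPre (a : A) : ofPre φ (toPre φ a) = a := rfl
@[simp] theorem toPre_ofPre (a : PreL2 φ) : toPre φ (ofPre φ a) = a := rfl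

/-- The right action of `B`. -/
instance : Module Bᵐᵒᵖ (PreL2 φ) where
  smul b a := toPre φ (ofPre φ a * j b.unop)
  one_smul a := by
    change toPre φ (ofPre φ a * j 1) = a
    rw [_root_.map_one, mul_one, toPre_ofPre]
  mul_smul b c a := by
    change toPre φ (ofPre φ a * j (c.unop * b.unop))
      = toPre φ (ofPre φ (toPre φ (ofPre φ a * j c.unop)) * j b.unop)
    rw [_root_.map_mul j, ofPre_toPre, mul_assoc]
  smul_zero b := by
    change toPre φ (ofPre φ 0 * j b.unop) = 0
    rw [_root_.map_zero, zero_mul, _root_.map_zero]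
  smul_add b x y := by
    change toPre φ (ofPre φ (x + y) * j b.unop) = _
    rw [_root_.map_add, add_mul, _root_.map_add]
    rfl
  add_smul b c a := by
    change toPre φ (ofPre φ a * j (b.unop + c.unop)) = _
    rw [_root_.map_add, mul_add, _root_.map_add]
    rfl
  zero_smul a := by
    change toPre φ (ofPre φ a * j 0) = 0
    rw [_root_.map_zero, mul_zero, _root_.map_zero]

theorem ofPre_op_smul (b : Bᵐᵒᵖ) (a : PreL2 φ) : ofPre φ (b • a) = ofPre φ a * j b.unop := rfl

instance : PreCStarModule Bᵐᵒᵖ (PreL2 φ) where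
  form a b := op (φ (star (ofPre φ a) * ofPre φ b))
  form_add_right x y z := by rw [_root_.map_add, mul_add, φ.map_add, op_add]
  form_smul_right b x y := by
    rw [ofPre_op_smul, ← mul_assoc, φ.map_mul_incl, op_mul, op_unop]
  form_complex_smul_right w x y := by
    rw [_root_.map_smul, mul_smul_comm, φ.map_smul, op_smul]
  star_form x y := by rw [← op_star, ← φ.map_star, star_mul, star_star]
  form_self_nonneg x := φ.nonneg (ofPre φ x)

theorem form_def (x y : PreL2 φ) :
    form (C := Bᵐᵒᵖ) x y = op (φ (star (ofPre φ x) * ofPre φ y)) := rfl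

/-- `L²(A, φ)`: the right Hilbert `B`-module obtained from `A` by separation and completion with
respect to `⟨a, b⟩ = φ (a* b)`. A right Hilbert `B`-module is a `CStarModule` over `Bᵐᵒᵖ`. -/
abbrev L2 : Type _ := HilbertCompletion Bᵐᵒᵖ (PreL2 φ)

/-- The map `a ↦ â` from `A` to `L²(A, φ)`. -/
def hat (a : A) : L2 φ := toHilbert (toPre φ a)

/-- The specified vector `ξ = 1̂`. -/
def xi : L2 φ := hat φ 1

variable {φ}

/-- The `B`-valued inner product of `L²(A, φ)`. -/
def ip (x y : L2 φ) : B := (inner Bᵐᵒᵖ x y).unop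

theorem ip_hat (a b : A) : ip (hat φ a) (hat φ b) = φ (star a * b) :=
  congrArg unop (inner_toHilbert (C := Bᵐᵒᵖ) (toPre φ a) (toPre φ b))

theorem ip_add_right (x y z : L2 φ) : ip x (y + z) = ip x y + ip x z :=
  congrArg unop (CStarModule.inner_add_right (A := Bᵐᵒᵖ) (x := x) (y := y) (z := z))
theorem ip_smul_right (w : ℂ) (x y : L2 φ) : ip x (w • y) = w • ip x y :=
  congrArg unop (CStarModule.inner_smul_right_complex (A := Bᵐᵒᵖ) (z := w) (x := x) (y := y))
theorem ip_star (x y : L2 φ) : star (ip x y) = ip y x :=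
  congrArg unop (CStarModule.star_inner (A := Bᵐᵒᵖ) x y)
theorem ip_op_smul_right (b : B) (x y : L2 φ) : ip x (op b • y) = ip x y * b :=
  congrArg unop (CStarModule.inner_op_smul_right (A := Bᵐᵒᵖ) (a := op b) (x := x) (y := y))
theorem ip_self_nonneg (x : L2 φ) : 0 ≤ ip x x :=
  CStarModule.inner_self_nonneg (A := Bᵐᵒᵖ) (x := x)
theorem ip_op_smul_left (b : B) (x y : L2 φ) : ip (op b • x) y = star b * ip x y := by
  rw [← ip_star, ip_op_smul_right, star_mul, ip_star]
theorem ip_add_left (x y z : L2 φ) : ip (x + y) z = ip x z + ip y z := by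
  rw [← ip_star, ip_add_right, star_add, ip_star, ip_star]
theorem ip_zero_right (x : L2 φ) : ip x 0 = 0 := by
  simpa using ip_smul_right 0 x 0
theorem ip_zero_left (x : L2 φ) : ip 0 x = 0 := by
  rw [← ip_star, ip_zero_right, star_zero]
theorem ip_sub_right (x y z : L2 φ) : ip x (y - z) = ip x y - ip x z := by
  rw [eq_sub_iff_add_eq, ← ip_add_right, sub_add_cancel]
theorem ip_sub_left (x y z : L2 φ) : ip (x - y) z = ip x z - ip y z := by
  rw [eq_sub_iff_add_eq, ← ip_add_left, sub_add_cancel]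
theorem ip_sum_left {n : Type*} (s : Finset n) (x : n → L2 φ) (y : L2 φ) :
    ip (∑ i ∈ s, x i) y = ∑ i ∈ s, ip (x i) y := by
  classical
  induction s using Finset.induction_on with
  | empty => simp [ip_zero_left]
  | insert a s ha ih => rw [Finset.sum_insert ha, Finset.sum_insert ha, ip_add_left, ih]
theorem ip_sum_right {n : Type*} (s : Finset n) (x : L2 φ) (y : n → L2 φ) :
    ip x (∑ i ∈ s, y i) = ∑ i ∈ s, ip x (y i) := by
  rw [← ip_star, ip_sum_left, star_sum]
  exact Finset.sum_congr rfl fun i _ => ip_star _ _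

variable (φ)

theorem ip_xi_xi : ip (xi φ) (xi φ) = 1 := by
  rw [xi, ip_hat, star_one, one_mul, ← _root_.map_one j, φ.map_incl]

/-- Left multiplication by `a` on `A`. -/
def preLeft (a : A) : PreL2 φ →ₗ[ℂ] PreL2 φ :=
  (toPre φ).toLinearMap ∘ₗ LinearMap.mulLeft ℂ a ∘ₗ (ofPre φ).toLinearMap

theorem ofPre_preLeft (a : A) (x : PreL2 φ) : ofPre φ (preLeft φ a x) = a * ofPre φ x := rfl

theorem preLeft_bound (a : A) (x : PreL2 φ) :
    ‖form (C := Bᵐᵒᵖ) (preLeft φ a x) (preLeft φ a x)‖ ≤ ‖a‖ ^ 2 * ‖form (C := Bᵐᵒᵖ) x x‖ := by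
  refine bound_of_rep (preLeft φ) (fun a x y => ?_) (fun x y => ?_) (fun x y => ?_) a x
  · simp only [form_def, ofPre_preLeft, star_mul, mul_assoc]
  · simp only [form_def, ofPre_preLeft, one_mul]
  · exact ⟨(opLinearEquiv ℂ).toLinearMap ∘ₗ φ.toLinearMap ∘ₗ
      LinearMap.mulLeft ℂ (star (ofPre φ x)) ∘ₗ LinearMap.mulRight ℂ (ofPre φ y), fun a => rfl⟩

/-- The representation `π` of `A` on `L²(A, φ)`, with `π a b̂ = (a b)^`. -/
def piRep (a : A) : L2 φ →L[ℂ] L2 φ := extend (preLeft φ a) ‖a‖ (preLeft_bound φ a)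

theorem piRep_hat (a b : A) : piRep φ a (hat φ b) = hat φ (a * b) :=
  extend_toHilbert (preLeft φ a) ‖a‖ (preLeft_bound φ a) (toPre φ b)

theorem ip_piRep (a : A) (x y : L2 φ) : ip (piRep φ a x) y = ip x (piRep φ (star a) y) := by
  refine congrArg unop (inner_extend (fun x y => ?_) x y)
  simp only [form_def, ofPre_preLeft, star_mul, mul_assoc]

theorem L2_induction {p : L2 φ → Prop} (x : L2 φ) (hp : IsClosed {x | p x})
    (h : ∀ a : A, p (hat φ a)) : p x := hilbert_induction (V := PreL2 φ) x hp h

theorem clm_ext {S T : L2 φ →L[ℂ] L2 φ} (h : ∀ a, S (hat φ a) = T (hat φ a)) (x : L2 φ) :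
    S x = T x :=
  L2_induction φ (p := fun x => S x = T x) x (isClosed_eq S.continuous T.continuous) h

theorem piRep_mul (a b : A) (x : L2 φ) : piRep φ (a * b) x = piRep φ a (piRep φ b x) := by
  refine clm_ext φ (T := piRep φ a ∘L piRep φ b) (fun c => ?_) x
  rw [ContinuousLinearMap.comp_apply, piRep_hat, piRep_hat, piRep_hat, mul_assoc]

theorem piRep_one (x : L2 φ) : piRep φ 1 x = x := by
  refine clm_ext φ (T := ContinuousLinearMap.id ℂ _) (fun c => ?_) x
  rw [piRep_hat, one_mul]
  rfl

theorem hat_add (a b : A) : hat φ (a + b) = hat φ a + hat φ b :=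
  UniformSpace.Completion.coe_add (α := WithForm Bᵐᵒᵖ (PreL2 φ)) (toPre φ a) (toPre φ b)

theorem hat_smul (z : ℂ) (a : A) : hat φ (z • a) = z • hat φ a :=
  UniformSpace.Completion.coe_smul (X := WithForm Bᵐᵒᵖ (PreL2 φ)) z (toPre φ a)

theorem hat_mul_incl (a : A) (b : B) : hat φ (a * j b) = op b • hat φ a :=
  UniformSpace.Completion.coe_smul (X := WithForm Bᵐᵒᵖ (PreL2 φ)) (op b) (toPre φ a)

theorem piRep_add (a b : A) (x : L2 φ) : piRep φ (a + b) x = piRep φ a x + piRep φ b x := by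
  refine clm_ext φ (T := piRep φ a + piRep φ b) (fun c => ?_) x
  rw [add_apply, piRep_hat, piRep_hat, piRep_hat, add_mul, hat_add]

theorem piRep_smul (z : ℂ) (a : A) (x : L2 φ) : piRep φ (z • a) x = z • piRep φ a x := by
  refine clm_ext φ (T := z • piRep φ a) (fun c => ?_) x
  rw [smul_apply, piRep_hat, piRep_hat, smul_mul_assoc, hat_smul]

theorem piRep_op_smul (a : A) (b : B) (x : L2 φ) :
    piRep φ a (op b • x) = op b • piRep φ a x := by
  refine L2_induction φ (p := fun x => piRep φ a (op b • x) = op b • piRep φ a x) x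
    (isClosed_eq ?_ ?_) fun c => ?_
  · exact (piRep φ a).continuous.comp (continuous_const_smul _)
  · exact (piRep φ a).continuous.const_smul (op b)
  · rw [piRep_hat, ← hat_mul_incl, piRep_hat, ← hat_mul_incl, mul_assoc]

/-- The left action of `B` on `L²(A, φ)`, the restriction of `π` to `B`. -/
def lact (b : B) : L2 φ →L[ℂ] L2 φ := piRep φ (j b)

theorem lact_add (b c : B) (x : L2 φ) : lact φ (b + c) x = lact φ b x + lact φ c x := by
  rw [lact, _root_.map_add, piRep_add]; rfl

theorem lact_smul (z : ℂ) (b : B) (x : L2 φ) : lact φ (z • b) x = z • lact φ b x := by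
  rw [lact, _root_.map_smul, piRep_smul]; rfl

theorem lact_mul (b c : B) (x : L2 φ) : lact φ (b * c) x = lact φ b (lact φ c x) := by
  rw [lact, _root_.map_mul, piRep_mul]; rfl

theorem lact_one (x : L2 φ) : lact φ 1 x = x := by
  rw [lact, _root_.map_one, piRep_one]

theorem lact_zero (x : L2 φ) : lact φ 0 x = 0 := by
  simpa using lact_smul φ 0 0 x

theorem lact_sum {n : Type*} (s : Finset n) (b : n → B) (x : L2 φ) :
    lact φ (∑ m ∈ s, b m) x = ∑ m ∈ s, lact φ (b m) x := by
  classical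
  induction s using Finset.induction_on with
  | empty => simp [lact_zero]
  | insert m s hm ih => rw [Finset.sum_insert hm, Finset.sum_insert hm, lact_add, ih]

theorem ip_lact (b : B) (x y : L2 φ) : ip (lact φ b x) y = ip x (lact φ (star b) y) := by
  rw [lact, ip_piRep, ← StarHomClass.map_star j]; rfl

theorem lact_xi (b : B) : lact φ b (xi φ) = op b • xi φ := by
  rw [lact, xi, piRep_hat, mul_one, ← one_mul (j _), hat_mul_incl]

/-- `c ↦ ⟨x, c y⟩`. -/
def leftForm (x y : L2 φ) : B →ₗ[ℂ] B where
  toFun c := ip x (lact φ c y)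
  map_add' c d := by rw [lact_add, ip_add_right]
  map_smul' z c := by rw [lact_smul, ip_smul_right]; rfl

theorem leftForm_apply (x y : L2 φ) (c : B) : leftForm φ x y c = ip x (lact φ c y) := rfl

theorem star_leftForm (x y : L2 φ) (c : B) :
    star (leftForm φ x y c) = leftForm φ y x (star c) := by
  rw [leftForm_apply, leftForm_apply, ip_star, ip_lact]

theorem leftForm_zero_left (y : L2 φ) (c : B) : leftForm φ 0 y c = 0 := by
  rw [leftForm_apply, ip_zero_left]

theorem leftForm_zero_right (x : L2 φ) (c : B) : leftForm φ x 0 c = 0 := by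
  rw [leftForm_apply, _root_.map_zero, ip_zero_right]

theorem sum_leftForm_nonneg {n : Type*} [Fintype n] {c : n → n → B} (hc : IsPSD c)
    (x : n → L2 φ) (b : n → B) :
    0 ≤ ∑ a, ∑ a', star (b a) * leftForm φ (x a) (x a') (c a a') * b a' := by
  obtain ⟨d, hd⟩ := hc.exists_factor
  let Y (m : n) : L2 φ := ∑ a, op (b a) • lact φ (d m a) (x a)
  have h2 : ∑ a, ∑ a', star (b a) * leftForm φ (x a) (x a') (c a a') * b a'
      = ∑ m, ip (Y m) (Y m) := by
    have h3 (a a' : n) : star (b a) * leftForm φ (x a) (x a') (c a a') * b a'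
        = ∑ m, ip (op (b a) • lact φ (d m a) (x a)) (op (b a') • lact φ (d m a') (x a')) := by
      rw [leftForm_apply, hd, lact_sum, ip_sum_right, Finset.mul_sum, Finset.sum_mul]
      refine Finset.sum_congr rfl fun m _ => ?_
      rw [ip_op_smul_left, ip_op_smul_right, ip_lact, mul_assoc, lact_mul]
    simp only [h3, Y, ip_sum_left, ip_sum_right]
    rw [Finset.sum_congr rfl fun a _ => Finset.sum_comm, Finset.sum_comm]
    exact Finset.sum_congr rfl fun m _ => Finset.sum_comm
  rw [h2]
  exact Finset.sum_nonneg fun m _ => ip_self_nonneg _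

/-- `E° = {x ∈ L²(A, φ) | ⟨ξ, x⟩ = 0}`, the complement of `ξ B`. -/
def L2o : Submodule ℂ (L2 φ) where
  carrier := {x | ip (xi φ) x = 0}
  add_mem' {x y} hx hy := by
    change ip _ (x + y) = 0
    rw [ip_add_right, hx, hy, add_zero]
  zero_mem' := ip_zero_right _
  smul_mem' z x hx := by
    change ip _ (z • x) = 0
    rw [ip_smul_right, hx, smul_zero]

theorem mem_L2o {x : L2 φ} : x ∈ L2o φ ↔ ip (xi φ) x = 0 := Iff.rfl

/-- The projection `P° x = x - ξ ⟨ξ, x⟩` onto `E°`. -/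
def projo (x : L2 φ) : L2o φ := ⟨x - op (ip (xi φ) x) • xi φ, by
  rw [mem_L2o, ip_sub_right, ip_op_smul_right, ip_xi_xi, one_mul, sub_self]⟩

theorem projo_coe (x : L2 φ) : (projo φ x : L2 φ) = x - op (ip (xi φ) x) • xi φ := rfl

theorem projo_of_mem (x : L2o φ) : projo φ (x : L2 φ) = x := by
  have h : ip (xi φ) (x : L2 φ) = 0 := x.2
  ext1
  rw [projo_coe, h, op_zero, zero_smul, sub_zero]

theorem ip_mem_xi (x : L2o φ) : ip (x : L2 φ) (xi φ) = 0 := by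
  have h : ip (xi φ) (x : L2 φ) = 0 := x.2
  rw [← ip_star, h, star_zero]

theorem ip_mem_projo (x : L2o φ) (y : L2 φ) : ip (x : L2 φ) (projo φ y) = ip (x : L2 φ) y := by
  rw [projo_coe, ip_sub_right, ip_op_smul_right, ip_mem_xi, zero_mul, sub_zero]

theorem ip_projo_projo (x y : L2 φ) :
    ip (projo φ x : L2 φ) (projo φ y) = ip x y - star (ip (xi φ) x) * ip (xi φ) y := by
  rw [ip_mem_projo, projo_coe, ip_sub_left, ip_op_smul_left]

/-- The left action of `B` on `E°`. -/
def acto (b : B) (x : L2o φ) : L2o φ := ⟨lact φ b x, by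
  have h : ip (xi φ) (x : L2 φ) = 0 := x.2
  rw [mem_L2o, ← star_star b, ← ip_lact, lact_xi, ip_op_smul_left, h, mul_zero]⟩

theorem acto_coe (b : B) (x : L2o φ) : (acto φ b x : L2 φ) = lact φ b x := rfl

theorem acto_one (x : L2o φ) : acto φ 1 x = x := by
  ext1
  rw [acto_coe, lact_one]

theorem leftForm_acto (x y : L2o φ) (b c : B) :
    leftForm φ (acto φ b x : L2 φ) (acto φ c y : L2 φ) 1 = leftForm φ x y (star b * c) := by
  rw [leftForm_apply, leftForm_apply, lact_one, acto_coe, acto_coe, ip_lact, lact_mul]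

end L2

/-! ### Words and their Gram kernel -/

section Words

variable {B : Type*} [CStarAlgebra B] [PartialOrder B] [StarOrderedRing B]
  {I : Type*} {A : I → Type*} [∀ i, CStarAlgebra (A i)]
  {j : ∀ i, B →⋆ₐ[ℂ] A i} (φ : ∀ i, CondExp (j i))

/-- A letter: an index `i` together with a vector of `E_i°`. -/
abbrev Letter : Type _ := Σ i, L2o (φ i)

variable {φ}

open Classical in
/-- The component of a letter in `E_i` (zero unless the letter has index `i`). -/
def Letter.comp (x : Letter φ) (i : I) : L2 (φ i) :=
  Pi.single (M := fun i => L2 (φ i)) x.1 (x.2 : L2 (φ x.1)) i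

theorem Letter.comp_self (i : I) (ζ : L2o (φ i)) : Letter.comp (⟨i, ζ⟩ : Letter φ) i = ζ := by
  classical exact Pi.single_eq_same _ _

theorem Letter.comp_ne {x : Letter φ} {i : I} (h : x.1 ≠ i) : x.comp i = 0 := by
  classical exact Pi.single_eq_of_ne h.symm _

/-- `c ↦ ⟨ζ, c η⟩` for letters `ζ`, `η`, understood to be zero if their indices differ. -/
def letterForm (x y : Letter φ) : B →ₗ[ℂ] B := leftForm (φ x.1) x.2 (y.comp x.1)

theorem letterForm_ne {x y : Letter φ} (h : x.1 ≠ y.1) : letterForm x y = 0 := by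
  ext c
  rw [letterForm, Letter.comp_ne h.symm, leftForm_zero_right]
  rfl

theorem letterForm_same (i : I) (ζ η : L2o (φ i)) :
    letterForm (⟨i, ζ⟩ : Letter φ) ⟨i, η⟩ = leftForm (φ i) ζ η := by
  rw [letterForm, Letter.comp_self]

theorem star_letterForm (x y : Letter φ) (c : B) :
    star (letterForm x y c) = letterForm y x (star c) := by
  by_cases h : x.1 = y.1
  · obtain ⟨i, ζ⟩ := x
    obtain ⟨k, η⟩ := y
    obtain rfl : i = k := h
    rw [letterForm_same, letterForm_same, star_leftForm]
  · rw [letterForm_ne h, letterForm_ne (Ne.symm h)]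
    exact star_zero B

/-- The kernel of the inner product on words: for words `u = ζ₁ ⊗ ⋯ ⊗ ζₙ` and
`v = η₁ ⊗ ⋯ ⊗ ηₙ` of the same type, `gram u v c = ⟨u, c v⟩`, that is
`gram u v c = ⟨ζₙ, ⟨ζₙ₋₁, ⋯ ⟨ζ₁, c η₁⟩ ⋯ ηₙ₋₁⟩ ηₙ⟩`;
it is zero for words of different types. -/
def gram : List (Letter φ) → List (Letter φ) → B →ₗ[ℂ] B
  | [], [] => LinearMap.id
  | x :: u, y :: v => gram u v ∘ₗ letterForm x y
  | [], _ :: _ => 0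
  | _ :: _, [] => 0

@[simp] theorem gram_nil_nil (c : B) : gram ([] : List (Letter φ)) [] c = c := rfl
@[simp] theorem gram_cons_cons (x y : Letter φ) (u v : List (Letter φ)) (c : B) :
    gram (x :: u) (y :: v) c = gram u v (letterForm x y c) := rfl
@[simp] theorem gram_nil_cons (y : Letter φ) (v : List (Letter φ)) (c : B) :
    gram [] (y :: v) c = 0 := rfl
@[simp] theorem gram_cons_nil (x : Letter φ) (u : List (Letter φ)) (c : B) :
    gram (x :: u) [] c = 0 := rfl

theorem star_gram (u v : List (Letter φ)) (c : B) : star (gram u v c) = gram v u (star c) := by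
  induction u generalizing v c with
  | nil => cases v <;> simp
  | cons x u ih =>
    cases v with
    | nil => simp
    | cons y v => simp [ih, star_letterForm]

theorem gram_length_ne {u v : List (Letter φ)} (h : u.length ≠ v.length) (c : B) :
    gram u v c = 0 := by
  induction u generalizing v c with
  | nil => cases v <;> simp_all
  | cons x u ih =>
    cases v with
    | nil => simp
    | cons y v => exact ih (by simpa using h) _

/-- One step of the recursion for `gram`. -/
def stepForm : List (Letter φ) → List (Letter φ) → B →ₗ[ℂ] B
  | [], [] => LinearMap.id
  | x :: _, y :: _ => letterForm x y
  | [], _ :: _ => 0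
  | _ :: _, [] => 0

theorem gram_eq_step (u v : List (Letter φ)) (c : B) :
    gram u v c = gram u.tail v.tail (stepForm u v c) := by
  cases u <;> cases v <;> simp [stepForm]

theorem star_stepForm (u v : List (Letter φ)) (c : B) :
    star (stepForm u v c) = stepForm v u (star c) := by
  cases u <;> cases v <;> simp [stepForm, star_letterForm]

/-- The component in `E_i` of the first letter. -/
def headVec (i : I) : List (Letter φ) → L2 (φ i)
  | [] => 0
  | x :: _ => x.comp i

/-- The indicator of the empty word. -/
def headNil : List (Letter φ) → B
  | [] => 1
  | _ :: _ => 0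

/-- The index of the first letter. -/
def headIdx : List (Letter φ) → Finset I
  | [] => ∅
  | x :: _ => {x.1}

theorem stepForm_eq (u v : List (Letter φ)) (S : Finset I) (hu : headIdx u ⊆ S)
    (hv : headIdx v ⊆ S) (c : B) :
    stepForm u v c = headNil u * c * headNil v
      + ∑ i ∈ S, leftForm (φ i) (headVec i u) (headVec i v) c := by
  cases u with
  | nil => cases v <;> simp [stepForm, headNil, headVec, leftForm_zero_left]
  | cons x u =>
    cases v with
    | nil => simp [stepForm, headNil, headVec, leftForm_zero_right]
    | cons y v =>
      have hx : x.1 ∈ S := hu (by simp [headIdx])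
      rw [Finset.sum_eq_single_of_mem x.1 hx fun i _ hi => ?_]
      · simp only [stepForm, headNil, headVec, zero_mul, mul_zero, zero_add]
        rw [letterForm]
        exact congrArg (fun z => leftForm (φ x.1) z (y.comp x.1) c)
          (Letter.comp_self x.1 x.2).symm
      · rw [headVec, Letter.comp_ne hi.symm, leftForm_zero_left]

variable {n : Type*} [Fintype n]

theorem IsPSD.step {c : n → n → B} (hc : IsPSD c) (w : n → List (Letter φ)) :
    IsPSD fun a b => stepForm (w a) (w b) (c a b) := by
  classical
  refine ⟨fun a b => by rw [star_stepForm, hc.1], fun b => ?_⟩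
  let S : Finset I := Finset.univ.biUnion fun a => headIdx (w a)
  have hS (a : n) : headIdx (w a) ⊆ S := Finset.subset_biUnion_of_mem (fun a => headIdx (w a))
    (Finset.mem_univ a)
  have h5 : ∑ a, ∑ a', star (b a) * stepForm (w a) (w a') (c a a') * b a'
      = (∑ a, ∑ a', star (headNil (w a) * b a) * c a a' * (headNil (w a') * b a'))
        + ∑ i ∈ S, ∑ a, ∑ a', star (b a) *
          leftForm (φ i) (headVec i (w a)) (headVec i (w a')) (c a a') * b a' := by
    have h6 (u : List (Letter φ)) : star (headNil u) = headNil u := by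
      cases u <;> simp [headNil]
    rw [Finset.sum_comm (s := S), ← Finset.sum_add_distrib]
    refine Finset.sum_congr rfl fun a _ => ?_
    rw [Finset.sum_comm (s := S), ← Finset.sum_add_distrib]
    refine Finset.sum_congr rfl fun a' _ => ?_
    rw [stepForm_eq _ _ S (hS a) (hS a'), mul_add, add_mul, Finset.mul_sum, Finset.sum_mul,
      star_mul, h6]
    simp only [mul_assoc]
  rw [h5]
  exact add_nonneg (hc.2 _) (Finset.sum_nonneg fun i _ =>
    sum_leftForm_nonneg (φ i) hc (fun a => headVec i (w a)) b)

theorem IsPSD.gram_of_length (N : ℕ) {c : n → n → B} (hc : IsPSD c) (w : n → List (Letter φ))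
    (hw : ∀ a, (w a).length ≤ N) : IsPSD fun a b => gram (w a) (w b) (c a b) := by
  induction N generalizing c w with
  | zero =>
    have h (a : n) : w a = [] := List.length_eq_zero_iff.mp (Nat.le_zero.mp (hw a))
    simpa only [h, gram_nil_nil] using hc
  | succ N ih =>
    have h (a b : n) : FreeProd.gram (w a) (w b) (c a b)
        = FreeProd.gram (w a).tail (w b).tail (stepForm (w a) (w b) (c a b)) := gram_eq_step _ _ _
    simp only [h]
    exact ih (hc.step w) (fun a => (w a).tail) fun a => by
      have := hw a
      rw [List.length_tail]
      omega

theorem IsPSD.gram {c : n → n → B} (hc : IsPSD c) (w : n → List (Letter φ)) :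
    IsPSD fun a b => gram (w a) (w b) (c a b) :=
  hc.gram_of_length (Finset.univ.sup fun a => (w a).length) w fun a =>
    Finset.le_sup (f := fun a => (w a).length) (Finset.mem_univ a)

end Words

/-! ### The free product module -/

section FreeModule

variable {B : Type*} [CStarAlgebra B] [PartialOrder B] [StarOrderedRing B]
  {I : Type*} {A : I → Type*} [∀ i, CStarAlgebra (A i)]
  {j : ∀ i, B →⋆ₐ[ℂ] A i} {φ : ∀ i, CondExp (j i)}

/-- A word `ζ₁ ⊗ ⋯ ⊗ ζₙ` is reduced if neighbouring letters have different indices. -/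
def IsReduced (u : List (Letter φ)) : Prop := u.IsChain fun x y => x.1 ≠ y.1

variable (φ) in
/-- The reduced words of length at most `k` (of any length, for `k = ⊤`). -/
structure Word (k : ℕ∞) where
  /-- the word -/
  val : List (Letter φ)
  reduced : IsReduced val
  length_le : (val.length : ℕ∞) ≤ k

variable (φ) in
/-- The free right `B`-module on the reduced words of length at most `k`. -/
abbrev PreFree (k : ℕ∞) : Type _ := Word φ k →₀ B

variable {k : ℕ∞}

/-- `⟨∑ u b_u, ∑ v c_v⟩ = ∑ b_u* ⟨u, v⟩ c_v`. -/
def kernelForm (f g : PreFree φ k) : B :=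
  f.sum fun u b => g.sum fun v c => star b * gram u.1 v.1 1 * c

theorem kernelForm_add_right (f g h : PreFree φ k) :
    kernelForm f (g + h) = kernelForm f g + kernelForm f h := by
  rw [kernelForm, kernelForm, kernelForm, ← Finsupp.sum_add]
  refine Finsupp.sum_congr fun u _ => ?_
  rw [Finsupp.sum_add_index' (fun v => mul_zero _) fun v b c => mul_add _ _ _]

theorem kernelForm_smul_right {R : Type*} [Monoid R] [DistribMulAction R B] [SMulCommClass R B B]
    (z : R) (f g : PreFree φ k) : kernelForm f (z • g) = z • kernelForm f g := by
  rw [kernelForm, kernelForm, Finsupp.smul_sum]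
  refine Finsupp.sum_congr fun u _ => ?_
  rw [Finsupp.smul_sum, Finsupp.sum_smul_index' fun v => mul_zero _]
  exact Finsupp.sum_congr fun v _ => mul_smul_comm _ _ _

theorem star_kernelForm (f g : PreFree φ k) : star (kernelForm f g) = kernelForm g f := by
  rw [kernelForm, kernelForm, Finsupp.sum_comm, Finsupp.sum, star_sum]
  refine Finset.sum_congr rfl fun u _ => ?_
  rw [Finsupp.sum, star_sum]
  refine Finset.sum_congr rfl fun v _ => ?_
  change star (star (f v) * gram v.1 u.1 1 * g u) = star (g u) * gram u.1 v.1 1 * f v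
  rw [star_mul, star_mul, star_star, star_gram, star_one, mul_assoc]

theorem kernelForm_self_nonneg (f : PreFree φ k) : 0 ≤ kernelForm f f := by
  have h := ((IsPSD.one (B := B) (n := f.support)).gram fun u => u.1.1).2 fun u => f u.1
  have h2 : kernelForm f f
      = ∑ u : f.support, ∑ v : f.support, star (f u.1) * gram u.1.1 v.1.1 1 * f v.1 := by
    rw [Finset.sum_coe_sort f.support fun u =>
      ∑ v : f.support, star (f u) * gram u.1 v.1.1 1 * f v.1]
    refine Finset.sum_congr rfl fun u _ => ?_
    rw [Finset.sum_coe_sort f.support fun v => star (f u) * gram u.1 v.1 1 * f v]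
    rfl
  rw [h2]
  exact h

instance : PreCStarModule Bᵐᵒᵖ (PreFree φ k) where
  form f g := op (kernelForm f g)
  form_add_right f g h := by rw [kernelForm_add_right, op_add]
  form_smul_right b f g := by
    rw [kernelForm_smul_right]
    exact op_mul _ _
  form_complex_smul_right z f g := by rw [kernelForm_smul_right, op_smul]
  star_form f g := by rw [← op_star, star_kernelForm]
  form_self_nonneg f := kernelForm_self_nonneg f

theorem form_single (u v : Word φ k) (b c : B) :
    form (C := Bᵐᵒᵖ) (Finsupp.single u b : PreFree φ k) (Finsupp.single v c)
      = op (star b * gram u.1 v.1 1 * c) := by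
  refine congrArg op ?_
  rw [kernelForm, Finsupp.sum_single_index, Finsupp.sum_single_index]
  · exact mul_zero _
  · simp

variable (φ k) in
/-- For `k = ⊤`, the free product `E` of the modules `E_i = L²(A_i, φ_i)`, that is
`E = ξB ⊕ ⨁ E_{i₁}° ⊗_B ⋯ ⊗_B E_{iₙ}°`, the sum being over all `n ≥ 1` and `i₁ ≠ i₂ ≠ ⋯ ≠ iₙ`;
for `k : ℕ`, its submodule `E_(→k)` consisting of the summands with `n ≤ k`.
The internal tensor products and the direct sum are constructed in one step, as the separated
completion of the span of the elements `ζ₁ ⊗ ⋯ ⊗ ζₙ b` with respect to the inner product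
`⟨ζ₁ ⊗ ⋯ ⊗ ζₙ, η₁ ⊗ ⋯ ⊗ ηₙ⟩ = ⟨ζₙ, ⟨ζₙ₋₁, ⋯ ⟨ζ₁, η₁⟩ ⋯ ηₙ₋₁⟩ ηₙ⟩`, different summands being
orthogonal; the empty word is `ξ`. -/
abbrev FreeProdModule : Type _ := HilbertCompletion Bᵐᵒᵖ (PreFree φ k)

/-! #### The inclusion of `E_(→k)` in `E` and the projection onto it -/

/-- A reduced word of length at most `k` as a reduced word. -/
def inclWord (u : Word φ k) : Word φ ⊤ := ⟨u.1, u.2, le_top⟩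

theorem inclWord_injective : Function.Injective (inclWord : Word φ k → Word φ ⊤) :=
  fun u v h => by
    cases u
    cases v
    cases congrArg Word.val h
    rfl

variable (φ k) in
/-- The inclusion, on the level of words. -/
def inclPre : PreFree φ k →ₗ[ℂ] PreFree φ ⊤ := Finsupp.lmapDomain B ℂ inclWord

variable (φ k) in
/-- The projection, on the level of words: it drops the words of length greater than `k`. -/
def projPre : PreFree φ ⊤ →ₗ[ℂ] PreFree φ k := Finsupp.lcomapDomain inclWord inclWord_injective

theorem inclPre_single (u : Word φ k) (b : B) :
    inclPre φ k (Finsupp.single u b) = Finsupp.single (inclWord u) b :=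
  Finsupp.mapDomain_single

theorem projPre_single (u : Word φ k) (b : B) :
    projPre φ k (Finsupp.single (inclWord u) b) = Finsupp.single u b :=
  Finsupp.comapDomain_single inclWord u b inclWord_injective.injOn

theorem projPre_single_of_lt (v : Word φ ⊤) (hv : k < v.1.length) (b : B) :
    projPre φ k (Finsupp.single v b) = 0 := by
  ext u
  refine Finsupp.single_eq_of_ne fun h => ?_
  have h2 := u.3
  rw [← h] at hv
  exact absurd h2 (not_le.mpr hv)

theorem form_inclPre (f : PreFree φ k) (g : PreFree φ ⊤) :
    form (C := Bᵐᵒᵖ) (inclPre φ k f) g = form f (projPre φ k g) := by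
  induction f using Finsupp.induction_linear with
  | zero => rw [map_zero, form_zero_left, form_zero_left]
  | add f₁ f₂ h₁ h₂ => rw [map_add, form_add_left, form_add_left, h₁, h₂]
  | single u b =>
    induction g using Finsupp.induction_linear with
    | zero => rw [map_zero, form_zero_right, form_zero_right]
    | add g₁ g₂ h₁ h₂ => rw [map_add, form_add_right, form_add_right, h₁, h₂]
    | single v c =>
      rw [inclPre_single, form_single]
      by_cases hv : (v.1.length : ℕ∞) ≤ k
      · have e : v = inclWord ⟨v.1, v.2, hv⟩ := rfl
        rw [e, projPre_single, form_single]
        rfl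
      · rw [projPre_single_of_lt v (not_le.mp hv), form_zero_right, gram_length_ne]
        · rw [mul_zero, zero_mul, op_zero]
        · intro h
          refine hv ?_
          have h2 : (u.1.length : ℕ∞) ≤ k := u.3
          have h3 : u.1.length = v.1.length := h
          rwa [← h3]

theorem projPre_inclPre (f : PreFree φ k) : projPre φ k (inclPre φ k f) = f := by
  induction f using Finsupp.induction_linear with
  | zero => rw [map_zero, map_zero]
  | add f₁ f₂ h₁ h₂ => rw [map_add, map_add, h₁, h₂]
  | single u b => rw [inclPre_single, projPre_single]

theorem inclPre_bound (f : PreFree φ k) :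
    ‖form (C := Bᵐᵒᵖ) (inclPre φ k f) (inclPre φ k f)‖ ≤ 1 ^ 2 * ‖form (C := Bᵐᵒᵖ) f f‖ := by
  rw [form_inclPre, projPre_inclPre, one_pow, one_mul]

variable (φ k) in
/-- The isometric inclusion of `E_(→k)` in `E`. -/
def incl : FreeProdModule φ k →L[ℂ] FreeProdModule φ ⊤ := extend (inclPre φ k) 1 inclPre_bound

variable (φ k) in
/-- The projection of `E` onto `E_(→k)`. -/
def proj : FreeProdModule φ ⊤ →L[ℂ] FreeProdModule φ k :=
  extend (projPre φ k) 1 (bound_adjoint inclPre_bound form_inclPre)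

theorem inner_incl (x : FreeProdModule φ k) (y : FreeProdModule φ ⊤) :
    inner Bᵐᵒᵖ (incl φ k x) y = inner Bᵐᵒᵖ x (proj φ k y) :=
  inner_extend form_inclPre x y

theorem inner_proj (x : FreeProdModule φ ⊤) (y : FreeProdModule φ k) :
    inner Bᵐᵒᵖ (proj φ k x) y = inner Bᵐᵒᵖ x (incl φ k y) :=
  inner_extend (fun f g => by rw [← star_form, ← form_inclPre, star_form]) x y

variable (φ k) in
/-- The compression `Φ_k : 𝓛(E) → 𝓛(E_(→k))`, `Φ_k(x) = P x|`, where `P` is the projection of `E`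
onto `E_(→k)`. -/
def compress (x : Adjointable Bᵐᵒᵖ (FreeProdModule φ ⊤)) :
    Adjointable Bᵐᵒᵖ (FreeProdModule φ k) :=
  Adjointable.mk' (proj φ k ∘L x.toCLM ∘L incl φ k) (proj φ k ∘L (star x).toCLM ∘L incl φ k)
    fun y z => by
      simp only [ContinuousLinearMap.comp_apply]
      rw [inner_proj, x.inner_star, inner_incl]

/-! #### The action of `A_i` on `E` -/

open Classical in
/-- The vector `u b` of `E`, for a reduced word `u`. (It is used for reduced words only.) -/
def wordVec (u : List (Letter φ)) (b : B) : PreFree φ ⊤ :=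
  if h : IsReduced u then Finsupp.single ⟨u, h, le_top⟩ b else 0

/-- The left multiplication of a word by an element of `B`:
`c (ζ₁ ⊗ ⋯ ⊗ ζₙ) = (c ζ₁) ⊗ ζ₂ ⊗ ⋯ ⊗ ζₙ`, and `c ξ = ξ c`. -/
def lactWord (c : B) : List (Letter φ) → PreFree φ ⊤
  | [] => wordVec [] c
  | x :: u => wordVec (⟨x.1, acto (φ x.1) c x.2⟩ :: u) 1

/-- The unitary `V_i : E_i ⊗_B E(i) → E` on simple tensors `ζ ⊗ u`, where `u` is a reduced word that
does not start with a letter of index `i`: it maps `ζ ⊗ u` to `ζ ⊗ u` for `ζ ∈ E_i°`,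
and `ξ_i ⊗ u` to `u`. -/
def glue (i : I) (ζ : L2 (φ i)) (u : List (Letter φ)) : PreFree φ ⊤ :=
  wordVec (⟨i, projo (φ i) ζ⟩ :: u) 1 + lactWord (ip (xi (φ i)) ζ) u

open Classical in
/-- The adjoint `V_i* : E → E_i ⊗_B E(i)` on reduced words: the pair `(ζ, u)` stands for `ζ ⊗ u`. -/
def splitHead (i : I) : List (Letter φ) → L2 (φ i) × List (Letter φ)
  | [] => (xi (φ i), [])
  | x :: u => if x.1 = i then (x.comp i, u) else (xi (φ i), x :: u)

/-- `λ_i(a) = V_i (π_i(a) ⊗ 1) V_i*` on a reduced word. -/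
def lamWord (i : I) (a : A i) (u : List (Letter φ)) : PreFree φ ⊤ :=
  glue i (piRep (φ i) a (splitHead i u).1) (splitHead i u).2

variable (φ) in
/-- `λ_i(a)` on the span of the reduced words. -/
def lamPre (i : I) (a : A i) : PreFree φ ⊤ →ₗ[ℂ] PreFree φ ⊤ :=
  Finsupp.lsum ℂ fun u : Word φ ⊤ =>
    { toFun := fun b => op b • lamWord i a u.1
      map_add' := fun b c => by rw [op_add, add_smul]
      map_smul' := fun z b => by
        ext v
        simp }

theorem lamPre_single (i : I) (a : A i) (u : Word φ ⊤) (b : B) :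
    lamPre φ i a (Finsupp.single u b) = op b • lamWord i a u.1 :=
  Finsupp.lsum_single _ _ _ _

/-- `u` is a reduced word that does not start with a letter of index `i`. -/
def StartsOff (i : I) (u : List (Letter φ)) : Prop :=
  IsReduced u ∧ ∀ x ∈ u.head?, x.1 ≠ i

theorem StartsOff.cons {i : I} {u : List (Letter φ)} (hu : StartsOff i u) (ζ : L2o (φ i)) :
    IsReduced ((⟨i, ζ⟩ : Letter φ) :: u) :=
  List.isChain_cons.mpr ⟨fun x hx => (hu.2 x hx).symm, hu.1⟩

theorem IsReduced.startsOff {i : I} {ζ : L2o (φ i)} {u : List (Letter φ)}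
    (h : IsReduced ((⟨i, ζ⟩ : Letter φ) :: u)) : StartsOff i u :=
  ⟨(List.isChain_cons.mp h).2, fun x hx => ((List.isChain_cons.mp h).1 x hx).symm⟩

theorem IsReduced.replace {x : Letter φ} {u : List (Letter φ)} (h : IsReduced (x :: u))
    (ζ : L2o (φ x.1)) : IsReduced ((⟨x.1, ζ⟩ : Letter φ) :: u) :=
  List.isChain_cons.mpr (List.isChain_cons.mp h)

theorem isReduced_nil : IsReduced ([] : List (Letter φ)) := List.isChain_nil

theorem splitHead_cons_same (i : I) (ζ : L2o (φ i)) (u : List (Letter φ)) :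
    splitHead i ((⟨i, ζ⟩ : Letter φ) :: u) = ((ζ : L2 (φ i)), u) := by
  rw [splitHead, if_pos rfl, Letter.comp_self]

theorem splitHead_of_startsOff {i : I} {u : List (Letter φ)} (hu : StartsOff i u) :
    splitHead i u = (xi (φ i), u) := by
  cases u with
  | nil => rfl
  | cons x u => rw [splitHead, if_neg (hu.2 x (by simp))]

/-- A reduced word either starts with a letter of index `i` or not. -/
theorem reduced_cases (i : I) {u : List (Letter φ)} (hu : IsReduced u) :
    StartsOff i u ∨ ∃ (ζ : L2o (φ i)) (v : List (Letter φ)),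
      u = (⟨i, ζ⟩ : Letter φ) :: v ∧ StartsOff i v := by
  cases u with
  | nil => exact Or.inl ⟨hu, by simp⟩
  | cons x v =>
    obtain ⟨i', ζ⟩ := x
    by_cases h : i' = i
    · subst h
      exact Or.inr ⟨ζ, v, rfl, hu.startsOff⟩
    · exact Or.inl ⟨hu, by simpa using h⟩

theorem splitHead_startsOff (i : I) {u : List (Letter φ)} (hu : IsReduced u) :
    StartsOff i (splitHead i u).2 := by
  rcases reduced_cases i hu with h | ⟨ζ, v, rfl, hv⟩
  · rw [splitHead_of_startsOff h]; exact h
  · rw [splitHead_cons_same]; exact hv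

theorem wordVec_of_reduced {u : List (Letter φ)} (hu : IsReduced u) (b : B) :
    wordVec u b = Finsupp.single ⟨u, hu, le_top⟩ b := dif_pos hu

theorem form_wordVec {u v : List (Letter φ)} (hu : IsReduced u) (hv : IsReduced v) (b c : B) :
    form (C := Bᵐᵒᵖ) (wordVec u b) (wordVec v c) = op (star b * gram u v 1 * c) := by
  rw [wordVec_of_reduced hu, wordVec_of_reduced hv, form_single]

theorem lactWord_one (u : List (Letter φ)) : lactWord 1 u = wordVec u 1 := by
  cases u with
  | nil => rfl
  | cons x u => rw [lactWord, acto_one]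

theorem letterForm_acto (x y : Letter φ) (b c : B) :
    letterForm (⟨x.1, acto (φ x.1) b x.2⟩ : Letter φ) ⟨y.1, acto (φ y.1) c y.2⟩ 1
      = letterForm x y (star b * c) := by
  obtain ⟨i, ζ⟩ := x
  obtain ⟨i', η⟩ := y
  by_cases h : i = i'
  · subst h
    rw [letterForm_same, letterForm_same]
    exact leftForm_acto (φ i) ζ η b c
  · have h1 := letterForm_ne (x := (⟨i, ζ⟩ : Letter φ)) (y := ⟨i', η⟩) h
    have h2 := letterForm_ne (x := (⟨i, acto (φ i) b ζ⟩ : Letter φ))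
      (y := ⟨i', acto (φ i') c η⟩) h
    exact (LinearMap.congr_fun h2 1).trans (LinearMap.congr_fun h1 (star b * c)).symm

theorem form_lactWord {u v : List (Letter φ)} (hu : IsReduced u) (hv : IsReduced v) (b c : B) :
    form (C := Bᵐᵒᵖ) (lactWord b u) (lactWord c v) = op (gram u v (star b * c)) := by
  cases u with
  | nil =>
    cases v with
    | nil => rw [lactWord, lactWord, form_wordVec hu hv, gram_nil_nil, gram_nil_nil, mul_one]
    | cons y v =>
      rw [lactWord, lactWord, form_wordVec hu (hv.replace _), gram_nil_cons, gram_nil_cons]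
      simp
  | cons x u =>
    cases v with
    | nil =>
      rw [lactWord, lactWord, form_wordVec (hu.replace _) hv, gram_cons_nil, gram_cons_nil]
      simp
    | cons y v =>
      rw [lactWord, lactWord, form_wordVec (hu.replace _) (hv.replace _), gram_cons_cons,
        gram_cons_cons, letterForm_acto, star_one, one_mul, mul_one]

theorem form_wordVec_cons_lactWord {i : I} {u v : List (Letter φ)} (hu : StartsOff i u)
    (hv : StartsOff i v) (ζ : L2o (φ i)) (c : B) :
    form (C := Bᵐᵒᵖ) (wordVec ((⟨i, ζ⟩ : Letter φ) :: u) 1) (lactWord c v) = 0 := by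
  cases v with
  | nil =>
    rw [lactWord, form_wordVec (hu.cons _) hv.1, gram_cons_nil]
    simp
  | cons y v =>
    have hy : y.1 ≠ i := hv.2 y (by simp)
    rw [lactWord, form_wordVec (hu.cons _) (hv.1.replace _), gram_cons_cons,
      letterForm_ne (by exact hy.symm)]
    simp

theorem form_lactWord_wordVec_cons {i : I} {u v : List (Letter φ)} (hu : StartsOff i u)
    (hv : StartsOff i v) (ζ : L2o (φ i)) (c : B) :
    form (C := Bᵐᵒᵖ) (lactWord c v) (wordVec ((⟨i, ζ⟩ : Letter φ) :: u) 1) = 0 := by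
  rw [← star_form, form_wordVec_cons_lactWord hu hv, star_zero]

theorem form_wordVec_cons {i : I} {u v : List (Letter φ)} (hu : StartsOff i u)
    (hv : StartsOff i v) (ζ η : L2o (φ i)) :
    form (C := Bᵐᵒᵖ) (wordVec ((⟨i, ζ⟩ : Letter φ) :: u) 1) (wordVec ((⟨i, η⟩ : Letter φ) :: v) 1)
      = op (gram u v (ip (ζ : L2 (φ i)) η)) := by
  rw [form_wordVec (hu.cons _) (hv.cons _), gram_cons_cons, letterForm_same, leftForm_apply, lact_one,
    star_one, one_mul, mul_one]

/-- `V_i` is isometric. -/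
theorem form_glue {i : I} {u v : List (Letter φ)} (hu : StartsOff i u) (hv : StartsOff i v)
    (ζ η : L2 (φ i)) :
    form (C := Bᵐᵒᵖ) (glue i ζ u) (glue i η v) = op (gram u v (ip ζ η)) := by
  rw [glue, glue, form_add_left, form_add_right, form_add_right, form_wordVec_cons hu hv,
    form_wordVec_cons_lactWord hu hv, form_lactWord_wordVec_cons hv hu, form_lactWord hu.1 hv.1,
    add_zero, zero_add, ← op_add, ← map_add, ip_projo_projo, sub_add_cancel]

theorem form_wordVec_glue {i : I} {u v : List (Letter φ)} (hu : IsReduced u) (hv : StartsOff i v)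
    (η : L2 (φ i)) :
    form (C := Bᵐᵒᵖ) (wordVec u 1) (glue i η v)
      = op (gram (splitHead i u).2 v (ip (splitHead i u).1 η)) := by
  rcases reduced_cases i hu with h | ⟨ζ, w, rfl, hw⟩
  · rw [splitHead_of_startsOff h, glue, ← lactWord_one, form_add_right, form_lactWord_wordVec_cons hv h,
      form_lactWord h.1 hv.1, zero_add, star_one, one_mul]
  · rw [splitHead_cons_same, glue, form_add_right, form_wordVec_cons hw hv,
      form_wordVec_cons_lactWord hw hv, add_zero, ip_mem_projo]

theorem gram_splitHead (i : I) {u v : List (Letter φ)} (hu : IsReduced u) (hv : IsReduced v) :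
    gram u v 1
      = gram (splitHead i u).2 (splitHead i v).2 (ip (splitHead i u).1 (splitHead i v).1) := by
  rcases reduced_cases i hv with h | ⟨η, w, rfl, hw⟩
  · have h1 := form_wordVec_glue hu h (xi (φ i))
    have h2 := form_wordVec hu hv 1 1
    have h3 : form (C := Bᵐᵒᵖ) (wordVec u 1) (glue i (xi (φ i)) v)
        = form (C := Bᵐᵒᵖ) (wordVec u 1) (wordVec v 1) := by
      rcases reduced_cases i hu with h' | ⟨ζ, w, rfl, hw⟩
      · rw [glue, form_add_right, ip_xi_xi, lactWord_one, ← lactWord_one u,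
          form_lactWord_wordVec_cons h h', zero_add]
      · have h4 : (projo (φ i) (xi (φ i)) : L2 (φ i)) = 0 := by
          rw [projo_coe, ip_xi_xi, op_one, one_smul, sub_self]
        rw [glue, form_add_right, ip_xi_xi, lactWord_one, form_wordVec_cons hw h, h4, ip_zero_right,
          map_zero, op_zero, zero_add]
    rw [splitHead_of_startsOff h]
    rw [h3, h2, star_one, one_mul, mul_one] at h1
    exact op_injective h1
  · rw [splitHead_cons_same]
    have h1 := form_wordVec_glue hu hw (η : L2 (φ i))
    have h5 : ip (xi (φ i)) (η : L2 (φ i)) = 0 := η.2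
    have h2 := form_wordVec hu hv 1 1
    have h6 : form (C := Bᵐᵒᵖ) (wordVec u 1) (lactWord 0 w) = 0 := by
      rcases reduced_cases i hu with h' | ⟨ζ, w', rfl, hw'⟩
      · rw [← lactWord_one, form_lactWord h'.1 hw.1, mul_zero, map_zero, op_zero]
      · exact form_wordVec_cons_lactWord hw' hw _ _
    rw [glue, projo_of_mem, h5, form_add_right, h2, h6, add_zero, star_one, one_mul, mul_one] at h1
    exact op_injective h1

theorem form_bilin {X Y X' Y' : PreFree φ ⊤} (b c : B)
    (h : form (C := Bᵐᵒᵖ) X Y = form X' Y') :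
    form (C := Bᵐᵒᵖ) (op b • X) (op c • Y) = form (C := Bᵐᵒᵖ) (op b • X') (op c • Y') := by
  rw [form_smul_left, form_smul_left, form_smul_right, form_smul_right, h]

theorem single_eq (u : Word φ ⊤) (b : B) :
    (Finsupp.single u b : PreFree φ ⊤) = op b • wordVec u.1 1 := by
  rw [wordVec_of_reduced u.2, Finsupp.smul_single, op_smul_eq_mul, one_mul]

/-- To compare two sesquilinear expressions in linear maps, it suffices to do so on words. -/
theorem form_ext {S T S' T' : PreFree φ ⊤ →ₗ[ℂ] PreFree φ ⊤}
    (h : ∀ u v b c, form (C := Bᵐᵒᵖ) (S (Finsupp.single u b)) (T (Finsupp.single v c))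
      = form (C := Bᵐᵒᵖ) (S' (Finsupp.single u b)) (T' (Finsupp.single v c)))
    (f g : PreFree φ ⊤) : form (C := Bᵐᵒᵖ) (S f) (T g) = form (C := Bᵐᵒᵖ) (S' f) (T' g) := by
  induction f using Finsupp.induction_linear with
  | zero => rw [map_zero, map_zero, form_zero_left, form_zero_left]
  | add f₁ f₂ h₁ h₂ => rw [map_add, map_add, form_add_left, form_add_left, h₁, h₂]
  | single u b =>
    induction g using Finsupp.induction_linear with
    | zero => rw [map_zero, map_zero, form_zero_right, form_zero_right]
    | add g₁ g₂ h₁ h₂ => rw [map_add, map_add, form_add_right, form_add_right, h₁, h₂]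
    | single v c => exact h u v b c

theorem form_lamPre_lamPre (i : I) (a a' : A i) (f g : PreFree φ ⊤) :
    form (C := Bᵐᵒᵖ) (lamPre φ i a f) (lamPre φ i a' g)
      = form (C := Bᵐᵒᵖ) f (lamPre φ i (star a * a') g) := by
  refine form_ext (S' := LinearMap.id) (fun u v b c => ?_) f g
  rw [lamPre_single, lamPre_single, lamPre_single, LinearMap.id_apply, single_eq]
  refine form_bilin b c ?_
  rw [lamWord, lamWord, lamWord, form_glue (splitHead_startsOff i u.2) (splitHead_startsOff i v.2),
    form_wordVec_glue u.2 (splitHead_startsOff i v.2), ip_piRep, piRep_mul]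

theorem form_lamPre (i : I) (a : A i) (f g : PreFree φ ⊤) :
    form (C := Bᵐᵒᵖ) (lamPre φ i a f) g = form (C := Bᵐᵒᵖ) f (lamPre φ i (star a) g) := by
  refine form_ext (T := LinearMap.id) (S' := LinearMap.id) (fun u v b c => ?_) f g
  rw [lamPre_single, lamPre_single, LinearMap.id_apply, LinearMap.id_apply, single_eq, single_eq]
  refine form_bilin b c ?_
  rw [lamWord, lamWord, form_wordVec_glue u.2 (splitHead_startsOff i v.2), ← star_form,
    form_wordVec_glue v.2 (splitHead_startsOff i u.2), ← op_star, star_gram, ip_star, ip_piRep]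

theorem form_lamPre_one (i : I) (f g : PreFree φ ⊤) :
    form (C := Bᵐᵒᵖ) f (lamPre φ i 1 g) = form (C := Bᵐᵒᵖ) f g := by
  refine form_ext (S := LinearMap.id) (S' := LinearMap.id) (T' := LinearMap.id)
    (fun u v b c => ?_) f g
  rw [lamPre_single, LinearMap.id_apply, LinearMap.id_apply, single_eq, single_eq]
  refine form_bilin b c ?_
  rw [lamWord, form_wordVec_glue u.2 (splitHead_startsOff i v.2), piRep_one, form_wordVec u.2 v.2,
    gram_splitHead i u.2 v.2, star_one, one_mul, mul_one]

theorem form_lamPre_linear (i : I) (f g : PreFree φ ⊤) :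
    ∃ L : A i →ₗ[ℂ] Bᵐᵒᵖ, ∀ a, form (C := Bᵐᵒᵖ) f (lamPre φ i a g) = L a := by
  induction f using Finsupp.induction_linear with
  | zero => exact ⟨0, fun a => form_zero_left _⟩
  | add f₁ f₂ h₁ h₂ =>
    obtain ⟨L₁, h₁⟩ := h₁
    obtain ⟨L₂, h₂⟩ := h₂
    exact ⟨L₁ + L₂, fun a => by rw [form_add_left, h₁, h₂]; rfl⟩
  | single u b =>
    induction g using Finsupp.induction_linear with
    | zero => exact ⟨0, fun a => by rw [map_zero]; exact form_zero_right _⟩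
    | add g₁ g₂ h₁ h₂ =>
      obtain ⟨L₁, h₁⟩ := h₁
      obtain ⟨L₂, h₂⟩ := h₂
      exact ⟨L₁ + L₂, fun a => by rw [map_add, form_add_right, h₁, h₂]; rfl⟩
    | single v c =>
      let ζ := (splitHead i u.1).1
      let η := (splitHead i v.1).1
      let L₀ : A i →ₗ[ℂ] B :=
        { toFun := fun a => ip ζ (piRep (φ i) a η)
          map_add' := fun a a' => by rw [piRep_add, ip_add_right]
          map_smul' := fun z a => by rw [piRep_smul, ip_smul_right]; rfl }
      refine ⟨LinearMap.mulRight ℂ (star (op b)) ∘ₗ LinearMap.mulLeft ℂ (op c) ∘ₗ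
        (opLinearEquiv ℂ).toLinearMap ∘ₗ gram (splitHead i u.1).2 (splitHead i v.1).2 ∘ₗ L₀,
        fun a => ?_⟩
      rw [lamPre_single, single_eq, form_smul_left, form_smul_right, lamWord,
        form_wordVec_glue u.2 (splitHead_startsOff i v.2)]
      rfl

variable (φ) in
/-- The representation `λ_i` of `A_i` on `E`: `λ_i(a) = V_i (π_i(a) ⊗ 1) V_i*`, whose adjoint is
`λ_i(a*)`. -/
def lam (i : I) (a : A i) : Adjointable Bᵐᵒᵖ (FreeProdModule φ ⊤) :=
  have bound (a : A i) (f : PreFree φ ⊤) := bound_of_rep (lamPre φ i)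
    (fun a x y => form_lamPre_lamPre i a a x y) (form_lamPre_one i) (form_lamPre_linear i) a f
  Adjointable.mk' (extend (lamPre φ i a) ‖a‖ (bound a))
    (extend (lamPre φ i (star a)) ‖star a‖ (bound (star a)))
    fun x y => inner_extend (form_lamPre i a) x y

variable (φ) in
/-- The reduced amalgamated free product `A` of the `(A_i, φ_i)`: the C⋆-subalgebra of `𝓛(E)`
generated by the `λ_i(A_i)`. -/
def freeProd : StarSubalgebra ℂ (Adjointable Bᵐᵒᵖ (FreeProdModule φ ⊤)) :=
  (StarAlgebra.adjoin ℂ (⋃ i, Set.range (lam φ i))).topologicalClosure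

end FreeModule

end FreeProd

end

/-! Let `F` be the module spanned by all words. A reduced word `u` of length `n` can be cut as `u =
u₁ u₂` with `u₁` of length `p`, and real weights `c(n, p)` give an operator `V : E → E ⊗ F`, `V u =
∑ₚ c(n, p) u₁ ⊗ u₂`. Cuts at different positions are orthogonal, and cuts of `u` and `v` at the same
position have inner product `⟨u, v⟩` (`gram_append`). So `V* V` multiplies `u` by `∑ₚ c(n, p)²`
(`form_cutPre`), and `V` is an isometry when the squares sum to `1`. It has an adjoint, given by
weighted concatenation (`exists_adjoint_cut`).

If the weights vanish for `p > k`, then `(P_k ⊗ 1) V = V`. The map `Ψ_k(T) = V* (T ⊗ 1) V`, with `T`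
extended by zero from `E_(→k)` to `E`, is completely positive and unital, and `Ψ_k(Φ_k(a)) = V* (P_k
a P_k ⊗ 1) V = V* (a ⊗ 1) V`. Hence `a - Ψ_k(Φ_k(a)) = V* (V a - (a ⊗ 1) V)`, whose norm is at most
that of the commutator `(a ⊗ 1) V - V a` (`exists_cp_of_weights`).

It remains to see that the commutator tends to zero for `a` in `A`. By the Leibniz rule and a
uniform bound, the elements with this property form a closed subalgebra, so the generators `λ_i(a)`
suffice. Under `E = E_i ⊗ E(i)`, the operator `λ_i(a)` touches the head in `E_i` only. Cutting just
the factor in `E(i)` therefore commutes with it exactly (`amp_lam_cut_headWeight`). This modified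
cutting is again of the above form: on a word beginning with `i`, the weight `c(n, p)` is replaced
by `c(n - 1, p - 1)`. With square weights `1/k` spread evenly over the cut positions, and the
remaining mass at `p = n`, this shift is felt at three positions only (`weight_sub_sq_le`). The two
cutting operators then differ by at most `√(3/k)` in norm, which gives `norm_commutator_lam_le`. -/

noncomputable section

namespace FreeProd

open UniformSpace MulOpposite PreCStarModule

/-! ### Operators between Hilbert modules -/

section Operators

variable {C X Y : Type*} [CStarAlgebra C] [PartialOrder C] [StarOrderedRing C]
  [NormedAddCommGroup X] [NormedSpace ℂ X] [CompleteSpace X] [SMul C X] [CStarModule C X]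
  [NormedAddCommGroup Y] [NormedSpace ℂ Y] [CompleteSpace Y] [SMul C Y] [CStarModule C Y]

theorem ext_inner_left {x y : X} (h : ∀ z, inner C x z = inner C y z) : x = y := by
  refine Adjointable.ext_inner (C := C) fun z => ?_
  rw [← CStarModule.star_inner (A := C) x z, h, CStarModule.star_inner]

/-- An operator with an adjoint is linear over the coefficient algebra. -/
theorem map_smul_of_adjoint {V : X →L[ℂ] Y} {W : Y →L[ℂ] X}
    (h : ∀ x y, inner C (V x) y = inner C x (W y)) (c : C) (x : X) : V (c • x) = c • V x := by
  refine ext_inner_left (C := C) fun z => ?_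
  rw [h, CStarModule.inner_op_smul_left, CStarModule.inner_op_smul_left, h]

/-- Cauchy–Schwarz at `x = z`. Here `z` is the value that an adjoint of `V` must take at `y`, so
this bounds adjoints and makes their values depend continuously on `y`. -/
theorem norm_le_of_inner_eq {V : X →L[ℂ] Y} {z : X} {y : Y}
    (h : ∀ x, inner C (V x) y = inner C x z) : ‖z‖ ≤ ‖V‖ * ‖y‖ := by
  have h1 : ‖z‖ ^ 2 ≤ ‖z‖ * (‖V‖ * ‖y‖) := by
    rw [CStarModule.norm_sq_eq (A := C), ← h]
    calc _ ≤ ‖V z‖ * ‖y‖ := CStarModule.norm_inner_le Y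
      _ ≤ (‖V‖ * ‖z‖) * ‖y‖ := by gcongr; exact V.le_opNorm z
      _ = _ := by ring
  rcases (norm_nonneg z).eq_or_lt with h0 | h0
  · rw [← h0]; positivity
  · rw [sq] at h1
    exact le_of_mul_le_mul_left h1 h0

/-- The vectors on which a bounded operator has an adjoint form a closed subspace. -/
def adjointDomain (C : Type*) [CStarAlgebra C] [PartialOrder C] [StarOrderedRing C]
    [SMul C X] [CStarModule C X] [SMul C Y] [CStarModule C Y] (V : X →L[ℂ] Y) :
    Submodule ℂ Y where
  carrier := {y | ∃ z : X, ∀ x, inner C (V x) y = inner C x z}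
  add_mem' := by
    rintro y₁ y₂ ⟨z₁, h₁⟩ ⟨z₂, h₂⟩
    exact ⟨z₁ + z₂, fun x => by simp [h₁, h₂]⟩
  zero_mem' := ⟨0, fun x => by simp⟩
  smul_mem' := by
    rintro w y ⟨z, h⟩
    exact ⟨w • z, fun x => by simp [h]⟩

/-- Bounded operators between Hilbert modules need not have adjoints. Since the domain of the
adjoint is closed, it is enough to exhibit the adjoint on vectors with dense span. -/
theorem isClosed_adjointDomain (V : X →L[ℂ] Y) : IsClosed (adjointDomain C V : Set Y) := by
  refine IsSeqClosed.isClosed fun y y₀ hy hlim => ?_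
  choose z hz using hy
  have hc : CauchySeq z := by
    have h := hlim.cauchySeq
    rw [Metric.cauchySeq_iff] at h ⊢
    intro ε hε
    -- The summand `1` keeps the denominator positive when `V = 0`.
    obtain ⟨N, hN⟩ := h (ε / (‖V‖ + 1)) (by positivity)
    refine ⟨N, fun m hm n hn => ?_⟩
    have h1 := hN m hm n hn
    rw [dist_eq_norm] at h1 ⊢
    have h2 : ‖z m - z n‖ ≤ ‖V‖ * ‖y m - y n‖ := norm_le_of_inner_eq (C := C) fun x => by
      rw [CStarModule.inner_sub_right, CStarModule.inner_sub_right, hz, hz]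
    rw [lt_div_iff₀ (by positivity)] at h1
    nlinarith [norm_nonneg (y m - y n)]
  obtain ⟨z₀, hz₀⟩ := cauchySeq_tendsto_of_complete hc
  refine ⟨z₀, fun x => ?_⟩
  have h1 := ((CStarModule.continuous_inner (A := C) (E := Y)).tendsto (V x, y₀)).comp
    (tendsto_const_nhds.prodMk_nhds hlim)
  have h2 := ((CStarModule.continuous_inner (A := C) (E := X)).tendsto (x, z₀)).comp
    (tendsto_const_nhds.prodMk_nhds hz₀)
  exact tendsto_nhds_unique h1 (h2.congr fun n => (hz n x).symm)

theorem exists_adjoint {V : X →L[ℂ] Y} (h : ∀ y, y ∈ adjointDomain C V) :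
    ∃ W : Y →L[ℂ] X, ∀ x y, inner C (V x) y = inner C x (W y) := by
  choose W hW using h
  have hW' (y : Y) (x : X) : inner C (V x) y = inner C x (W y) := hW y x
  let W' : Y →ₗ[ℂ] X :=
    { toFun := W
      map_add' := fun y₁ y₂ => Adjointable.ext_inner (C := C) fun x => by
        rw [← hW', CStarModule.inner_add_right, CStarModule.inner_add_right, hW', hW']
      map_smul' := fun w y => Adjointable.ext_inner (C := C) fun x => by
        rw [← hW', RingHom.id_apply, CStarModule.inner_smul_right_complex,
          CStarModule.inner_smul_right_complex, hW'] }
  exact ⟨W'.mkContinuous ‖V‖ fun y => norm_le_of_inner_eq (hW' y), fun x y => hW' y x⟩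

theorem inner_adjoint_left {V : X →L[ℂ] Y} {W : Y →L[ℂ] X}
    (h : ∀ x y, inner C (V x) y = inner C x (W y)) (y : Y) (x : X) :
    inner C (W y) x = inner C y (V x) := by
  rw [← CStarModule.star_inner (A := C), ← h, CStarModule.star_inner]

/-- An adjointable operator `T` with `⟨x, T x⟩ ≥ 0` for all `x` is positive. -/
theorem Adjointable.nonneg_of_inner {T : Adjointable C X} (hT : star T = T)
    (h : ∀ x, 0 ≤ inner C x (T.toCLM x)) : 0 ≤ T := by
  -- `N` is the negative part of `T`, so `N T N = -N³`. Testing the hypothesis on `N x` gives `-⟨x,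
  -- N³ x⟩ ≥ 0`, and since `N³ = K* K` this forces `K = 0`, then `N = 0`.
  obtain ⟨N, hN, h3, h4, h5⟩ := exists_negPart hT
  refine h5 ?_
  obtain ⟨K, hK⟩ := exists_star_mul_self h3
  have hK0 : K = 0 := by
    refine Adjointable.toCLM_injective ?_
    ext x
    change K.toCLM x = 0
    rw [← CStarModule.inner_self (A := C)]
    refine le_antisymm ?_ CStarModule.inner_self_nonneg
    have e1 : inner C (K.toCLM x) (K.toCLM x) = inner C x ((N * N * N).toCLM x) := by
      rw [hK, Adjointable.inner_star]; rfl
    have e2 : inner C (N.toCLM x) (T.toCLM (N.toCLM x)) = -inner C x ((N * N * N).toCLM x) := by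
      rw [Adjointable.inner_star, hN, ← CStarModule.inner_neg_right]
      have e3 : N.toCLM (T.toCLM (N.toCLM x)) = (N * T * N).toCLM x := rfl
      rw [e3, h4]
      rfl
    rw [e1, ← neg_nonneg, ← e2]
    exact h _
  have h6 : N * N * N = 0 := by rw [hK, hK0, mul_zero]
  have h7 : N * N = 0 := by
    refine (CStarRing.star_mul_self_eq_zero_iff _).mp ?_
    rw [star_mul, hN, ← mul_assoc, h6, zero_mul]
  refine (CStarRing.star_mul_self_eq_zero_iff _).mp ?_
  rw [hN, h7]

theorem Adjointable.toCLM_sum {n : Type*} (s : Finset n) (f : n → Adjointable C X) :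
    (∑ i ∈ s, f i).toCLM = ∑ i ∈ s, (f i).toCLM :=
  map_sum (adjointableSubalgebra C X).val f s

theorem nonneg_of_isPSD {R n : Type*} [CStarAlgebra R] [PartialOrder R] [StarOrderedRing R]
    [Fintype n] {M : CStarMatrix n n R} (hM : IsPSD fun i k => M i k) : 0 ≤ M := by
  obtain ⟨d, hd⟩ := hM.exists_factor
  have h : M = star (CStarMatrix.ofMatrix d) * CStarMatrix.ofMatrix d := by
    ext i k
    rw [hd, CStarMatrix.mul_apply]
    rfl
  rw [h]
  exact star_mul_self_nonneg _

/-- The compression `T ↦ V* T V` of operators. -/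
def conj (V : X →L[ℂ] Y) (W : Y →L[ℂ] X) (h : ∀ x y, inner C (V x) y = inner C x (W y)) :
    Adjointable C Y →ₗ[ℂ] Adjointable C X where
  toFun T := Adjointable.mk' (W ∘L T.toCLM ∘L V) (W ∘L (star T).toCLM ∘L V) fun x y => by
    simp only [ContinuousLinearMap.comp_apply]
    rw [inner_adjoint_left h, T.inner_star, h]
  map_add' S T := Adjointable.toCLM_injective <| by
    ext x
    exact W.map_add (S.toCLM (V x)) (T.toCLM (V x))
  map_smul' z T := Adjointable.toCLM_injective <| by
    ext x
    exact W.map_smul z (T.toCLM (V x))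

theorem conj_apply {V : X →L[ℂ] Y} {W : Y →L[ℂ] X}
    (h : ∀ x y, inner C (V x) y = inner C x (W y)) (T : Adjointable C Y) (x : X) :
    (conj V W h T).toCLM x = W (T.toCLM (V x)) := rfl

theorem star_conj {V : X →L[ℂ] Y} {W : Y →L[ℂ] X}
    (h : ∀ x y, inner C (V x) y = inner C x (W y)) (T : Adjointable C Y) :
    star (conj V W h T) = conj V W h (star T) :=
  Adjointable.star_eq_of _ _ fun x y => by
    rw [conj_apply, conj_apply, inner_adjoint_left h, T.inner_star, h]

/-- Write `M = N* N`. Testing the compressed matrix against operators `b i` and a vector `x` gives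
`∑ ⟨y l, y l⟩` with `y l = ∑ N l i V (b i) x`. This criterion avoids identifying matrices over
`𝓛(X)` with operators on a direct sum of copies of `X`. -/
theorem map_conj_nonneg {V : X →L[ℂ] Y} {W : Y →L[ℂ] X}
    (h : ∀ x y, inner C (V x) y = inner C x (W y)) {n : Type*} [Fintype n]
    {M : CStarMatrix n n (Adjointable C Y)} (hM : 0 ≤ M) : 0 ≤ M.map (conj V W h) := by
  classical
  obtain ⟨N, hN⟩ := exists_star_mul_self hM
  have hMs : star M = M := IsSelfAdjoint.of_nonneg hM
  have hstar (i k : n) : star (M i k) = M k i := by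
    conv_rhs => rw [← hMs]
    rfl
  have hF (i k : n) : star (conj V W h (M i k)) = conj V W h (M k i) := by
    rw [star_conj, hstar]
  refine nonneg_of_isPSD ?_
  change IsPSD fun i k => conj V W h (M i k)
  refine ⟨hF, fun b => ?_⟩
  refine Adjointable.nonneg_of_inner ?_ fun x => ?_
  · rw [star_sum, Finset.sum_comm]
    refine Finset.sum_congr rfl fun i _ => ?_
    rw [star_sum]
    refine Finset.sum_congr rfl fun k _ => ?_
    rw [star_mul, star_mul, star_star, hF, mul_assoc]
  · let y (l : n) : Y := ∑ i, (N l i).toCLM (V ((b i).toCLM x))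
    have e : inner C x ((∑ i, ∑ k, star (b i) * conj V W h (M i k) * b k).toCLM x)
        = ∑ l, inner C (y l) (y l) := by
      have e1 (i k : n) : inner C x ((star (b i) * conj V W h (M i k) * b k).toCLM x)
          = ∑ l, inner C ((N l i).toCLM (V ((b i).toCLM x)))
            ((N l k).toCLM (V ((b k).toCLM x))) := by
        have e2 : (star (b i) * conj V W h (M i k) * b k).toCLM x
            = (star (b i)).toCLM (W ((M i k).toCLM (V ((b k).toCLM x)))) := rfl
        have e3 : (M i k).toCLM (V ((b k).toCLM x))
            = ∑ l, (star (N l i)).toCLM ((N l k).toCLM (V ((b k).toCLM x))) := by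
          have e4 : M i k = ∑ l, star (N l i) * N l k := by
            rw [hN, CStarMatrix.mul_apply]; rfl
          rw [e4, Adjointable.toCLM_sum, sum_apply]
          rfl
        rw [e2, ← Adjointable.inner_star, ← h, e3, CStarModule.inner_sum_right]
        exact Finset.sum_congr rfl fun l _ => (Adjointable.inner_star _ _ _).symm
      simp only [Adjointable.toCLM_sum, sum_apply,
        CStarModule.inner_sum_right, e1, y, CStarModule.inner_sum_left]
      rw [Finset.sum_congr rfl fun i _ => Finset.sum_comm, Finset.sum_comm]
      refine Finset.sum_congr rfl fun l _ => ?_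
      rw [Finset.sum_comm]
    rw [e]
    exact Finset.sum_nonneg fun l _ => CStarModule.inner_self_nonneg

/-- The completely positive map `a ↦ V* κ(a) V`, for a `*`-homomorphism `κ`. -/
def stinespring {R : Type*} [CStarAlgebra R] [PartialOrder R] [StarOrderedRing R]
    (κ : R →⋆ₙₐ[ℂ] Adjointable C Y) (V : X →L[ℂ] Y) (W : Y →L[ℂ] X)
    (h : ∀ x y, inner C (V x) y = inner C x (W y)) :
    CompletelyPositiveMap R (Adjointable C X) where
  toLinearMap := conj V W h ∘ₗ (κ : R →ₗ[ℂ] Adjointable C Y)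
  map_cstarMatrix_nonneg' _ M hM := by
    have h1 : 0 ≤ M.map κ :=
      NonUnitalStarAlgHomClass.instCompletelyPositiveMapClass.map_cstarMatrix_nonneg' κ _ M hM
    exact map_conj_nonneg h h1

end Operators

/-! ### The semi-inner-product module of a positive kernel -/

section Kernel

variable {B : Type*} [CStarAlgebra B] [PartialOrder B] [StarOrderedRing B] {α β : Type*}

/-- `⟨∑ u b_u, ∑ v c_v⟩ = ∑ b_u* K(u, v) c_v`. -/
def sesqForm (K : α → α → B) (f g : α →₀ B) : B :=
  f.sum fun u b => g.sum fun v c => star b * K u v * c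

theorem sesqForm_smul_right {R : Type*} [Monoid R] [DistribMulAction R B] [SMulCommClass R B B]
    (K : α → α → B) (z : R) (f g : α →₀ B) : sesqForm K f (z • g) = z • sesqForm K f g := by
  rw [sesqForm, sesqForm, Finsupp.smul_sum]
  refine Finsupp.sum_congr fun u _ => ?_
  rw [Finsupp.smul_sum, Finsupp.sum_smul_index' fun v => mul_zero _]
  exact Finsupp.sum_congr fun v _ => mul_smul_comm _ _ _

/-- The inner product of the free right `B`-module on `α` defined by a positive kernel. -/
abbrev kernelModule (K : α → α → B)
    (hK : ∀ s : Finset α, IsPSD fun a b : s => K a b) (hstar : ∀ a b, star (K a b) = K b a) :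
    PreCStarModule Bᵐᵒᵖ (α →₀ B) where
  form f g := op (sesqForm K f g)
  form_add_right f g h := by
    rw [sesqForm, sesqForm, sesqForm, ← op_add, ← Finsupp.sum_add]
    refine congrArg op (Finsupp.sum_congr fun u _ => ?_)
    rw [Finsupp.sum_add_index' (fun v => mul_zero _) fun v b c => mul_add _ _ _]
  form_smul_right b f g := by
    rw [sesqForm_smul_right]
    exact op_mul _ _
  form_complex_smul_right z f g := by rw [sesqForm_smul_right, op_smul]
  star_form f g := by
    rw [← op_star, sesqForm, sesqForm, Finsupp.sum_comm, Finsupp.sum, star_sum]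
    refine congrArg op (Finset.sum_congr rfl fun u _ => ?_)
    rw [Finsupp.sum, star_sum]
    refine Finset.sum_congr rfl fun v _ => ?_
    change star (star (f v) * K v u * g u) = star (g u) * K u v * f v
    rw [star_mul, star_mul, star_star, hstar, mul_assoc]
  form_self_nonneg f := by
    have h := (hK f.support).2 fun u => f u.1
    have h2 : sesqForm K f f
        = ∑ u : f.support, ∑ v : f.support, star (f u.1) * K u.1 v.1 * f v.1 := by
      rw [Finset.sum_coe_sort f.support fun u =>
        ∑ v : f.support, star (f u) * K u v.1 * f v.1]
      refine Finset.sum_congr rfl fun u _ => ?_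
      rw [Finset.sum_coe_sort f.support fun v => star (f u) * K u v * f v]
      rfl
    rw [← h2] at h
    exact h

theorem sesqForm_single (K : α → α → B) (u v : α) (b c : B) :
    sesqForm K (Finsupp.single u b) (Finsupp.single v c) = star b * K u v * c := by
  rw [sesqForm, Finsupp.sum_single_index, Finsupp.sum_single_index]
  · exact mul_zero _
  · simp

/-- Two sesquilinear expressions agree if they agree on the generators. -/
theorem form_ext_single {C V W : Type*} [CStarAlgebra C] [PartialOrder C]
    [AddCommGroup V] [Module ℂ V] [Module C V] [PreCStarModule C V]
    [AddCommGroup W] [Module ℂ W] [Module C W] [PreCStarModule C W]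
    {S : (α →₀ B) →ₗ[ℂ] V} {T : (β →₀ B) →ₗ[ℂ] V}
    {S' : (α →₀ B) →ₗ[ℂ] W} {T' : (β →₀ B) →ₗ[ℂ] W}
    (h : ∀ u v b c, form (C := C) (S (Finsupp.single u b)) (T (Finsupp.single v c))
      = form (C := C) (S' (Finsupp.single u b)) (T' (Finsupp.single v c)))
    (f : α →₀ B) (g : β →₀ B) : form (C := C) (S f) (T g) = form (C := C) (S' f) (T' g) := by
  induction f using Finsupp.induction_linear with
  | zero => rw [map_zero, map_zero, form_zero_left, form_zero_left]
  | add f₁ f₂ h₁ h₂ => rw [map_add, map_add, form_add_left, form_add_left, h₁, h₂]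
  | single u b =>
    induction g using Finsupp.induction_linear with
    | zero => rw [map_zero, map_zero, form_zero_right, form_zero_right]
    | add g₁ g₂ h₁ h₂ => rw [map_add, map_add, form_add_right, form_add_right, h₁, h₂]
    | single v c => exact h u v b c

end Kernel

/-! ### Calculus in the completion of a semi-inner-product module. -/

section Completion

variable {C : Type*} [CStarAlgebra C] [PartialOrder C] [StarOrderedRing C]
  {V : Type*} [AddCommGroup V] [Module ℂ V] [Module C V] [PreCStarModule C V]

theorem toHilbert_add (x y : V) :
    toHilbert (C := C) (x + y) = toHilbert (C := C) x + toHilbert (C := C) y :=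
  Completion.coe_add (α := WithForm C V) x y

theorem toHilbert_smul (z : ℂ) (x : V) : toHilbert (C := C) (z • x) = z • toHilbert (C := C) x :=
  Completion.coe_smul (X := WithForm C V) z x

theorem toHilbert_op_smul (c : C) (x : V) :
    toHilbert (C := C) (c • x) = c • toHilbert (C := C) x :=
  Completion.coe_smul (X := WithForm C V) c x

theorem toHilbert_zero : toHilbert (C := C) (0 : V) = 0 := by
  simpa using toHilbert_smul (C := C) 0 (0 : V)

theorem toHilbert_sum {n : Type*} (s : Finset n) (x : n → V) :
    toHilbert (C := C) (∑ i ∈ s, x i) = ∑ i ∈ s, toHilbert (C := C) (x i) := by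
  classical
  induction s using Finset.induction_on with
  | empty => simp [toHilbert_zero]
  | insert a s ha ih => rw [Finset.sum_insert ha, Finset.sum_insert ha, toHilbert_add, ih]

theorem norm_toHilbert_sq (x : V) : ‖toHilbert (C := C) x‖ ^ 2 = ‖form (C := C) x x‖ := by
  rw [CStarModule.norm_sq_eq (A := C), inner_toHilbert]

theorem hilbert_inner_add_right (x y z : HilbertCompletion C V) :
    inner C x (y + z) = inner C x y + inner C x z :=
  CStarModule.inner_add_right (A := C) (x := x) (y := y) (z := z)

theorem hilbert_inner_add_left (x y z : HilbertCompletion C V) :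
    inner C (x + y) z = inner C x z + inner C y z :=
  CStarModule.inner_add_left (A := C) (x := x) (y := y) (z := z)

theorem hilbert_inner_zero_left (x : HilbertCompletion C V) : inner C 0 x = 0 :=
  CStarModule.inner_zero_left (A := C) (x := x)

theorem hilbert_inner_zero_right (x : HilbertCompletion C V) : inner C x 0 = 0 :=
  CStarModule.inner_zero_right (A := C) (x := x)

theorem hilbert_inner_op_smul_right (c : C) (x y : HilbertCompletion C V) :
    inner C x (c • y) = c * inner C x y :=
  CStarModule.inner_op_smul_right (A := C) (a := c) (x := x) (y := y)

theorem hilbert_inner_op_smul_left (c : C) (x y : HilbertCompletion C V) :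
    inner C (c • x) y = inner C x y * star c :=
  CStarModule.inner_op_smul_left (A := C) (a := c) (x := x) (y := y)

theorem hilbert_inner_smul_right (z : ℂ) (x y : HilbertCompletion C V) :
    inner C x (z • y) = z • inner C x y :=
  CStarModule.inner_smul_right_complex (A := C) (z := z) (x := x) (y := y)

theorem hilbert_inner_sum_right {n : Type*} (s : Finset n) (x : HilbertCompletion C V)
    (y : n → HilbertCompletion C V) :
    inner C x (∑ i ∈ s, y i) = ∑ i ∈ s, inner C x (y i) :=
  CStarModule.inner_sum_right (A := C) (x := x) (y := y)

theorem hilbert_inner_sum_left {n : Type*} (s : Finset n) (x : n → HilbertCompletion C V)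
    (y : HilbertCompletion C V) :
    inner C (∑ i ∈ s, x i) y = ∑ i ∈ s, inner C (x i) y :=
  CStarModule.inner_sum_left (A := C) (x := x) (y := y)

theorem norm_hilbert_inner_le (x y : HilbertCompletion C V) : ‖inner C x y‖ ≤ ‖x‖ * ‖y‖ :=
  CStarModule.norm_inner_le (A := C) _ (x := x) (y := y)

theorem ext_inner_toHilbert {x y : HilbertCompletion C V}
    (h : ∀ z : V, inner C (toHilbert z) x = inner C (toHilbert z) y) : x = y :=
  Adjointable.ext_inner (C := C) fun z => hilbert_induction z
    (p := fun z => inner C z x = inner C z y)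
    (isClosed_eq (cont_inner continuous_id continuous_const)
      (cont_inner continuous_id continuous_const)) h

end Completion

/-! ### Tensor products with words -/

section Tensor

variable {B : Type*} [CStarAlgebra B] [PartialOrder B] [StarOrderedRing B]
  {I : Type*} {A : I → Type*} [∀ i, CStarAlgebra (A i)]
  {j : ∀ i, B →⋆ₐ[ℂ] A i} {φ : ∀ i, CondExp (j i)}

/-- The kernel `⟨x ⊗ v, y ⊗ w⟩ = ⟨v, ⟨x, y⟩ w⟩`, for `x`, `y` in `E` and words `v`, `w`. -/
def tensKernel (p q : FreeProdModule φ ⊤ × List (Letter φ)) : B :=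
  gram p.2 q.2 (inner Bᵐᵒᵖ p.1 q.1).unop

/-- The quadratic form at `b` is the inner square of the vector `∑ x_a b_a`. -/
theorem isPSD_inner {n : Type*} [Fintype n] (x : n → FreeProdModule φ ⊤) :
    IsPSD fun a b => (inner Bᵐᵒᵖ (x a) (x b)).unop := by
  refine ⟨fun a b => congrArg unop (CStarModule.star_inner (A := Bᵐᵒᵖ) (x a) (x b)), fun b => ?_⟩
  have h : (0 : Bᵐᵒᵖ) ≤ inner Bᵐᵒᵖ (∑ a, op (b a) • x a) (∑ a, op (b a) • x a) :=
    inner_self_nonneg_completion _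
  have h2 : ∑ a, ∑ a', star (b a) * (inner Bᵐᵒᵖ (x a) (x a')).unop * b a'
      = (inner Bᵐᵒᵖ (∑ a, op (b a) • x a) (∑ a, op (b a) • x a)).unop := by
    rw [hilbert_inner_sum_left, Finset.unop_sum]
    refine Finset.sum_congr rfl fun a _ => ?_
    rw [hilbert_inner_sum_right, Finset.unop_sum]
    refine Finset.sum_congr rfl fun a' _ => ?_
    rw [hilbert_inner_op_smul_right, hilbert_inner_op_smul_left, unop_mul, unop_mul,
      unop_star, unop_op, unop_op]
  rw [h2]
  exact h

variable (φ) in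
/-- The algebraic tensor product of `E` with the words. -/
abbrev PreTens : Type _ := (FreeProdModule φ ⊤ × List (Letter φ)) →₀ B

/-- Positivity comes from `IsPSD.gram`: passing the positive Gram matrix of the vectors of `E`
through the kernel of the words keeps it positive. The words need not be reduced for this, so the
second leg may be any list of letters. -/
instance : PreCStarModule Bᵐᵒᵖ (PreTens φ) :=
  kernelModule tensKernel
    (fun s => (isPSD_inner fun a : s => a.1.1).gram fun a : s => a.1.2)
    fun p q => by
      rw [tensKernel, star_gram]
      exact congrArg (gram q.2 p.2)
        (congrArg unop (CStarModule.star_inner (A := Bᵐᵒᵖ) p.1 q.1))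

theorem form_tens_single (p q : FreeProdModule φ ⊤ × List (Letter φ)) (b c : B) :
    form (C := Bᵐᵒᵖ) (Finsupp.single p b : PreTens φ) (Finsupp.single q c)
      = op (star b * gram p.2 q.2 (inner Bᵐᵒᵖ p.1 q.1).unop * c) :=
  congrArg op (sesqForm_single tensKernel p q b c)

variable (φ) in
/-- The tensor product of `E` with the module spanned by the words. -/
abbrev TensModule : Type _ := HilbertCompletion Bᵐᵒᵖ (PreTens φ)

/-- The vector `x ⊗ v b`. -/
def tens (x : FreeProdModule φ ⊤) (v : List (Letter φ)) (b : B) : TensModule φ :=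
  toHilbert (C := Bᵐᵒᵖ) (Finsupp.single (x, v) b : PreTens φ)

theorem inner_tens (x y : FreeProdModule φ ⊤) (v w : List (Letter φ)) (b c : B) :
    inner Bᵐᵒᵖ (tens x v b) (tens y w c)
      = op (star b * gram v w (inner Bᵐᵒᵖ x y).unop * c) :=
  (inner_toHilbert (C := Bᵐᵒᵖ) _ _).trans (form_tens_single (x, v) (y, w) b c)

theorem toHilbert_single (p : FreeProdModule φ ⊤ × List (Letter φ)) (b : B) :
    toHilbert (C := Bᵐᵒᵖ) (Finsupp.single p b : PreTens φ) = tens p.1 p.2 b := rfl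

/-- The relations of a tensor product fail in the algebraic module `PreTens` and hold only after
separation. They are proved by pairing with elementary tensors. -/
theorem ext_inner_tens {x y : TensModule φ}
    (h : ∀ z v b, inner Bᵐᵒᵖ (tens z v b) x = inner Bᵐᵒᵖ (tens z v b) y) : x = y := by
  refine ext_inner_toHilbert (C := Bᵐᵒᵖ) fun f => ?_
  induction f using Finsupp.induction_linear with
  | zero => rw [toHilbert_zero, hilbert_inner_zero_left, hilbert_inner_zero_left]
  | add f g h₁ h₂ =>
    rw [toHilbert_add, hilbert_inner_add_left, hilbert_inner_add_left, h₁, h₂]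
  | single p b => exact h p.1 p.2 b

theorem tens_add (x y : FreeProdModule φ ⊤) (v : List (Letter φ)) (b : B) :
    tens (x + y) v b = tens x v b + tens y v b := by
  refine ext_inner_tens fun z w c => ?_
  rw [hilbert_inner_add_right, inner_tens, inner_tens, inner_tens,
    hilbert_inner_add_right, unop_add, map_add, mul_add, add_mul, op_add]

theorem tens_smul (z : ℂ) (x : FreeProdModule φ ⊤) (v : List (Letter φ)) (b : B) :
    tens (z • x) v b = z • tens x v b := by
  refine ext_inner_tens fun y w c => ?_
  rw [hilbert_inner_smul_right, inner_tens, inner_tens,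
    hilbert_inner_smul_right, unop_smul, map_smul, mul_smul_comm, smul_mul_assoc,
    op_smul]

theorem op_smul_tens (x : FreeProdModule φ ⊤) (v : List (Letter φ)) (b c : B) :
    op c • tens x v b = tens x v (b * c) := by
  rw [tens, ← toHilbert_op_smul, Finsupp.smul_single]
  rfl

/-- This and `tens_cons` say that the tensor product is balanced over `B`, that is `x b ⊗ v = x ⊗ b
v`. On the empty word, `b` becomes a right coefficient; on a nonempty word it acts on the first
letter. -/
theorem tens_nil (x : FreeProdModule φ ⊤) (b : B) :
    tens (op b • x) [] 1 = op b • tens x [] 1 := by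
  refine ext_inner_tens fun y w c => ?_
  rw [op_smul_tens, inner_tens, inner_tens, hilbert_inner_op_smul_right, unop_mul, unop_op]
  cases w with
  | nil => rw [gram_nil_nil, gram_nil_nil, mul_one, one_mul, mul_assoc]
  | cons y w => simp

theorem letterForm_acto_right (x y : Letter φ) (b c : B) :
    letterForm x (⟨y.1, acto (φ y.1) b y.2⟩ : Letter φ) c = letterForm x y (c * b) := by
  obtain ⟨i, ζ⟩ := x
  obtain ⟨i', η⟩ := y
  by_cases h : i = i'
  · subst h
    rw [letterForm_same, letterForm_same, leftForm_apply, leftForm_apply, lact_mul, acto_coe]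
  · have h1 := letterForm_ne (x := (⟨i, ζ⟩ : Letter φ)) (y := ⟨i', η⟩) h
    have h2 := letterForm_ne (x := (⟨i, ζ⟩ : Letter φ)) (y := ⟨i', acto (φ i') b η⟩) h
    exact (LinearMap.congr_fun h2 c).trans (LinearMap.congr_fun h1 (c * b)).symm

theorem tens_cons (x : FreeProdModule φ ⊤) (b c : B) (y : Letter φ) (v : List (Letter φ)) :
    tens (op b • x) (y :: v) c = tens x (⟨y.1, acto (φ y.1) b y.2⟩ :: v) c := by
  refine ext_inner_tens fun z w d => ?_
  rw [inner_tens, inner_tens, hilbert_inner_op_smul_right, unop_mul, unop_op]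
  cases w with
  | nil => simp
  | cons y' w => rw [gram_cons_cons, gram_cons_cons, letterForm_acto_right]

/-! ### The amplification `S ↦ S ⊗ 1`. -/

theorem tensModule_clm_ext {Y : Type*} [NormedAddCommGroup Y] [NormedSpace ℂ Y]
    {S T : TensModule φ →L[ℂ] Y} (h : ∀ x v b, S (tens x v b) = T (tens x v b)) : S = T := by
  ext y
  refine hilbert_induction (p := fun y => S y = T y) y (isClosed_eq S.continuous T.continuous)
    fun f => ?_
  induction f using Finsupp.induction_linear with
  | zero => rw [toHilbert_zero, map_zero, map_zero]
  | add f g h₁ h₂ => rw [toHilbert_add, map_add, map_add, h₁, h₂]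
  | single p b => exact h p.1 p.2 b

/-- The operator `S ⊗ 1` on the algebraic tensor product. -/
def preAmp (S : Adjointable Bᵐᵒᵖ (FreeProdModule φ ⊤)) : PreTens φ →ₗ[ℂ] PreTens φ :=
  Finsupp.lmapDomain B ℂ fun p => (S.toCLM p.1, p.2)

theorem preAmp_single (S : Adjointable Bᵐᵒᵖ (FreeProdModule φ ⊤))
    (p : FreeProdModule φ ⊤ × List (Letter φ)) (b : B) :
    preAmp S (Finsupp.single p b) = Finsupp.single (S.toCLM p.1, p.2) b :=
  Finsupp.mapDomain_single

theorem form_preAmp (S : Adjointable Bᵐᵒᵖ (FreeProdModule φ ⊤)) (f g : PreTens φ) :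
    form (C := Bᵐᵒᵖ) (preAmp S f) g = form (C := Bᵐᵒᵖ) f (preAmp (star S) g) := by
  refine form_ext_single (S := preAmp S) (T := LinearMap.id) (S' := LinearMap.id)
    (T' := preAmp (star S)) (fun p q b c => ?_) f g
  rw [preAmp_single, preAmp_single, LinearMap.id_apply, LinearMap.id_apply, form_tens_single,
    form_tens_single, S.inner_star]

theorem preAmp_mul (S T : Adjointable Bᵐᵒᵖ (FreeProdModule φ ⊤)) (f : PreTens φ) :
    preAmp (S * T) f = preAmp S (preAmp T f) := by
  induction f using Finsupp.induction_linear with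
  | zero => simp only [map_zero]
  | add f g h₁ h₂ => simp only [map_add, h₁, h₂]
  | single p b => rw [preAmp_single, preAmp_single, preAmp_single]; rfl

theorem preAmp_one (f : PreTens φ) : preAmp 1 f = f := by
  induction f using Finsupp.induction_linear with
  | zero => rw [map_zero]
  | add f g h₁ h₂ => rw [map_add, h₁, h₂]
  | single p b => rw [preAmp_single]; rfl

/-- Linearity in `S` is what `bound_of_rep` needs in order to evaluate the positive element `‖S‖² -
S* S` and so bound `S ⊗ 1` by `‖S‖`. -/
theorem form_preAmp_linear (f g : PreTens φ) :
    ∃ L : Adjointable Bᵐᵒᵖ (FreeProdModule φ ⊤) →ₗ[ℂ] Bᵐᵒᵖ,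
      ∀ S, form (C := Bᵐᵒᵖ) f (preAmp S g) = L S := by
  induction f using Finsupp.induction_linear with
  | zero => exact ⟨0, fun a => form_zero_left _⟩
  | add f₁ f₂ h₁ h₂ =>
    obtain ⟨L₁, h₁⟩ := h₁
    obtain ⟨L₂, h₂⟩ := h₂
    exact ⟨L₁ + L₂, fun a => by rw [form_add_left, h₁, h₂]; rfl⟩
  | single p b =>
    induction g using Finsupp.induction_linear with
    | zero => exact ⟨0, fun a => by rw [map_zero]; exact form_zero_right _⟩
    | add g₁ g₂ h₁ h₂ =>
      obtain ⟨L₁, h₁⟩ := h₁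
      obtain ⟨L₂, h₂⟩ := h₂
      exact ⟨L₁ + L₂, fun a => by rw [map_add, form_add_right, h₁, h₂]; rfl⟩
    | single q c =>
      let L₀ : Adjointable Bᵐᵒᵖ (FreeProdModule φ ⊤) →ₗ[ℂ] B :=
        { toFun := fun S => (inner Bᵐᵒᵖ p.1 (S.toCLM q.1)).unop
          map_add' := fun S T => by
            rw [Adjointable.toCLM_add, add_apply, hilbert_inner_add_right, unop_add]
          map_smul' := fun z S => by
            rw [Adjointable.toCLM_smul, smul_apply, hilbert_inner_smul_right,
              unop_smul]
            rfl }
      refine ⟨(opLinearEquiv ℂ).toLinearMap ∘ₗ LinearMap.mulRight ℂ c ∘ₗ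
        LinearMap.mulLeft ℂ (star b) ∘ₗ gram p.2 q.2 ∘ₗ L₀, fun a => ?_⟩
      rw [preAmp_single, form_tens_single]
      rfl

theorem preAmp_bound (S : Adjointable Bᵐᵒᵖ (FreeProdModule φ ⊤)) (f : PreTens φ) :
    ‖form (C := Bᵐᵒᵖ) (preAmp S f) (preAmp S f)‖ ≤ ‖S‖ ^ 2 * ‖form (C := Bᵐᵒᵖ) f f‖ :=
  bound_of_rep (V := PreTens φ) preAmp (fun S f g => by rw [form_preAmp, preAmp_mul])
    (fun f g => by rw [preAmp_one]) form_preAmp_linear S f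

/-- The operator `S ⊗ 1`. -/
def ampOp (S : Adjointable Bᵐᵒᵖ (FreeProdModule φ ⊤)) : Adjointable Bᵐᵒᵖ (TensModule φ) :=
  Adjointable.mk' (extend (preAmp S) ‖S‖ (preAmp_bound S))
    (extend (preAmp (star S)) ‖star S‖ (preAmp_bound (star S)))
    fun x y => inner_extend (form_preAmp S) x y

theorem ampOp_tens (S : Adjointable Bᵐᵒᵖ (FreeProdModule φ ⊤)) (x : FreeProdModule φ ⊤)
    (v : List (Letter φ)) (b : B) : (ampOp S).toCLM (tens x v b) = tens (S.toCLM x) v b := by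
  refine (extend_toHilbert (preAmp S) ‖S‖ (preAmp_bound S) _).trans ?_
  rw [preAmp_single]
  rfl

theorem star_ampOp (S : Adjointable Bᵐᵒᵖ (FreeProdModule φ ⊤)) :
    star (ampOp S) = ampOp (star S) := by
  have h (x y : TensModule φ) : inner Bᵐᵒᵖ ((ampOp S).toCLM x) y
      = inner Bᵐᵒᵖ x ((ampOp (star S)).toCLM y) := by
    have e (S : Adjointable Bᵐᵒᵖ (FreeProdModule φ ⊤)) :
        (ampOp S).toCLM = extend (preAmp S) ‖S‖ (preAmp_bound S) := rfl
    rw [e, e]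
    exact inner_extend (form_preAmp S) x y
  exact Adjointable.star_eq_of _ _ h

variable (φ) in
/-- The representation `S ↦ S ⊗ 1` of `𝓛(E)`. -/
def amp : Adjointable Bᵐᵒᵖ (FreeProdModule φ ⊤) →⋆ₙₐ[ℂ] Adjointable Bᵐᵒᵖ (TensModule φ) where
  toFun := ampOp
  map_smul' z S := Adjointable.toCLM_injective <| tensModule_clm_ext fun x v b => by
    rw [ampOp_tens, Adjointable.toCLM_smul, Adjointable.toCLM_smul, smul_apply, smul_apply,
      ampOp_tens, tens_smul]
    rfl
  map_zero' := Adjointable.toCLM_injective <| tensModule_clm_ext fun x v b => by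
    rw [ampOp_tens]
    have h : tens (0 : FreeProdModule φ ⊤) v b = 0 := by
      simpa using tens_smul 0 (0 : FreeProdModule φ ⊤) v b
    exact h
  map_add' S T := Adjointable.toCLM_injective <| tensModule_clm_ext fun x v b => by
    rw [ampOp_tens, Adjointable.toCLM_add, Adjointable.toCLM_add, add_apply, add_apply,
      ampOp_tens, ampOp_tens, tens_add]
  map_mul' S T := Adjointable.toCLM_injective <| tensModule_clm_ext fun x v b => by
    rw [ampOp_tens, Adjointable.toCLM_mul, Adjointable.toCLM_mul, mul_apply_eq_comp,
      mul_apply_eq_comp, ampOp_tens, ampOp_tens]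
  map_star' S := (star_ampOp S).symm

theorem amp_tens (S : Adjointable Bᵐᵒᵖ (FreeProdModule φ ⊤)) (x : FreeProdModule φ ⊤)
    (v : List (Letter φ)) (b : B) : (amp φ S).toCLM (tens x v b) = tens (S.toCLM x) v b :=
  ampOp_tens S x v b

/-! #### Continuity of the tensor product -/

/-- `B` acts on `L²(A_i, φ_i)` through the contraction `j i`, so Cauchy–Schwarz gives the bound `‖x‖
‖y‖ ‖c‖`. By iteration `gram` is continuous, and hence so is `x ↦ x ⊗ v`. -/
theorem continuous_leftForm {i : I} (x y : L2 (φ i)) : Continuous (leftForm (φ i) x y) := by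
  refine AddMonoidHomClass.continuous_of_bound _ (‖x‖ * ‖y‖) fun c => ?_
  have h1 : ‖lact (φ i) c y‖ ≤ ‖c‖ * ‖y‖ := by
    have h2 : ‖lact (φ i) c y‖ ≤ ‖j i c‖ * ‖y‖ := by
      refine hilbert_induction (p := fun y => ‖lact (φ i) c y‖ ≤ ‖j i c‖ * ‖y‖) y
        (isClosed_le (lact (φ i) c).continuous.norm (continuous_const.mul continuous_norm))
        fun a => ?_
      refine abs_le_of_sq_le_sq' ?_ (by positivity) |>.2
      rw [lact, piRep, extend_toHilbert, mul_pow, norm_toHilbert_sq, norm_toHilbert_sq]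
      exact preLeft_bound (φ i) (j i c) a
    refine h2.trans ?_
    gcongr
    exact NonUnitalStarAlgHom.norm_apply_le (j i) c
  calc ‖leftForm (φ i) x y c‖ = ‖inner Bᵐᵒᵖ x (lact (φ i) c y)‖ := rfl
    _ ≤ ‖x‖ * ‖lact (φ i) c y‖ := norm_hilbert_inner_le _ _
    _ ≤ ‖x‖ * (‖c‖ * ‖y‖) := by gcongr
    _ = _ := by ring

theorem continuous_gram (u v : List (Letter φ)) : Continuous (gram u v) := by
  induction u generalizing v with
  | nil =>
    cases v with
    | nil => exact continuous_id
    | cons y v => exact continuous_const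
  | cons x u ih =>
    cases v with
    | nil => exact continuous_const
    | cons y v => exact (ih v).comp (continuous_leftForm _ _)

/-- The norm of `x ⊗ v b` is a continuous function of `⟨x, x⟩` that vanishes at `x = 0`; for a
linear map, continuity at `0` suffices. -/
theorem continuous_tens (v : List (Letter φ)) (b : B) :
    Continuous fun x : FreeProdModule φ ⊤ => tens x v b := by
  let T : FreeProdModule φ ⊤ →ₗ[ℂ] TensModule φ :=
    { toFun := fun x => tens x v b
      map_add' := fun x y => tens_add x y v b
      map_smul' := fun z x => tens_smul z x v b }
  have h0 : ContinuousAt T 0 := by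
    rw [ContinuousAt, map_zero, tendsto_zero_iff_norm_tendsto_zero]
    have h1 (x : FreeProdModule φ ⊤) : ‖T x‖
        = √‖star b * gram v v (inner Bᵐᵒᵖ x x).unop * b‖ := by
      rw [CStarModule.norm_eq_sqrt_norm_inner_self (A := Bᵐᵒᵖ)]
      exact congrArg (fun z => √‖z‖) (inner_tens x x v v b b)
    simp only [h1]
    have h2 : Continuous fun x : FreeProdModule φ ⊤ =>
        √‖star b * gram v v (inner Bᵐᵒᵖ x x).unop * b‖ :=
      Real.continuous_sqrt.comp (((continuous_const.mul ((continuous_gram v v).comp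
        (continuous_unop.comp (cont_inner continuous_id continuous_id)))).mul
          continuous_const).norm)
    have h3 := h2.tendsto 0
    rw [hilbert_inner_zero_left, unop_zero, map_zero, mul_zero, zero_mul, norm_zero,
      Real.sqrt_zero] at h3
    exact h3
  exact continuous_of_continuousAt_zero T h0

end Tensor

/-! ### Finite sums in the form, and norms of extended maps. -/

section FormSum

variable {C : Type*} [CStarAlgebra C] [PartialOrder C]
  {V : Type*} [AddCommGroup V] [Module ℂ V] [Module C V] [PreCStarModule C V]

theorem form_sum_right {n : Type*} (s : Finset n) (x : V) (y : n → V) :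
    form (C := C) x (∑ i ∈ s, y i) = ∑ i ∈ s, form (C := C) x (y i) := by
  classical
  induction s using Finset.induction_on with
  | empty => simp [form_zero_right]
  | insert a s ha ih => rw [Finset.sum_insert ha, Finset.sum_insert ha, form_add_right, ih]

theorem form_sum_left {n : Type*} (s : Finset n) (x : n → V) (y : V) :
    form (C := C) (∑ i ∈ s, x i) y = ∑ i ∈ s, form (C := C) (x i) y := by
  rw [← star_form, form_sum_right, star_sum]
  exact Finset.sum_congr rfl fun i _ => star_form _ _

theorem form_real_smul_left (r : ℝ) (x y : V) :
    form (C := C) ((r : ℂ) • x) y = (r : ℂ) • form (C := C) x y := by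
  rw [form_complex_smul_left, Complex.star_def, Complex.conj_ofReal]

theorem norm_extend_le [StarOrderedRing C]
    {W : Type*} [AddCommGroup W] [Module ℂ W] [Module C W] [PreCStarModule C W]
    {T : V →ₗ[ℂ] W} {c : ℝ} (hc : 0 ≤ c)
    (hT : ∀ x, ‖form (C := C) (T x) (T x)‖ ≤ c ^ 2 * ‖form (C := C) x x‖) :
    ‖extend T c hT‖ ≤ c := by
  refine ContinuousLinearMap.opNorm_le_bound _ hc fun x => ?_
  refine hilbert_induction (p := fun x => ‖extend T c hT x‖ ≤ c * ‖x‖) x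
    (isClosed_le (extend T c hT).continuous.norm (continuous_const.mul continuous_norm))
    fun x => ?_
  refine abs_le_of_sq_le_sq' ?_ (by positivity) |>.2
  rw [extend_toHilbert, mul_pow, norm_toHilbert_sq, norm_toHilbert_sq]
  exact hT x

end FormSum

section Cut

variable {B : Type*} [CStarAlgebra B] [PartialOrder B] [StarOrderedRing B]
  {I : Type*} {A : I → Type*} [∀ i, CStarAlgebra (A i)]
  {j : ∀ i, B →⋆ₐ[ℂ] A i} {φ : ∀ i, CondExp (j i)}

/-! ### Words and their types -/

/-- The type `(i₁, …, iₙ)` of a word. -/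
def wordType (u : List (Letter φ)) : List I := u.map Sigma.fst

theorem length_wordType (u : List (Letter φ)) : (wordType u).length = u.length :=
  List.length_map _

theorem isReduced_iff_wordType (u : List (Letter φ)) :
    IsReduced u ↔ (wordType u).IsChain fun i i' => i ≠ i' :=
  (List.isChain_map Sigma.fst).symm

/-- Words in different direct summands of `E` are orthogonal. This is why scalars depending on the
type of a word can be moved freely across the inner product. -/
theorem gram_wordType_ne {u v : List (Letter φ)} (h : wordType u ≠ wordType v) (c : B) :
    gram u v c = 0 := by
  induction u generalizing v c with
  | nil =>
    cases v with
    | nil => exact absurd rfl h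
    | cons y v => rfl
  | cons x u ih =>
    cases v with
    | nil => rfl
    | cons y v =>
      rw [gram_cons_cons]
      by_cases hxy : x.1 = y.1
      · refine ih (fun h' => h ?_) _
        exact congrArg₂ List.cons hxy h'
      · rw [letterForm_ne hxy, LinearMap.zero_apply, map_zero]

/-- Associativity of the internal tensor product: `⟨u v, u' v'⟩ = ⟨v, ⟨u, u'⟩ v'⟩`. Read from right
to left, it says that cutting two words at the same position preserves their inner product. -/
theorem gram_append {u u' : List (Letter φ)} (h : u.length = u'.length) (v v' : List (Letter φ))
    (c : B) : gram (u ++ v) (u' ++ v') c = gram v v' (gram u u' c) := by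
  induction u generalizing u' c with
  | nil =>
    cases u' with
    | nil => rfl
    | cons y u' => simp at h
  | cons x u ih =>
    cases u' with
    | nil => simp at h
    | cons y u' => exact ih (by simpa using h) _

theorem IsReduced.take {u : List (Letter φ)} (hu : IsReduced u) (p : ℕ) : IsReduced (u.take p) :=
  List.IsChain.take hu p

theorem IsReduced.drop {u : List (Letter φ)} (hu : IsReduced u) (p : ℕ) : IsReduced (u.drop p) :=
  List.IsChain.drop hu p

/-- A reduced word as a vector of `E`. -/
def vec (u : List (Letter φ)) : FreeProdModule φ ⊤ := toHilbert (C := Bᵐᵒᵖ) (wordVec u 1)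

theorem inner_vec {u v : List (Letter φ)} (hu : IsReduced u) (hv : IsReduced v) :
    inner Bᵐᵒᵖ (vec u) (vec v) = op (gram u v 1) := by
  rw [vec, vec, inner_toHilbert, form_wordVec hu hv, star_one, one_mul, mul_one]

theorem toHilbert_single_word (u : Word φ ⊤) (b : B) :
    toHilbert (C := Bᵐᵒᵖ) (Finsupp.single u b : PreFree φ ⊤) = op b • vec u.1 := by
  rw [single_eq, toHilbert_op_smul, vec]

theorem free_induction {p : FreeProdModule φ ⊤ → Prop} (x : FreeProdModule φ ⊤)
    (hp : IsClosed {x | p x}) (hadd : ∀ x y, p x → p y → p (x + y))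
    (h : ∀ (u : List (Letter φ)) (b : B), IsReduced u → p (op b • vec u)) : p x := by
  refine hilbert_induction x hp fun f => ?_
  induction f using Finsupp.induction_linear with
  | zero =>
    rw [toHilbert_zero]
    -- The zero vector is the empty word with coefficient `0`.
    simpa using h ([] : List (Letter φ)) 0 List.isChain_nil
  | add f g h₁ h₂ => rw [toHilbert_add]; exact hadd _ _ h₁ h₂
  | single u b => rw [toHilbert_single_word]; exact h u.1 b u.2

/-! ### Multipliers -/

/-- Multiplication of a word by a scalar that depends on its type. -/
def mulPre (r : List I → ℝ) : PreFree φ ⊤ →ₗ[ℂ] PreFree φ ⊤ :=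
  Finsupp.lsum ℂ fun u : Word φ ⊤ => ((r (wordType u.1) : ℝ) : ℂ) • Finsupp.lsingle u

theorem mulPre_single (r : List I → ℝ) (u : Word φ ⊤) (b : B) :
    mulPre (φ := φ) r (Finsupp.single u b)
      = ((r (wordType u.1) : ℝ) : ℂ) • Finsupp.single u b :=
  Finsupp.lsum_single _ _ _ _

theorem form_mulPre_mulPre (r s : List I → ℝ) (f g : PreFree φ ⊤) :
    form (C := Bᵐᵒᵖ) (mulPre r f) (mulPre s g) = form f (mulPre (fun t => r t * s t) g) := by
  refine form_ext_single (S := mulPre (φ := φ) r) (T := mulPre (φ := φ) s) (S' := LinearMap.id)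
    (T' := mulPre (φ := φ) fun t => r t * s t) (fun u v b c => ?_) f g
  rw [mulPre_single, mulPre_single, mulPre_single, LinearMap.id_apply, form_real_smul_left,
    form_complex_smul_right, form_complex_smul_right, smul_smul, form_single]
  by_cases h : wordType u.1 = wordType v.1
  · rw [h, Complex.ofReal_mul]
  · rw [gram_wordType_ne h, mul_zero, zero_mul, op_zero, smul_zero, smul_zero]

theorem mulPre_add (r s : List I → ℝ) (f : PreFree φ ⊤) :
    mulPre (fun t => r t + s t) f = mulPre r f + mulPre s f := by
  induction f using Finsupp.induction_linear with
  | zero => simp only [map_zero, add_zero]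
  | add f g h₁ h₂ => simp only [map_add, h₁, h₂]; abel
  | single u b =>
    rw [mulPre_single, mulPre_single, mulPre_single, Complex.ofReal_add, add_smul]

theorem mulPre_const (r : ℝ) (f : PreFree φ ⊤) : mulPre (fun _ => r) f = (r : ℂ) • f := by
  induction f using Finsupp.induction_linear with
  | zero => simp only [map_zero, smul_zero]
  | add f g h₁ h₂ => simp only [map_add, h₁, h₂, smul_add]
  | single u b => rw [mulPre_single]

/-- The difference `r² ⟨f, f⟩ - ⟨f, s f⟩` is the inner square of `√(r² - s) f`, where `√(r² - s)` is
again a multiplier depending on types. The order inequality passes to norms because `⟨f, s f⟩` is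
positive. -/
theorem norm_form_mulPre_le {s : List I → ℝ} {r : ℝ} (hs : ∀ t, s t ≤ r ^ 2)
    (f : PreFree φ ⊤) (h0 : 0 ≤ form (C := Bᵐᵒᵖ) f (mulPre s f)) :
    ‖form (C := Bᵐᵒᵖ) f (mulPre s f)‖ ≤ r ^ 2 * ‖form (C := Bᵐᵒᵖ) f f‖ := by
  have h1 : form (C := Bᵐᵒᵖ) f (mulPre s f) ≤ ((r ^ 2 : ℝ) : ℂ) • form (C := Bᵐᵒᵖ) f f := by
    have h2 : (0 : Bᵐᵒᵖ) ≤ form (C := Bᵐᵒᵖ) (mulPre (fun t => √(r ^ 2 - s t)) f)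
        (mulPre (fun t => √(r ^ 2 - s t)) f) := form_self_nonneg _
    have h3 : form (C := Bᵐᵒᵖ) f (mulPre s f)
        + form (C := Bᵐᵒᵖ) (mulPre (fun t => √(r ^ 2 - s t)) f)
          (mulPre (fun t => √(r ^ 2 - s t)) f) = ((r ^ 2 : ℝ) : ℂ) • form (C := Bᵐᵒᵖ) f f := by
      have h4 : (fun t => s t + √(r ^ 2 - s t) * √(r ^ 2 - s t)) = fun _ => r ^ 2 := by
        ext t
        rw [Real.mul_self_sqrt (sub_nonneg.mpr (hs t)), add_sub_cancel]
      rw [form_mulPre_mulPre, ← form_add_right, ← mulPre_add, ← form_complex_smul_right,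
        ← mulPre_const, h4]
    rw [← h3]
    exact le_add_of_nonneg_right h2
  refine (CStarAlgebra.norm_le_norm_of_nonneg_of_le h0 h1).trans ?_
  rw [norm_smul, Complex.norm_real, Real.norm_of_nonneg (by positivity)]

/-! ### Cutting words -/

/-- `∑ₚ c(u, p) u₁ ⊗ u₂`, where `u = u₁ u₂` with `u₁` of length `p`; the weights depend on the type
of `u` only. -/
def cutWord (c : List I → ℕ → ℝ) (u : List (Letter φ)) : PreTens φ :=
  ∑ p ∈ Finset.range (u.length + 1),
    ((c (wordType u) p : ℝ) : ℂ) • Finsupp.single (vec (u.take p), u.drop p) 1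

/-- The linear extension of `cutWord`. -/
def cutPre (c : List I → ℕ → ℝ) : PreFree φ ⊤ →ₗ[ℂ] PreTens φ :=
  Finsupp.lsum ℂ fun u : Word φ ⊤ =>
    { toFun := fun b => op b • cutWord c u.1
      map_add' := fun b c => by rw [op_add, add_smul]
      map_smul' := fun z b => by
        ext v
        simp }

theorem cutPre_single (c : List I → ℕ → ℝ) (u : Word φ ⊤) (b : B) :
    cutPre c (Finsupp.single u b) = op b • cutWord c u.1 :=
  Finsupp.lsum_single _ _ _ _

/-- The inner product of two systems of weights. -/
def weightForm (c d : List I → ℕ → ℝ) (t : List I) : ℝ :=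
  ∑ p ∈ Finset.range (t.length + 1), c t p * d t p

/-- Only the cut of `w` after `u.length` letters contributes, since all others have a first leg of
the wrong length. The right side identifies the adjoint of cutting on `u ⊗ v` as a weighted
concatenation. -/
theorem form_cutWord_single (c : List I → ℕ → ℝ) {w u : List (Letter φ)} (hw : IsReduced w)
    (hu : IsReduced u) (v : List (Letter φ)) :
    form (C := Bᵐᵒᵖ) (cutWord c w) (Finsupp.single (vec u, v) 1)
      = ((c (wordType w) u.length : ℝ) : ℂ) • op (gram w (u ++ v) 1) := by
  have h (p : ℕ) : form (C := Bᵐᵒᵖ) (((c (wordType w) p : ℝ) : ℂ) •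
      (Finsupp.single (vec (w.take p), w.drop p) 1 : PreTens φ)) (Finsupp.single (vec u, v) 1)
      = ((c (wordType w) p : ℝ) : ℂ) • op (gram (w.drop p) v (gram (w.take p) u 1)) := by
    rw [form_real_smul_left, form_tens_single, inner_vec (hw.take p) hu, star_one, one_mul,
      mul_one]
    rfl
  rw [cutWord, form_sum_left, Finset.sum_eq_single u.length]
  · rw [h]
    -- If `u` is longer than `w`, no cut of `w` matches, and the right side vanishes as well because
    -- `w` is shorter than `u ++ v`.
    by_cases hl : u.length ≤ w.length
    · rw [← gram_append (by simpa using hl), List.take_append_drop]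
    · rw [gram_length_ne (v := u) (by rw [List.length_take]; omega), map_zero,
        gram_length_ne (u := w) (by rw [List.length_append]; omega)]
  · intro p hp hne
    rw [Finset.mem_range] at hp
    rw [h, gram_length_ne (v := u) (by rw [List.length_take]; omega), map_zero, op_zero, smul_zero]
  · intro hp
    rw [Finset.mem_range] at hp
    rw [h, gram_length_ne (v := u) (by rw [List.length_take]; omega), map_zero, op_zero, smul_zero]

theorem form_cutWord (c d : List I → ℕ → ℝ) {u v : List (Letter φ)} (hu : IsReduced u)
    (hv : IsReduced v) :
    form (C := Bᵐᵒᵖ) (cutWord c u) (cutWord d v)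
      = ((weightForm c d (wordType v) : ℝ) : ℂ) • op (gram u v 1) := by
  have e : cutWord d v = ∑ p ∈ Finset.range (v.length + 1),
    ((d (wordType v) p : ℝ) : ℂ) • (Finsupp.single (vec (v.take p), v.drop p) 1 : PreTens φ) := rfl
  rw [e, form_sum_right, weightForm, length_wordType, Complex.ofReal_sum,
    Finset.sum_smul]
  refine Finset.sum_congr rfl fun p hp => ?_
  rw [Finset.mem_range] at hp
  rw [form_complex_smul_right, form_cutWord_single c hu (hv.take p), List.take_append_drop,
    List.length_take, min_eq_left (by omega), smul_smul, Complex.ofReal_mul, mul_comm]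
  by_cases h : wordType u = wordType v
  · rw [h]
  · rw [gram_wordType_ne h, op_zero, smul_zero, smul_zero]

/-- Every matching pair of cuts contributes the same inner product, so the Gram operator of two
cutting maps is a scalar multiplier. Norm bounds and isometry thus become statements about the
weights alone. -/
theorem form_cutPre (c d : List I → ℕ → ℝ) (f g : PreFree φ ⊤) :
    form (C := Bᵐᵒᵖ) (cutPre c f) (cutPre d g)
      = form f (mulPre (weightForm c d) g) := by
  refine form_ext_single (S := cutPre (φ := φ) c) (T := cutPre (φ := φ) d)
    (S' := LinearMap.id) (T' := mulPre (φ := φ) (weightForm c d)) (fun u v b b' => ?_) f g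
  rw [cutPre_single, cutPre_single, mulPre_single, LinearMap.id_apply, form_smul_left,
    form_smul_right, form_cutWord c d u.2 v.2, form_complex_smul_right, form_single,
    mul_smul_comm, smul_mul_assoc, op_mul, op_mul, op_star]
  simp only [mul_assoc]

theorem cutPre_bound {c : List I → ℕ → ℝ} {r : ℝ} (hc : ∀ t, weightForm c c t ≤ r ^ 2)
    (f : PreFree φ ⊤) :
    ‖form (C := Bᵐᵒᵖ) (cutPre c f) (cutPre c f)‖ ≤ r ^ 2 * ‖form (C := Bᵐᵒᵖ) f f‖ := by
  rw [form_cutPre]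
  refine norm_form_mulPre_le hc f ?_
  rw [← form_cutPre]
  exact form_self_nonneg _

variable (φ) in
/-- The operator `E → E ⊗ E` that cuts words. -/
def cut (c : List I → ℕ → ℝ) {r : ℝ} (hc : ∀ t, weightForm c c t ≤ r ^ 2) :
    FreeProdModule φ ⊤ →L[ℂ] TensModule φ :=
  extend (cutPre c) r (cutPre_bound hc)

theorem cut_toHilbert {c : List I → ℕ → ℝ} {r : ℝ} (hc : ∀ t, weightForm c c t ≤ r ^ 2)
    (f : PreFree φ ⊤) : cut φ c hc (toHilbert f) = toHilbert (C := Bᵐᵒᵖ) (cutPre c f) := by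
  unfold cut
  rw [extend_toHilbert]

theorem norm_cut_le {c : List I → ℕ → ℝ} {r : ℝ} (hr : 0 ≤ r)
    (hc : ∀ t, weightForm c c t ≤ r ^ 2) : ‖cut φ c hc‖ ≤ r :=
  norm_extend_le hr (cutPre_bound hc)

theorem cut_op_smul_vec {c : List I → ℕ → ℝ} {r : ℝ} (hc : ∀ t, weightForm c c t ≤ r ^ 2)
    {u : List (Letter φ)} (hu : IsReduced u) (b : B) :
    cut φ c hc (op b • vec u) = op b • ∑ p ∈ Finset.range (u.length + 1),
      ((c (wordType u) p : ℝ) : ℂ) • tens (vec (u.take p)) (u.drop p) 1 := by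
  rw [← toHilbert_single_word ⟨u, hu, le_top⟩ b, cut_toHilbert, cutPre_single, toHilbert_op_smul, cutWord, toHilbert_sum]
  congr 1
  refine Finset.sum_congr rfl fun p _ => ?_
  rw [toHilbert_smul]
  rfl

theorem cut_vec {c : List I → ℕ → ℝ} {r : ℝ} (hc : ∀ t, weightForm c c t ≤ r ^ 2)
    {u : List (Letter φ)} (hu : IsReduced u) :
    cut φ c hc (vec u) = ∑ p ∈ Finset.range (u.length + 1),
      ((c (wordType u) p : ℝ) : ℂ) • tens (vec (u.take p)) (u.drop p) 1 := by
  have h := cut_op_smul_vec hc hu 1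
  rwa [op_one, one_smul, one_smul] at h

/-- The cutting operator is isometric if the weights are normalized. -/
theorem inner_cut_cut {c : List I → ℕ → ℝ} {r : ℝ} (hc : ∀ t, weightForm c c t ≤ r ^ 2)
    (hc1 : ∀ t, weightForm c c t = 1) (x y : FreeProdModule φ ⊤) :
    inner Bᵐᵒᵖ (cut φ c hc x) (cut φ c hc y) = inner Bᵐᵒᵖ x y := by
  refine hilbert_induction (p := fun x => inner Bᵐᵒᵖ (cut φ c hc x) (cut φ c hc y)
    = inner Bᵐᵒᵖ x y) x (isClosed_eq (cont_inner (cut φ c hc).continuous continuous_const)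
      (cont_inner continuous_id continuous_const)) fun f => ?_
  refine hilbert_induction (p := fun y => inner Bᵐᵒᵖ (cut φ c hc (toHilbert f)) (cut φ c hc y)
    = inner Bᵐᵒᵖ (toHilbert f) y) y
    (isClosed_eq (cont_inner continuous_const (cut φ c hc).continuous)
      (cont_inner continuous_const continuous_id)) fun g => ?_
  rw [cut_toHilbert, cut_toHilbert, inner_toHilbert, inner_toHilbert, form_cutPre]
  have e2 : weightForm c c = fun _ => 1 := funext hc1
  rw [e2, mulPre_const, Complex.ofReal_one, one_smul]

/-- The adjoint sends `u ⊗ v` to the concatenation `u v`, multiplied by the weight of the cut that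
separates `u` from `v`. -/
theorem tens_vec_mem_adjointDomain {c : List I → ℕ → ℝ} {r : ℝ}
    (hc : ∀ t, weightForm c c t ≤ r ^ 2) {u : List (Letter φ)} (hu : IsReduced u)
    (v : List (Letter φ)) :
    tens (vec u) v 1 ∈ adjointDomain Bᵐᵒᵖ (cut φ c hc) := by
  refine ⟨((c (wordType (u ++ v)) u.length : ℝ) : ℂ) • vec (u ++ v), fun x => ?_⟩
  change inner Bᵐᵒᵖ (cut φ c hc x) (tens (vec u) v 1)
    = inner Bᵐᵒᵖ x (((c (wordType (u ++ v)) u.length : ℝ) : ℂ) • vec (u ++ v))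
  refine free_induction (p := fun x => inner Bᵐᵒᵖ (cut φ c hc x) (tens (vec u) v 1)
    = inner Bᵐᵒᵖ x (((c (wordType (u ++ v)) u.length : ℝ) : ℂ) • vec (u ++ v))) x
    (isClosed_eq (cont_inner (cut φ c hc).continuous continuous_const)
      (cont_inner continuous_id continuous_const)) (fun x y h₁ h₂ => ?_) fun w b hw => ?_
  · rw [map_add, hilbert_inner_add_left, hilbert_inner_add_left, h₁, h₂]
  · have h1 : cut φ c hc (op b • vec w) = op b • toHilbert (C := Bᵐᵒᵖ) (cutWord c w) := by
      rw [← toHilbert_op_smul, ← cutPre_single c ⟨w, hw, le_top⟩,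
        ← toHilbert_single_word ⟨w, hw, le_top⟩ b, cut_toHilbert]
    have h2 : inner Bᵐᵒᵖ (toHilbert (C := Bᵐᵒᵖ) (cutWord c w)) (tens (vec u) v 1)
        = ((c (wordType w) u.length : ℝ) : ℂ) • op (gram w (u ++ v) 1) :=
      (inner_toHilbert (C := Bᵐᵒᵖ) _ _).trans (form_cutWord_single c hw hu v)
    have h3 : inner Bᵐᵒᵖ (vec w) (vec (u ++ v)) = op (gram w (u ++ v) 1) := by
      -- A concatenation that is not reduced gives the vector zero by the convention in `wordVec`.
      -- The right side agrees, because a reduced `w` cannot have the type of a word that is not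
      -- reduced.
      by_cases h : IsReduced (u ++ v)
      · exact inner_vec hw h
      · have h4 : vec (u ++ v) = 0 := by rw [vec, wordVec, dif_neg h, toHilbert_zero]
        rw [h4, hilbert_inner_zero_right, gram_wordType_ne, op_zero]
        intro h5
        rw [isReduced_iff_wordType, ← h5, ← isReduced_iff_wordType] at h
        exact h hw
    rw [h1, hilbert_inner_op_smul_left, hilbert_inner_op_smul_left, h2, hilbert_inner_smul_right,
      h3]
    -- The weights are evaluated at the type of `w` on one side and of `u ++ v` on the other; where
    -- these differ, the inner product vanishes.
    by_cases h : wordType w = wordType (u ++ v)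
    · rw [h]
    · rw [gram_wordType_ne h, op_zero, smul_zero, smul_zero]

theorem op_smul_mem_adjointDomain {V : FreeProdModule φ ⊤ →L[ℂ] TensModule φ} {y : TensModule φ}
    (hy : y ∈ adjointDomain Bᵐᵒᵖ V) (b : Bᵐᵒᵖ) : b • y ∈ adjointDomain Bᵐᵒᵖ V := by
  obtain ⟨z, hz⟩ := hy
  exact ⟨b • z, fun x => by
    rw [CStarModule.inner_op_smul_right (A := Bᵐᵒᵖ), CStarModule.inner_op_smul_right (A := Bᵐᵒᵖ),
      hz]⟩

/-- Since the domain is closed and `x ↦ x ⊗ v` is continuous, only tensors `u b ⊗ v` with `u` a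
reduced word have to be treated. -/
theorem mem_adjointDomain_cut {c : List I → ℕ → ℝ} {r : ℝ}
    (hc : ∀ t, weightForm c c t ≤ r ^ 2) (y : TensModule φ) :
    y ∈ adjointDomain Bᵐᵒᵖ (cut φ c hc) := by
  have hcl := isClosed_adjointDomain (C := Bᵐᵒᵖ) (cut φ c hc)
  refine hilbert_induction y hcl fun f => ?_
  induction f using Finsupp.induction_linear with
  | zero => rw [toHilbert_zero]; exact Submodule.zero_mem _
  | add f g h₁ h₂ => rw [toHilbert_add]; exact Submodule.add_mem _ h₁ h₂
  | single p b =>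
    obtain ⟨x, v⟩ := p
    rw [toHilbert_single]
    have h1 : tens x v b = op b • tens x v 1 := by rw [op_smul_tens, one_mul]
    change tens x v b ∈ _
    rw [h1]
    refine op_smul_mem_adjointDomain ?_ _
    refine free_induction (p := fun x => tens x v 1 ∈ adjointDomain Bᵐᵒᵖ (cut φ c hc)) x
      (hcl.preimage (continuous_tens v 1)) (fun x y h₁ h₂ => ?_) fun u b hu => ?_
    · rw [tens_add]; exact Submodule.add_mem _ h₁ h₂
    -- Balancing moves `b` out of the first leg: to the right of everything if `v` is empty, into
    -- the first letter of `v` otherwise.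
    · cases v with
      | nil =>
        rw [tens_nil]
        exact op_smul_mem_adjointDomain (tens_vec_mem_adjointDomain hc hu _) _
      | cons y v =>
        rw [tens_cons]
        exact tens_vec_mem_adjointDomain hc hu _

theorem exists_adjoint_cut {c : List I → ℕ → ℝ} {r : ℝ} (hc : ∀ t, weightForm c c t ≤ r ^ 2) :
    ∃ W : TensModule φ →L[ℂ] FreeProdModule φ ⊤,
      ∀ x y, inner Bᵐᵒᵖ (cut φ c hc x) y = inner Bᵐᵒᵖ x (W y) :=
  exists_adjoint (C := Bᵐᵒᵖ) (mem_adjointDomain_cut hc)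

end Cut

/-! ### The weights -/

section Weights

/-- The weight of cutting a word of length `n` after `p` letters: the square is `1 / k` for
`1 ≤ p < n` with `p ≤ k`, and what remains of the total mass `1` is placed at `p = n`. -/
def weight (k n p : ℕ) : ℝ :=
  if p = 0 then (if n = 0 then 1 else 0)
  else if p < n then (if p ≤ k then √(1 / k) else 0) else √(1 - (n - 1 : ℝ) / k)

theorem weight_zero_right (k m : ℕ) : weight k (m + 1) 0 = 0 := by simp [weight]

theorem weight_zero_zero (k : ℕ) : weight k 0 0 = 1 := by simp [weight]

theorem weight_succ_succ (k m r : ℕ) : weight k (m + 1) (r + 1)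
    = if r < m then (if r + 1 ≤ k then √(1 / k) else 0) else √(1 - (m : ℝ) / k) := by
  simp [weight]

/-- For `p < n` this is the cutoff. For `p = n > k` the remaining mass `1 - (n - 1) / k` is at most
`0`, and the real square root is `0` there. As a result all first legs lie in `E_(→k)`. -/
theorem weight_eq_zero {k n p : ℕ} (hk : 0 < k) (hpn : p ≤ n) (hp : k < p) : weight k n p = 0 := by
  obtain ⟨r, rfl⟩ : ∃ r, p = r + 1 := ⟨p - 1, by omega⟩
  obtain ⟨m, rfl⟩ : ∃ m, n = m + 1 := ⟨n - 1, by omega⟩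
  rw [weight_succ_succ]
  split_ifs with h1 h2
  · omega
  · rfl
  · refine Real.sqrt_eq_zero_of_nonpos ?_
    have : (1 : ℝ) ≤ m / k := by
      rw [le_div_iff₀ (by exact_mod_cast hk), one_mul]
      exact_mod_cast (by omega : k ≤ m)
    linarith

theorem sum_ite_le (k m : ℕ) (z : ℝ) :
    ∑ r ∈ Finset.range m, (if r + 1 ≤ k then z else 0) = (min m k : ℕ) * z := by
  induction m with
  | zero => simp
  | succ m ih =>
    rw [Finset.sum_range_succ, ih]
    split_ifs with h
    · rw [min_eq_left (by omega), min_eq_left h]; push_cast; ring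
    · rw [min_eq_right (by omega), min_eq_right (by omega), add_zero]

/-- For `n = m + 1` there are `min m k` interior cuts of mass `1 / k` each, and the cut at `p = n`
carries `max 0 (1 - m / k)`, which completes the sum to `1`. -/
theorem sum_weight_sq {k : ℕ} (hk : 0 < k) (n : ℕ) :
    ∑ p ∈ Finset.range (n + 1), weight k n p * weight k n p = 1 := by
  have hk' : (0 : ℝ) < k := by exact_mod_cast hk
  cases n with
  | zero => simp [weight_zero_zero]
  | succ m =>
    rw [Finset.sum_range_succ', weight_zero_right, mul_zero, add_zero, Finset.sum_range_succ]
    have h1 (r : ℕ) (hr : r ∈ Finset.range m) :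
        weight k (m + 1) (r + 1) * weight k (m + 1) (r + 1)
          = if r + 1 ≤ k then 1 / (k : ℝ) else 0 := by
      rw [weight_succ_succ, if_pos (Finset.mem_range.mp hr)]
      split_ifs
      · exact Real.mul_self_sqrt (by positivity)
      · exact mul_zero _
    rw [Finset.sum_congr rfl h1, sum_ite_le, weight_succ_succ, if_neg (lt_irrefl m)]
    rcases le_total m k with h | h
    · have h2 : (m : ℝ) / k ≤ 1 := by
        rw [div_le_one hk']; exact_mod_cast h
      rw [Real.mul_self_sqrt (by linarith), min_eq_left h]
      ring
    · have h2 : 1 ≤ (m : ℝ) / k := by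
        rw [one_le_div hk']; exact_mod_cast h
      rw [Real.sqrt_eq_zero_of_nonpos (by linarith), min_eq_right h, mul_one_div, div_self hk'.ne']
      ring

/-- For nonnegative numbers, one factor `√y - √x` is at most `√y + √x`. Negative arguments are
allowed, as the square root truncates them to `0`; this covers the mass at `p = n` for long words.
-/
theorem sq_sqrt_sub_sqrt_le {x y : ℝ} (h : x ≤ y) : (√x - √y) * (√x - √y) ≤ y - x := by
  have h1 := Real.sqrt_le_sqrt h
  have h2 := Real.sqrt_nonneg x
  rcases le_total 0 y with hy | hy
  · rcases le_total 0 x with hx | hx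
    · nlinarith [Real.mul_self_sqrt hy, Real.mul_self_sqrt hx]
    · rw [Real.sqrt_eq_zero_of_nonpos hx]
      nlinarith [Real.mul_self_sqrt hy]
  · rw [Real.sqrt_eq_zero_of_nonpos hy, Real.sqrt_eq_zero_of_nonpos (h.trans hy)]
    linarith

/-- Shifting length and cut position together by one matters in three places: at `r = 0`, where
interior cuts begin; at `r = k`, where the cutoff acts; and at `r = m`, where the remaining mass
drops by at most `1 / k`. Elsewhere both weights are `√(1 / k)` or both are `0`. -/
theorem weight_sub_sq_le {k : ℕ} (hk : 0 < k) (m r : ℕ) (hr : r ≤ m) :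
    (weight k (m + 1) (r + 1) - weight k m r) * (weight k (m + 1) (r + 1) - weight k m r)
      ≤ ((if r = 0 then 1 / (k : ℝ) else 0) + (if r = k then 1 / (k : ℝ) else 0))
        + if r = m then 1 / (k : ℝ) else 0 := by
  have hk' : (0 : ℝ) < k := by exact_mod_cast hk
  have hpos : (0 : ℝ) ≤ 1 / k := by positivity
  have hsq : √(1 / (k : ℝ)) * √(1 / (k : ℝ)) = 1 / k := Real.mul_self_sqrt hpos
  have hite (P : Prop) [Decidable P] : (0 : ℝ) ≤ if P then 1 / (k : ℝ) else 0 := by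
    split_ifs
    · exact hpos
    · exact le_rfl
  rw [weight_succ_succ]
  rcases Nat.eq_zero_or_pos r with rfl | hr0
  · rcases Nat.eq_zero_or_pos m with rfl | hm
    · rw [weight_zero_zero]
      have := hite (0 = k)
      simp only [lt_irrefl, if_false, Nat.cast_zero, zero_div, sub_zero, Real.sqrt_one, sub_self,
        mul_zero, if_true]
      linarith
    · obtain ⟨m, rfl⟩ : ∃ m', m = m' + 1 := ⟨m - 1, by omega⟩
      rw [weight_zero_right, if_pos hm, if_pos (by omega), sub_zero, hsq, if_pos rfl]
      linarith [hite (0 = k), hite (0 = m + 1)]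
  · obtain ⟨r, rfl⟩ : ∃ r', r = r' + 1 := ⟨r - 1, by omega⟩
    obtain ⟨m, rfl⟩ : ∃ m', m = m' + 1 := ⟨m - 1, by omega⟩
    rw [weight_succ_succ, if_neg (Nat.succ_ne_zero r), zero_add]
    rcases hr.eq_or_lt with h | h
    · have h' : r = m := by omega
      subst h'
      rw [if_neg (lt_irrefl _), if_neg (lt_irrefl _)]
      simp only [if_true]
      refine (sq_sqrt_sub_sqrt_le ?_).trans ?_
      · push_cast
        gcongr
        linarith
      · have e : (1 - (r : ℝ) / k) - (1 - ((r + 1 : ℕ) : ℝ) / k) = 1 / k := by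
          push_cast; ring
        rw [e]
        linarith [hite (r + 1 = k)]
    · have h' : r < m := by omega
      rw [if_pos h, if_pos h']
      by_cases h1 : r + 1 ≤ k
      · by_cases h2 : r + 1 + 1 ≤ k
        · rw [if_pos h1, if_pos h2, sub_self, mul_zero]
          exact add_nonneg (hite _) (hite _)
        · rw [if_pos h1, if_neg h2, if_pos (by omega : r + 1 = k), zero_sub, neg_mul_neg, hsq]
          linarith [hite (r + 1 = m + 1)]
      · rw [if_neg h1, if_neg (by omega), sub_self, mul_zero]
        exact add_nonneg (hite _) (hite _)

variable {I : Type*}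

/-- `weight`, as a function of the type of a word. -/
def lengthWeight (I : Type*) (k : ℕ) (t : List I) (p : ℕ) : ℝ := weight k t.length p

open Classical in
/-- The weights after splitting off the first letter of the words that start with index `i`. -/
def headWeight (i : I) (k : ℕ) (t : List I) (p : ℕ) : ℝ :=
  if t.head? = some i then (if p = 0 then 0 else weight k (t.length - 1) (p - 1))
  else weight k t.length p

theorem weightForm_lengthWeight {k : ℕ} (hk : 0 < k) (t : List I) :
    weightForm (lengthWeight I k) (lengthWeight I k) t = 1 := sum_weight_sq hk t.length

theorem headWeight_cons_zero (i : I) (k : ℕ) (t : List I) : headWeight i k (i :: t) 0 = 0 := by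
  simp [headWeight]

theorem headWeight_cons_succ (i : I) (k : ℕ) (t : List I) (p : ℕ) :
    headWeight i k (i :: t) (p + 1) = weight k t.length p := by
  simp [headWeight]

theorem headWeight_of_ne {i : I} {k : ℕ} {t : List I} (h : t.head? ≠ some i) (p : ℕ) :
    headWeight i k t p = weight k t.length p := if_neg h

theorem weightForm_headWeight {k : ℕ} (hk : 0 < k) (i : I) (t : List I) :
    weightForm (headWeight i k) (headWeight i k) t = 1 := by
  by_cases h : t.head? = some i
  · obtain ⟨t, rfl⟩ : ∃ t', t = i :: t' := by
      cases t with
      | nil => simp at h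
      | cons i' t => exact ⟨t, by simpa using h⟩
    rw [weightForm, Finset.sum_range_succ', headWeight_cons_zero, mul_zero, add_zero,
      List.length_cons]
    simp only [headWeight_cons_succ]
    exact sum_weight_sq hk t.length
  · simp only [weightForm, headWeight_of_ne h]
    exact sum_weight_sq hk t.length

/-- The two systems of weights agree on words that do not begin with `i`. On the others they differ
by the shift of `weight_sub_sq_le`, whose three exceptional positions contribute at most `3 / k` in
all. -/
theorem weightForm_sub_le {k : ℕ} (hk : 0 < k) (i : I) (t : List I) :
    weightForm (lengthWeight I k - headWeight i k) (lengthWeight I k - headWeight i k) t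
      ≤ √(3 / k) ^ 2 := by
  have hk' : (0 : ℝ) < k := by exact_mod_cast hk
  have hpos : (0 : ℝ) ≤ 1 / k := by positivity
  rw [Real.sq_sqrt (by positivity)]
  by_cases h : t.head? = some i
  · obtain ⟨t, rfl⟩ : ∃ t', t = i :: t' := by
      cases t with
      | nil => simp at h
      | cons i' t => exact ⟨t, by simpa using h⟩
    have h0 : lengthWeight I k (i :: t) 0 = 0 := weight_zero_right k t.length
    have h1 (r : ℕ) : lengthWeight I k (i :: t) (r + 1) = weight k (t.length + 1) (r + 1) := rfl
    rw [weightForm, Finset.sum_range_succ']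
    simp only [Pi.sub_apply, h0, h1, headWeight_cons_zero, headWeight_cons_succ, sub_zero,
      mul_zero, add_zero, List.length_cons]
    refine (Finset.sum_le_sum fun r hr => weight_sub_sq_le hk t.length r
      (by rw [Finset.mem_range] at hr; omega)).trans ?_
    rw [Finset.sum_add_distrib, Finset.sum_add_distrib, Finset.sum_ite_eq', Finset.sum_ite_eq',
      Finset.sum_ite_eq']
    have hite (P : Prop) [Decidable P] : (if P then 1 / (k : ℝ) else 0) ≤ 1 / k := by
      split_ifs
      · exact le_rfl
      · exact hpos
    calc _ ≤ 1 / (k : ℝ) + 1 / k + 1 / k := add_le_add (add_le_add (hite _) (hite _)) (hite _)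
      _ = _ := by ring
  · have h1 (p : ℕ) : (lengthWeight I k - headWeight i k) t p = 0 := by
      rw [Pi.sub_apply, Pi.sub_apply, headWeight_of_ne h, lengthWeight, sub_self]
    simp only [weightForm, h1, mul_zero, Finset.sum_const_zero]
    positivity

end Weights

/-! ### Cutting words and the action of `A_i` -/

section Commute

variable {B : Type*} [CStarAlgebra B] [PartialOrder B] [StarOrderedRing B]
  {I : Type*} {A : I → Type*} [∀ i, CStarAlgebra (A i)]
  {j : ∀ i, B →⋆ₐ[ℂ] A i} {φ : ∀ i, CondExp (j i)}

theorem free_clm_ext {Y : Type*} [NormedAddCommGroup Y] [NormedSpace ℂ Y]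
    {S T : FreeProdModule φ ⊤ →L[ℂ] Y}
    (h : ∀ (u : List (Letter φ)) (b : B), IsReduced u → S (op b • vec u) = T (op b • vec u)) :
    S = T := by
  ext x
  refine free_induction (p := fun x => S x = T x) x (isClosed_eq S.continuous T.continuous)
    (fun x y h₁ h₂ => ?_) h
  rw [map_add, map_add, h₁, h₂]

theorem cut_sub {c d : List I → ℕ → ℝ} {r s r' : ℝ} (hc : ∀ t, weightForm c c t ≤ r ^ 2)
    (hd : ∀ t, weightForm d d t ≤ s ^ 2) (hcd : ∀ t, weightForm (c - d) (c - d) t ≤ r' ^ 2) :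
    cut φ c hc - cut φ d hd = cut φ (c - d) hcd := by
  refine free_clm_ext fun u b hu => ?_
  rw [sub_apply, cut_op_smul_vec hc hu, cut_op_smul_vec hd hu,
    cut_op_smul_vec hcd hu, ← smul_sub, ← Finset.sum_sub_distrib]
  simp only [Pi.sub_apply, Complex.ofReal_sub, sub_smul]

theorem cut_op_smul {c : List I → ℕ → ℝ} {r : ℝ} (hc : ∀ t, weightForm c c t ≤ r ^ 2) (b : Bᵐᵒᵖ)
    (x : FreeProdModule φ ⊤) : cut φ c hc (b • x) = b • cut φ c hc x := by
  obtain ⟨W, hW⟩ := exists_adjoint_cut (φ := φ) hc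
  exact map_smul_of_adjoint (C := Bᵐᵒᵖ) hW b x

/-- The vector `V_i (ζ ⊗ u)`. -/
def glueVec (i : I) (ζ : L2 (φ i)) (u : List (Letter φ)) : FreeProdModule φ ⊤ :=
  toHilbert (C := Bᵐᵒᵖ) (glue i ζ u)

theorem lam_toHilbert (i : I) (a : A i) (f : PreFree φ ⊤) :
    (lam φ i a).toCLM (toHilbert f) = toHilbert (C := Bᵐᵒᵖ) (lamPre φ i a f) := by
  unfold lam
  rw [Adjointable.toCLM_mk', extend_toHilbert]

theorem lam_vec (i : I) (a : A i) {u : List (Letter φ)} (hu : IsReduced u) :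
    (lam φ i a).toCLM (vec u)
      = glueVec i (piRep (φ i) a (splitHead i u).1) (splitHead i u).2 := by
  rw [vec, lam_toHilbert, wordVec_of_reduced hu, lamPre_single, op_one, one_smul]
  rfl

/-- On the span of words `lamPre φ i 1` is not the identity: it adds words beginning with the zero
letter. These have norm zero, so the equality holds after separation. -/
theorem lam_one (i : I) : lam φ i 1 = 1 := by
  refine Adjointable.toCLM_injective (free_clm_ext fun u b hu => ?_)
  rw [← toHilbert_single_word ⟨u, hu, le_top⟩ b, lam_toHilbert]
  refine ext_inner_toHilbert (C := Bᵐᵒᵖ) fun f => ?_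
  rw [inner_toHilbert, form_lamPre_one]
  exact (inner_toHilbert (C := Bᵐᵒᵖ) _ _).symm

theorem star_lam (i : I) (a : A i) : star (lam φ i a) = lam φ i (star a) := by
  have h (x y : FreeProdModule φ ⊤) : inner Bᵐᵒᵖ ((lam φ i a).toCLM x) y
      = inner Bᵐᵒᵖ x ((lam φ i (star a)).toCLM y) := by
    unfold lam
    rw [Adjointable.toCLM_mk', Adjointable.toCLM_mk']
    exact inner_extend (form_lamPre i a) x y
  exact Adjointable.star_eq_of _ _ h

/-- This is `V_i V_i* = 1` on words, read off from `λ_i(1) = 1`. -/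
theorem vec_eq_glueVec (i : I) {u : List (Letter φ)} (hu : IsReduced u) :
    vec u = glueVec i (splitHead i u).1 (splitHead i u).2 := by
  have h := lam_vec i 1 hu
  rwa [lam_one, piRep_one] at h

/-- Under `E = E_i ⊗ E(i)`, these weights cut only the factor in `E(i)`, and the head `η` stays in
the first leg. Decompose `η` into its part in `E_i°` and a multiple `ξ_i b`: the first part prefixes
a letter, whose extra length is undone by the shift in `headWeight`, and the second gives `b w`,
where the weights are not shifted. The coefficients are the same in both cases. -/
theorem cut_headWeight_glueVec {i : I} {k : ℕ} {r : ℝ}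
    (hc : ∀ t, weightForm (headWeight i k) (headWeight i k) t ≤ r ^ 2)
    (η : L2 (φ i)) {w : List (Letter φ)} (hw : StartsOff i w) :
    cut φ (headWeight i k) hc (glueVec i η w) = ∑ p ∈ Finset.range (w.length + 1),
      ((weight k w.length p : ℝ) : ℂ) • tens (glueVec i η (w.take p)) (w.drop p) 1 := by
  have h1 (ζ : L2o (φ i)) : cut φ (headWeight i k) hc (vec ((⟨i, ζ⟩ : Letter φ) :: w))
      = ∑ p ∈ Finset.range (w.length + 1), ((weight k w.length p : ℝ) : ℂ) •
        tens (vec ((⟨i, ζ⟩ : Letter φ) :: w.take p)) (w.drop p) 1 := by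
    have e : wordType ((⟨i, ζ⟩ : Letter φ) :: w) = i :: wordType w := rfl
    rw [cut_vec hc (hw.cons ζ), List.length_cons, Finset.sum_range_succ', e, headWeight_cons_zero,
      Complex.ofReal_zero, zero_smul, add_zero]
    refine Finset.sum_congr rfl fun p _ => ?_
    rw [headWeight_cons_succ, length_wordType, List.take_succ_cons, List.drop_succ_cons]
  have h2 (b : B) : cut φ (headWeight i k) hc (toHilbert (lactWord b w))
      = ∑ p ∈ Finset.range (w.length + 1), ((weight k w.length p : ℝ) : ℂ) •
        tens (toHilbert (C := Bᵐᵒᵖ) (lactWord b (w.take p))) (w.drop p) 1 := by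
    cases w with
    | nil =>
      have e : toHilbert (C := Bᵐᵒᵖ) (lactWord (φ := φ) b []) = op b • vec [] := by
        rw [lactWord, vec, ← toHilbert_op_smul, wordVec_of_reduced List.isChain_nil,
          wordVec_of_reduced List.isChain_nil, Finsupp.smul_single, op_smul_eq_mul, one_mul]
      rw [e, cut_op_smul_vec hc List.isChain_nil]
      simp only [List.length_nil, zero_add, Finset.sum_range_one, List.take_nil, List.drop_nil]
      rw [e, tens_nil, headWeight_of_ne (by simp [wordType]), length_wordType, List.length_nil,
        weight_zero_zero, Complex.ofReal_one, one_smul, one_smul]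
    | cons x w =>
      have hx : x.1 ≠ i := hw.2 x (by simp)
      have ht : wordType ((⟨x.1, acto (φ x.1) b x.2⟩ : Letter φ) :: w) = x.1 :: wordType w := rfl
      have e (v : List (Letter φ)) : toHilbert (C := Bᵐᵒᵖ) (lactWord b (x :: v))
          = vec ((⟨x.1, acto (φ x.1) b x.2⟩ : Letter φ) :: v) := rfl
      rw [e, cut_vec hc (hw.1.replace _), List.length_cons, List.length_cons]
      refine Finset.sum_congr rfl fun p _ => ?_
      rw [ht, headWeight_of_ne (by simpa using hx), List.length_cons, length_wordType]
      cases p with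
      -- At `p = 0` the letter carrying `b` would fall into the second leg, but a nonempty word
      -- gives this cut weight `0`.
      | zero => rw [weight_zero_right, Complex.ofReal_zero, zero_smul, zero_smul]
      | succ p =>
        rw [List.take_succ_cons, List.drop_succ_cons, List.take_succ_cons, List.drop_succ_cons, e]
  have h3 (v : List (Letter φ)) : glueVec i η v = vec ((⟨i, projo (φ i) η⟩ : Letter φ) :: v)
      + toHilbert (C := Bᵐᵒᵖ) (lactWord (ip (xi (φ i)) η) v) := by
    rw [glueVec, glue, toHilbert_add, vec]
  simp only [h3]
  rw [map_add, h1, h2, ← Finset.sum_add_distrib]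
  exact Finset.sum_congr rfl fun p _ => by rw [tens_add, smul_add]

theorem StartsOff.take {i : I} {w : List (Letter φ)} (hw : StartsOff i w) (p : ℕ) :
    StartsOff i (w.take p) := by
  refine ⟨hw.1.take p, fun x hx => hw.2 x ?_⟩
  cases p with
  | zero => simp at hx
  | succ p =>
    cases w with
    | nil => simp at hx
    | cons y w => simpa using hx

/-- The first legs `V_i (ζ ⊗ w₁)` arising from a reduced word are themselves reduced words, so
`lam_vec` computes `λ_i(a)` on them. -/
theorem exists_splitHead_take (i : I) {u : List (Letter φ)} (hu : IsReduced u) (p : ℕ) :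
    ∃ v, IsReduced v ∧ splitHead i v = ((splitHead i u).1, (splitHead i u).2.take p) := by
  rcases reduced_cases i hu with h | ⟨ζ, w, rfl, hw⟩
  · exact ⟨u.take p, hu.take p, by
      rw [splitHead_of_startsOff h, splitHead_of_startsOff (h.take p)]⟩
  · exact ⟨_, (hw.take p).cons ζ, by rw [splitHead_cons_same, splitHead_cons_same]⟩

/-- With the weights `headWeight i k`, cutting commutes with the action of `A_i`. -/
theorem amp_lam_cut_headWeight {i : I} {k : ℕ} {r : ℝ}
    (hc : ∀ t, weightForm (headWeight i k) (headWeight i k) t ≤ r ^ 2) (a : A i) :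
    (amp φ (lam φ i a)).toCLM ∘L cut φ (headWeight i k) hc
      = cut φ (headWeight i k) hc ∘L (lam φ i a).toCLM := by
  refine free_clm_ext fun u b hu => ?_
  rw [ContinuousLinearMap.comp_apply, ContinuousLinearMap.comp_apply,
    map_smul_of_adjoint (C := Bᵐᵒᵖ) (lam φ i a).inner_star, cut_op_smul, cut_op_smul,
    map_smul_of_adjoint (C := Bᵐᵒᵖ) (amp φ (lam φ i a)).inner_star]
  congr 1
  have hs := splitHead_startsOff i hu
  rw [lam_vec i a hu, cut_headWeight_glueVec hc _ hs, vec_eq_glueVec i hu,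
    cut_headWeight_glueVec hc _ hs, map_sum]
  refine Finset.sum_congr rfl fun p _ => ?_
  -- Both sides are now sums with the same weights over cuts `w = w₁ w₂` of the tail. It remains to
  -- apply `λ_i(a)` to each first leg, where it changes the head and leaves `w₁` alone.
  obtain ⟨v, hv, hv'⟩ := exists_splitHead_take i hu p
  have h1 := vec_eq_glueVec i hv
  have h2 := lam_vec i a hv
  rw [hv'] at h1 h2
  rw [map_smul, amp_tens, ← h1, h2]

theorem norm_amp_le (x : Adjointable Bᵐᵒᵖ (FreeProdModule φ ⊤)) : ‖amp φ x‖ ≤ ‖x‖ :=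
  NonUnitalStarAlgHom.norm_apply_le (amp φ) x

/-- Replace the cutting operator by the one with weights `headWeight i k`, which commutes with
`λ_i(a)` exactly. Only the difference `D`, of norm at most `√(3 / k)`, enters the commutator, once
on each side. -/
theorem norm_commutator_lam_le {k : ℕ} (hk : 0 < k) {r : ℝ}
    (hc : ∀ t, weightForm (lengthWeight I k) (lengthWeight I k) t ≤ r ^ 2) (i : I) (a : A i) :
    ‖(amp φ (lam φ i a)).toCLM ∘L cut φ (lengthWeight I k) hc
      - cut φ (lengthWeight I k) hc ∘L (lam φ i a).toCLM‖ ≤ 2 * ‖lam φ i a‖ * √(3 / k) := by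
  have hc' : ∀ t, weightForm (headWeight i k) (headWeight i k) t ≤ 1 ^ 2 := fun t => by
    rw [weightForm_headWeight hk, one_pow]
  set S := (amp φ (lam φ i a)).toCLM
  set T := (lam φ i a).toCLM
  set D := cut φ (lengthWeight I k - headWeight i k) (weightForm_sub_le hk i)
  have hD : ‖D‖ ≤ √(3 / k) := norm_cut_le (Real.sqrt_nonneg _) _
  have hS : ‖S‖ ≤ ‖lam φ i a‖ := norm_amp_le _
  have hT : ‖T‖ ≤ ‖lam φ i a‖ := le_rfl
  have e1 : cut φ (lengthWeight I k) hc = D + cut φ (headWeight i k) hc' := by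
    rw [← sub_eq_iff_eq_add]
    exact cut_sub _ _ _
  have e2 : S ∘L cut φ (headWeight i k) hc' = cut φ (headWeight i k) hc' ∘L T :=
    amp_lam_cut_headWeight hc' a
  rw [e1, ContinuousLinearMap.comp_add, ContinuousLinearMap.add_comp, e2, add_sub_add_right_eq_sub]
  calc _ ≤ ‖S ∘L D‖ + ‖D ∘L T‖ := norm_sub_le _ _
    _ ≤ ‖S‖ * ‖D‖ + ‖D‖ * ‖T‖ :=
      add_le_add (ContinuousLinearMap.opNorm_comp_le _ _) (ContinuousLinearMap.opNorm_comp_le _ _)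
    _ ≤ ‖lam φ i a‖ * √(3 / k) + √(3 / k) * ‖lam φ i a‖ := by gcongr
    _ = _ := by ring

end Commute

/-- From `V* V = 1` follows `a - V* S V = V* (V a - S V)`, and `V*` is a contraction because `V` is.
-/
theorem Adjointable.norm_sub_le_norm_commutator {C X Y : Type*} [CStarAlgebra C] [PartialOrder C]
    [StarOrderedRing C] [NormedAddCommGroup X] [NormedSpace ℂ X] [CompleteSpace X] [SMul C X]
    [CStarModule C X] [NormedAddCommGroup Y] [NormedSpace ℂ Y] [CompleteSpace Y] [SMul C Y]
    [CStarModule C Y] {V : X →L[ℂ] Y} {W : Y →L[ℂ] X}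
    (hVW : ∀ x y, inner C (V x) y = inner C x (W y)) (hV : ‖V‖ ≤ 1) (hWV : ∀ x, W (V x) = x)
    {a T : Adjointable C X} {S : Adjointable C Y} (hT : ∀ x, T.toCLM x = W (S.toCLM (V x))) :
    ‖a - T‖ ≤ ‖S.toCLM ∘L V - V ∘L a.toCLM‖ := by
  rw [← Adjointable.norm_toCLM]
  refine ContinuousLinearMap.opNorm_le_bound _ (norm_nonneg _) fun x => ?_
  have h := (S.toCLM ∘L V - V ∘L a.toCLM).le_opNorm x
  have hW : ‖W (V (a.toCLM x) - S.toCLM (V x))‖ ≤ ‖V (a.toCLM x) - S.toCLM (V x)‖ :=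
    (norm_le_of_inner_eq (C := C) fun z => hVW z _).trans
      (mul_le_of_le_one_left (norm_nonneg _) hV)
  rw [Adjointable.toCLM_sub, sub_apply, hT, ← hWV (a.toCLM x), ← map_sub]
  rw [sub_apply, ContinuousLinearMap.comp_apply, ContinuousLinearMap.comp_apply,
    norm_sub_rev] at h
  exact hW.trans h

section Approximation

variable {B : Type*} [CStarAlgebra B] [PartialOrder B] [StarOrderedRing B]
  {I : Type*} {A : I → Type*} [∀ i, CStarAlgebra (A i)]
  {j : ∀ i, B →⋆ₐ[ℂ] A i} {φ : ∀ i, CondExp (j i)}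

/-! ### The completely positive maps -/

theorem proj_incl {k : ℕ∞} (x : FreeProdModule φ k) : proj φ k (incl φ k x) = x := by
  refine hilbert_induction (p := fun x => proj φ k (incl φ k x) = x) x
    (isClosed_eq ((proj φ k).continuous.comp (incl φ k).continuous) continuous_id) fun f => ?_
  rw [incl, proj, extend_toHilbert, extend_toHilbert, projPre_inclPre]

theorem incl_proj_vec {k : ℕ} {u : List (Letter φ)} (hu : IsReduced u) (hk : u.length ≤ k) :
    incl φ k (proj φ k (vec u)) = vec u := by
  have h : incl φ (k : ℕ∞) (toHilbert (Finsupp.single ⟨u, hu, by exact_mod_cast hk⟩ 1))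
      = vec u := by
    rw [incl, extend_toHilbert, inclPre_single, toHilbert_single_word, op_one, one_smul]
    rfl
  rw [← h, proj_incl]

variable (φ) in
/-- The extension of operators on `E_(→k)` by zero. -/
def inflate (k : ℕ∞) : Adjointable Bᵐᵒᵖ (FreeProdModule φ k) →⋆ₙₐ[ℂ]
    Adjointable Bᵐᵒᵖ (FreeProdModule φ ⊤) where
  toFun := conj (proj φ k) (incl φ k) inner_proj
  map_smul' z S := map_smul (conj (proj φ k) (incl φ k) inner_proj) z S
  map_zero' := map_zero _
  map_add' S T := map_add _ S T
  map_mul' S T := Adjointable.toCLM_injective <| by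
    ext x
    change incl φ k (S.toCLM (T.toCLM (proj φ k x)))
      = incl φ k (S.toCLM (proj φ k (incl φ k (T.toCLM (proj φ k x)))))
    rw [proj_incl]
  map_star' S := (star_conj inner_proj S).symm

theorem inflate_apply {k : ℕ∞} (S : Adjointable Bᵐᵒᵖ (FreeProdModule φ k))
    (x : FreeProdModule φ ⊤) :
    (inflate φ k S).toCLM x = incl φ k (S.toCLM (proj φ k x)) := rfl

/-- With `P = inflate φ k 1` the projection onto `E_(→k)` inside `E`, compressing and extending by
zero is `a ↦ P a P`. -/
theorem inflate_compress {k : ℕ∞} (a : Adjointable Bᵐᵒᵖ (FreeProdModule φ ⊤)) :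
    inflate φ k (compress φ k a) = inflate φ k 1 * a * inflate φ k 1 := rfl

/-- `(P ⊗ 1) V = V`, because every first leg with nonzero weight has at most `k` letters and is
fixed by `P`. -/
theorem amp_inflate_one_cut {k : ℕ} {c : List I → ℕ → ℝ} {r : ℝ}
    (hc : ∀ t, weightForm c c t ≤ r ^ 2) (hck : ∀ t p, p ≤ t.length → k < p → c t p = 0)
    (x : FreeProdModule φ ⊤) :
    (amp φ (inflate φ k 1)).toCLM (cut φ c hc x) = cut φ c hc x := by
  have h : (amp φ (inflate φ k 1)).toCLM ∘L cut φ c hc = cut φ c hc := by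
    refine free_clm_ext fun u b hu => ?_
    rw [ContinuousLinearMap.comp_apply, cut_op_smul_vec hc hu,
      map_smul_of_adjoint (C := Bᵐᵒᵖ) (amp φ (inflate φ k 1)).inner_star, map_sum]
    congr 1
    refine Finset.sum_congr rfl fun p hp => ?_
    rw [Finset.mem_range] at hp
    rw [map_smul]
    by_cases hpk : k < p
    · rw [hck _ p (by rw [length_wordType]; omega) hpk, Complex.ofReal_zero, zero_smul, zero_smul]
    · rw [amp_tens, inflate_apply, Adjointable.toCLM_one, one_apply_eq_self,
        incl_proj_vec (hu.take p) (by rw [List.length_take]; omega)]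
  exact congrArg (fun T => T x) h

/-- Take `Ψ(T) = V* (T ⊗ 1) V` with `T` extended by zero. From `(P ⊗ 1) V = V` one gets `Ψ(1) = V* V
= 1` and `Ψ(Φ(a)) = V* (P a P ⊗ 1) V = V* (a ⊗ 1) V`, so that the commutator bound applies. -/
theorem exists_cp_of_weights {k : ℕ} {c : List I → ℕ → ℝ} (hc : ∀ t, weightForm c c t ≤ 1 ^ 2)
    (hc1 : ∀ t, weightForm c c t = 1) (hck : ∀ t p, p ≤ t.length → k < p → c t p = 0) :
    ∃ Ψ : CompletelyPositiveMap (Adjointable Bᵐᵒᵖ (FreeProdModule φ k))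
        (Adjointable Bᵐᵒᵖ (FreeProdModule φ ⊤)),
      Ψ 1 = 1 ∧ ∀ a, ‖a - Ψ (compress φ k a)‖
        ≤ ‖(amp φ a).toCLM ∘L cut φ c hc - cut φ c hc ∘L a.toCLM‖ := by
  obtain ⟨W, hW⟩ := exists_adjoint_cut (φ := φ) hc
  have hV := amp_inflate_one_cut (φ := φ) hc hck
  have hWV (x : FreeProdModule φ ⊤) : W (cut φ c hc x) = x := by
    refine Adjointable.ext_inner (C := Bᵐᵒᵖ) fun z => ?_
    rw [← hW]
    exact inner_cut_cut hc hc1 z x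
  -- The adjoint of `(P ⊗ 1) V = V`, as `P ⊗ 1` is self-adjoint.
  have hWP (y : TensModule φ) : W ((amp φ (inflate φ k 1)).toCLM y) = W y := by
    refine Adjointable.ext_inner (C := Bᵐᵒᵖ) fun z => ?_
    rw [← hW, ← hW, ← inner_adjoint_left (C := Bᵐᵒᵖ) (amp φ (inflate φ k 1)).inner_star,
      ← map_star, ← map_star, star_one, hV]
  have hap (S : Adjointable Bᵐᵒᵖ (FreeProdModule φ k)) (x : FreeProdModule φ ⊤) :
      (stinespring ((amp φ).comp (inflate φ k)) (cut φ c hc) W hW S).toCLM x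
        = W ((amp φ (inflate φ k S)).toCLM (cut φ c hc x)) := rfl
  refine ⟨stinespring ((amp φ).comp (inflate φ k)) (cut φ c hc) W hW, ?_, fun a => ?_⟩
  · refine Adjointable.toCLM_injective ?_
    ext x
    rw [hap, hV, hWV]
    rfl
  · refine Adjointable.norm_sub_le_norm_commutator hW (norm_cut_le zero_le_one hc) hWV fun x => ?_
    have e : (amp φ (inflate φ k (compress φ k a))).toCLM (cut φ c hc x)
        = (amp φ (inflate φ k 1)).toCLM ((amp φ a).toCLM (cut φ c hc x)) := by
      rw [inflate_compress, map_mul, map_mul, Adjointable.toCLM_mul, Adjointable.toCLM_mul,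
        mul_apply_eq_comp, mul_apply_eq_comp, hV]
    exact (hap _ x).trans ((congrArg W e).trans (hWP _))

/-! ### Asymptotic commutation -/

theorem weightForm_lengthWeight_le (k : ℕ) (t : List I) :
    weightForm (lengthWeight I (k + 1)) (lengthWeight I (k + 1)) t ≤ 1 ^ 2 := by
  rw [weightForm_lengthWeight k.succ_pos, one_pow]

variable (φ) in
/-- The isometry `V_{k+1} : E → E ⊗ E`. -/
def cutIso (k : ℕ) : FreeProdModule φ ⊤ →L[ℂ] TensModule φ :=
  cut φ (lengthWeight I (k + 1)) (weightForm_lengthWeight_le k)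

theorem norm_cutIso_le (k : ℕ) : ‖cutIso φ k‖ ≤ 1 := norm_cut_le zero_le_one _

/-- `(x ⊗ 1) V_{k+1} - V_{k+1} x`. -/
def commutator (k : ℕ) (x : Adjointable Bᵐᵒᵖ (FreeProdModule φ ⊤)) :
    FreeProdModule φ ⊤ →L[ℂ] TensModule φ :=
  (amp φ x).toCLM ∘L cutIso φ k - cutIso φ k ∘L x.toCLM

theorem commutator_add (k : ℕ) (x y : Adjointable Bᵐᵒᵖ (FreeProdModule φ ⊤)) :
    commutator k (x + y) = commutator k x + commutator k y := by
  simp only [commutator, map_add, Adjointable.toCLM_add, ContinuousLinearMap.add_comp,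
    ContinuousLinearMap.comp_add]
  abel

/-- The Leibniz rule; with the bound `‖x ⊗ 1‖ ≤ ‖x‖` it makes asymptotic commutation multiplicative.
-/
theorem commutator_mul (k : ℕ) (x y : Adjointable Bᵐᵒᵖ (FreeProdModule φ ⊤)) :
    commutator k (x * y)
      = (amp φ x).toCLM ∘L commutator k y + commutator k x ∘L y.toCLM := by
  ext z
  simp only [commutator, map_mul, Adjointable.toCLM_mul, ContinuousLinearMap.comp_apply,
    add_apply, sub_apply, mul_apply_eq_comp, map_sub]
  abel

/-- The bound is uniform in `k`, which lets asymptotic commutation pass to norm limits. -/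
theorem norm_commutator_le (k : ℕ) (x : Adjointable Bᵐᵒᵖ (FreeProdModule φ ⊤)) :
    ‖commutator k x‖ ≤ 2 * ‖x‖ := by
  have hV := norm_cutIso_le (φ := φ) k
  have hS : ‖(amp φ x).toCLM‖ ≤ ‖x‖ := norm_amp_le _
  have hT : ‖x.toCLM‖ ≤ ‖x‖ := le_rfl
  calc _ ≤ ‖(amp φ x).toCLM ∘L cutIso φ k‖ + ‖cutIso φ k ∘L x.toCLM‖ := norm_sub_le _ _
    _ ≤ ‖(amp φ x).toCLM‖ * ‖cutIso φ k‖ + ‖cutIso φ k‖ * ‖x.toCLM‖ :=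
      add_le_add (ContinuousLinearMap.opNorm_comp_le _ _) (ContinuousLinearMap.opNorm_comp_le _ _)
    _ ≤ ‖x‖ * 1 + 1 * ‖x‖ := by gcongr
    _ = _ := by ring

/-- `x` commutes asymptotically with the isometries `V_k`. -/
def AsympCommutes (x : Adjointable Bᵐᵒᵖ (FreeProdModule φ ⊤)) : Prop :=
  Filter.Tendsto (fun k => ‖commutator k x‖) Filter.atTop (nhds 0)

theorem AsympCommutes.add {x y : Adjointable Bᵐᵒᵖ (FreeProdModule φ ⊤)} (hx : AsympCommutes x)
    (hy : AsympCommutes y) : AsympCommutes (x + y) := by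
  refine squeeze_zero (fun k => norm_nonneg _) (fun k => ?_) (by simpa using Filter.Tendsto.add hx hy)
  rw [commutator_add]
  exact norm_add_le _ _

theorem AsympCommutes.mul {x y : Adjointable Bᵐᵒᵖ (FreeProdModule φ ⊤)} (hx : AsympCommutes x)
    (hy : AsympCommutes y) : AsympCommutes (x * y) := by
  have h := (Filter.Tendsto.const_mul ‖x‖ hy).add (Filter.Tendsto.mul_const ‖y‖ hx)
  rw [mul_zero, zero_mul, add_zero] at h
  refine squeeze_zero (fun k => norm_nonneg _) (fun k => ?_) h
  have hS : ‖(amp φ x).toCLM‖ ≤ ‖x‖ := norm_amp_le _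
  have hT : ‖y.toCLM‖ ≤ ‖y‖ := le_rfl
  rw [commutator_mul]
  calc _ ≤ ‖(amp φ x).toCLM‖ * ‖commutator k y‖ + ‖commutator k x‖ * ‖y.toCLM‖ :=
      (norm_add_le _ _).trans (add_le_add (ContinuousLinearMap.opNorm_comp_le _ _)
        (ContinuousLinearMap.opNorm_comp_le _ _))
    _ ≤ _ := by gcongr

theorem asympCommutes_smul_one (z : ℂ) :
    AsympCommutes (z • 1 : Adjointable Bᵐᵒᵖ (FreeProdModule φ ⊤)) := by
  have h (k : ℕ) : commutator k (z • 1 : Adjointable Bᵐᵒᵖ (FreeProdModule φ ⊤)) = 0 := by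
    have h1 : amp φ 1 = 1 := Adjointable.toCLM_injective <| tensModule_clm_ext fun x v b =>
      amp_tens 1 x v b
    rw [commutator, map_smul, h1]
    ext x
    simp [Adjointable.toCLM_smul]
  simp only [AsympCommutes, h, norm_zero]
  exact tendsto_const_nhds

theorem asympCommutes_lam (i : I) (a : A i) : AsympCommutes (lam φ i a) := by
  have h1 : Filter.Tendsto (fun k : ℕ => √(3 / ((k + 1 : ℕ) : ℝ))) Filter.atTop (nhds 0) := by
    have h2 : Filter.Tendsto (fun k : ℕ => 3 / ((k + 1 : ℕ) : ℝ)) Filter.atTop (nhds 0) :=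
      (Filter.tendsto_add_atTop_iff_nat (f := fun k : ℕ => 3 / (k : ℝ)) 1).mpr
        (tendsto_const_div_atTop_nhds_zero_nat 3)
    have h3 := (Real.continuous_sqrt.tendsto 0).comp h2
    rw [Real.sqrt_zero] at h3
    exact h3
  refine squeeze_zero (fun k => norm_nonneg _)
    (fun k => norm_commutator_lam_le k.succ_pos (weightForm_lengthWeight_le k) i a) ?_
  simpa using h1.const_mul (2 * ‖lam φ i a‖)

theorem isClosed_asympCommutes :
    IsClosed {x : Adjointable Bᵐᵒᵖ (FreeProdModule φ ⊤) | AsympCommutes x} := by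
  refine isClosed_of_closure_subset fun x hx => ?_
  change Filter.Tendsto _ _ _
  rw [Metric.tendsto_atTop]
  intro ε hε
  -- The commutator with `x - y` has norm at most `2 ‖x - y‖ < ε / 2`, which leaves `ε / 2` for the
  -- commutator with `y`.
  obtain ⟨y, hy, hxy⟩ := Metric.mem_closure_iff.mp hx (ε / 4) (by positivity)
  obtain ⟨N, hN⟩ := Metric.tendsto_atTop.mp hy (ε / 2) (by positivity)
  refine ⟨N, fun k hk => ?_⟩
  have h1 := hN k hk
  rw [Real.dist_0_eq_abs, abs_norm] at h1 ⊢
  have h2 := norm_commutator_le k (x - y)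
  have h3 : commutator k x = commutator k (x - y) + commutator k y := by
    rw [← commutator_add, sub_add_cancel]
  rw [dist_eq_norm] at hxy
  rw [h3]
  linarith [norm_add_le (commutator k (x - y)) (commutator k y)]

theorem asympCommutes_of_mem_freeProd {x : Adjointable Bᵐᵒᵖ (FreeProdModule φ ⊤)}
    (hx : x ∈ freeProd φ) : AsympCommutes x := by
  refine closure_minimal (fun y hy => ?_) isClosed_asympCommutes hx
  -- A small `(y ⊗ 1) V - V y` gives no direct control of the same expression for `y*`. The
  -- induction over the generated `*`-algebra therefore carries both, and the generators allow this
  -- since `λ_i(a)* = λ_i(a*)`.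
  suffices h : AsympCommutes y ∧ AsympCommutes (star y) from h.1
  refine StarAlgebra.adjoin_induction (p := fun y _ => AsympCommutes y ∧ AsympCommutes (star y))
    (fun y hy => ?_) (fun z => ?_) (fun x y _ _ hx hy => ?_) (fun x y _ _ hx hy => ?_)
    (fun x _ hx => ?_) hy
  · obtain ⟨i, a, rfl⟩ := Set.mem_iUnion.mp hy
    rw [star_lam]
    exact ⟨asympCommutes_lam i a, asympCommutes_lam i (star a)⟩
  · rw [Algebra.algebraMap_eq_smul_one, star_smul, star_one]
    exact ⟨asympCommutes_smul_one z, asympCommutes_smul_one (star z)⟩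
  · rw [star_add]
    exact ⟨hx.1.add hy.1, hx.2.add hy.2⟩
  · rw [star_mul]
    exact ⟨hx.1.mul hy.1, hy.2.mul hx.2⟩
  · rw [star_star]
    exact hx.symm

variable (φ) in
theorem exists_cp (k : ℕ) :
    ∃ Ψ : CompletelyPositiveMap (Adjointable Bᵐᵒᵖ (FreeProdModule φ (k : ℕ∞)))
        (Adjointable Bᵐᵒᵖ (FreeProdModule φ ⊤)),
      Ψ 1 = 1 ∧ ∀ m, k = m + 1 → ∀ a, ‖a - Ψ (compress φ k a)‖ ≤ ‖commutator m a‖ := by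
  cases k with
  | zero =>
    -- For `k = 0` only a unital completely positive map is required, the estimate being vacuous.
    -- All the mass is put on the cut at `p = 0`, so that `V u = ξ ⊗ u`.
    have h1 (t : List I) : weightForm (fun _ p => if p = 0 then (1 : ℝ) else 0)
        (fun _ p => if p = 0 then (1 : ℝ) else 0) t = 1 := by
      simp [weightForm]
    obtain ⟨Ψ, hΨ, -⟩ := exists_cp_of_weights (φ := φ) (k := 0) (fun t => by rw [h1, one_pow]) h1
      fun t p _ hp => if_neg hp.ne'
    exact ⟨Ψ, hΨ, fun m hm => by omega⟩
  | succ k =>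
    -- The weights with parameter `k + 1` have first legs in `E_(→k+1)`; they define `cutIso φ k`,
    -- whence the shift of index in the statement.
    obtain ⟨Ψ, hΨ, h⟩ := exists_cp_of_weights (φ := φ) (weightForm_lengthWeight_le k)
      (weightForm_lengthWeight k.succ_pos)
      fun t p hp hk => weight_eq_zero k.succ_pos hp hk
    refine ⟨Ψ, hΨ, fun m hm => ?_⟩
    obtain rfl : k = m := by omega
    exact h

end Approximation

end FreeProd

end

theorem lemma3p1 {B : Type*} [CStarAlgebra B] [PartialOrder B] [StarOrderedRing B]
    {I : Type*} [Nontrivial I] {A : I → Type*} [∀ i, CStarAlgebra (A i)]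
    (j : ∀ i, B →⋆ₐ[ℂ] A i) (φ : ∀ i, FreeProd.CondExp (j i))
    (hφ : ∀ i (a : A i), a ≠ 0 → ∃ x : A i, φ i (star x * star a * a * x) ≠ 0) :
    ∃ Ψ : ∀ k : ℕ, CompletelyPositiveMap
        (FreeProd.Adjointable Bᵐᵒᵖ (FreeProd.FreeProdModule φ (k : ℕ∞)))
        (FreeProd.Adjointable Bᵐᵒᵖ (FreeProd.FreeProdModule φ ⊤)),
      (∀ k, Ψ k 1 = 1) ∧
      ∀ a ∈ FreeProd.freeProd φ,
        Filter.Tendsto (fun k : ℕ => ‖a - Ψ k (FreeProd.compress φ (k : ℕ∞) a)‖)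
          Filter.atTop (nhds 0) := by
  choose Ψ hΨ h using FreeProd.exists_cp φ
  refine ⟨Ψ, hΨ, fun a ha => ?_⟩
  -- The estimate is available for positive indices only, so the sequence is shifted by one.
  refine (Filter.tendsto_add_atTop_iff_nat 1).mp ?_
  exact squeeze_zero (fun k => norm_nonneg _) (fun k => h (k + 1) k rfl a)
    (FreeProd.asympCommutes_of_mem_freeProd ha)
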